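/- **Theorem 5.4 (Compactness for the convection–diffusion problem).** Let $N\ge 1$, $T>0$, $r\in[1,\infty)$, and consider $$\partial_t u+\sum_{i=1}^N\partial_{x_i}f_i(u)-\mathfrak L[\varphi(u)]=g\ \text{ in }\mathbb R^N\times(0,T),\qquad u(\cdot,0)=u_0\ \text{ on }\mathbb R^N. \tag{CDE}$$ *Data.* Assume $f_1,\dots,f_N,\varphi\in W^{1,\infty}_{\rm loc}(\mathbb R)$ (that is, locally Lipschitz) with $\varphi$ nondecreasing, $u_0\in L^1(\mathbb R^N)\cap L^\infty(\mathbb R^N)$, and $g$ measurable with $\int_0^T\big(\|g(\cdot,t)\|_{L^1(\mathbb R^N)}+\|g(\cdot,t)\|_{L^\infty(\mathbb R^N)}\big)\,dt<\infty$. *Numerical flux.* Let $F=(F_1,\dots,F_N):\mathbb R^2\to\mathbb R^N$ be Lipschitz, $|F_i(a,b)-F_i(a',b')|\le L_F(|a-a'|+|b-b'|)$, consistent, $F_i(u,u)=f_i(u)$, nondecreasing in its first and nonincreasing in its second argument. *Grids.* For every $h\in(0,1)$ let $x_\beta=h\beta$ ($\beta\in\mathbb Z^N$), $R_h=h(-\frac12,\frac12]^N$,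 and let $0=t_0<t_1<\dots<t_J=T$ be a time grid (depending on $h$) with steps $\Delta t_j=t_j-t_{j-1}$ satisfying the CFL condition $2N L_F\,\Delta t_j\le h$ for $1\le j\le J$. *Discrete diffusion operators.* For every $h\in(0,1)$ let $$\mathcal L^h[\psi]_\beta=\sum_{\gamma\in\mathbb Z^N\setminus\{0\}}\big(\psi(x_\beta+z_\gamma)-\psi(x_\beta)\big)\omega_{\gamma,h},$$ with $z_{-\gamma}=-z_\gamma\in h\mathbb Z^N$, $\omega_{\gamma,h}=\omega_{-\gamma,h}\ge0$, $\sum_{\gamma\ne0}\omega_{\gamma,h}<\infty$, and $$(\mathrm A_{\omega_h})\qquad \sup_{0<h<1}\Big\{\sum_{h\le|z_\gamma|\le1}|z_\gamma|^2\omega_{\gamma,h}+\sum_{|z_\gamma|>1}\omega_{\gamma,h}\Big\}<\infty .$$ Assume that one of the following holds: 1. $\mathcal L^h=\Delta_h$ for all $h\in(0,1)$, where $\Delta_h\psi(x)=\sum_{i=1}^N h^{-2}\big(\psi(x+he_i)+\psi(x-he_i)-2\psi(x)\big)$; 2. $(\mathrm A_{\omega_h}')$: $\ \sup_{0<h<1}\big\{\sum_{h\le|z_\gamma|\le1}|z_\gamma|^2\omega_{\gamma,h}+\sum_{|z_\gamma|>1}|z_\gamma|\omega_{\gamma,h}\big\}<\infty$;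 3. $(\mathrm A_{\omega_h}'')$: for some $\alpha\in(0,2)$, $\ \sup_{R>1}\sup_{0<h<1}\big\{R^{\alpha-2}\sum_{1<|z_\gamma|\le R}|z_\gamma|^2\omega_{\gamma,h}+R^\alpha\sum_{|z_\gamma|>R}\omega_{\gamma,h}\big\}<\infty$. *Scheme.* For every $h\in(0,1)$ let $(U^j_\beta)$ satisfy $\sum_\beta|U^j_\beta|<\infty$ for $0\le j\le J$, $U^0_\beta=h^{-N}\int_{x_\beta+R_h}u_0\,dx$ and, for all $\beta\in\mathbb Z^N$ and $1\le j\le J$, $$U^j_\beta=U^{j-1}_\beta-\Delta t_j\sum_{i=1}^N D^-_{h,i}F_i(U^{j-1}_\beta,U^{j-1}_{\beta+e_i})+\Delta t_j\,\mathcal L^h[\varphi(U^j_\cdot)]_\beta+\Delta t_j\,G^j_\beta ,$$ where $D^-_{h,i}\phi_\beta=(\phi_\beta-\phi_{\beta-e_i})/h$ and $G^j_\beta=\frac1{h^N\Delta t_j}\int_{t_{j-1}}^{t_j}\int_{x_\beta+R_h}g(x,\tau)\,dx\,d\tau$. Let $\widetilde{\overline U}_h:\mathbb R^N\times[0,T]\to\mathbb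 R$ be the interpolant of $(U^j_\beta)$ that is constant in $x$ on each cell $x_\beta+R_h$ and linear in $t$ on each $[t_{j-1},t_j]$. *Conclusion.* Each $\widetilde{\overline U}_h$ with $h\in(0,1)$ belongs to $C([0,T];L^r(\mathbb R^N))$, and the family $\{\widetilde{\overline U}_h\}_{0<h<1}$ is precompact there: for every sequence $(h_k)$ in $(0,1)$ there are a subsequence $(h_{k_n})$ and a $u\in C([0,T];L^r(\mathbb R^N))$ such that $$\sup_{t\in[0,T]}\big\|\widetilde{\overline U}_{h_{k_n}}(\cdot,t)-u(\cdot,t)\big\|_{L^r(\mathbb R^N)}\to0\qquad(n\to\infty).$$ -/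

import Mathlib

open Set Filter Topology MeasureTheory
open scoped ENNReal NNReal

noncomputable section

namespace ConvDiff

/-- Multi-indices `β ∈ ℤ^N`. A function on the grid `h ℤ^N` is a function of the multi-index. -/
abbrev Idx (N : ℕ) := Fin N → ℤ

/-- The grid point `x_β = h β`. -/
def gridPoint {N : ℕ} (h : ℝ) (β : Idx N) : EuclideanSpace ℝ (Fin N) :=
  WithLp.toLp 2 fun i => h * (β i : ℝ)

/-- The cell `x_β + R_h` with `R_h = h (-1/2, 1/2]^N`. -/
def cell {N : ℕ} (h : ℝ) (β : Idx N) : Set (EuclideanSpace ℝ (Fin N)) :=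
  {x | ∀ i, x i - gridPoint h β i ∈ Ioc (-(h / 2)) (h / 2)}

/-- A (nonuniform) time grid `0 = t_0 < t_1 < ... < t_J = T`; the values `t j` for `j > J` play
no role. -/
structure TimeGrid (T : ℝ) where
  J : ℕ
  t : ℕ → ℝ
  t_zero : t 0 = 0
  t_last : t J = T
  t_lt : ∀ j < J, t j < t (j + 1)

/-- The time step from `t_j` to `t_{j+1}`. -/
def TimeGrid.step {T : ℝ} (τ : TimeGrid T) (j : ℕ) : ℝ := τ.t (j + 1) - τ.t j

/-- Discrete initial datum: the cell averages of `u₀`. -/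
def discInit {N : ℕ} (h : ℝ) (u₀ : EuclideanSpace ℝ (Fin N) → ℝ) (β : Idx N) : ℝ :=
  (h ^ N)⁻¹ * ∫ x in cell h β, u₀ x

/-- Discrete source term on the time interval `(t_j, t_{j+1}]`: the space-time averages of `g`. -/
def discSource {N : ℕ} {T : ℝ} (h : ℝ) (τ : TimeGrid T)
    (g : EuclideanSpace ℝ (Fin N) → ℝ → ℝ) (j : ℕ) (β : Idx N) : ℝ :=
  (h ^ N * τ.step j)⁻¹ * ∫ s in τ.t j..τ.t (j + 1), ∫ x in cell h β, g x s

/-- The operator `𝓛^h[ψ]_β = ∑_{γ ≠ 0} (ψ(x_β + z_γ) - ψ(x_β)) ω_γ` with `z_γ = h (z γ) ∈ h ℤ^N`. -/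
def latticeOp {N : ℕ} (z : Idx N → Idx N) (ω : Idx N → ℝ) (ψ : Idx N → ℝ) (β : Idx N) : ℝ :=
  ∑' γ : {γ : Idx N // γ ≠ 0}, (ψ (β + z γ) - ψ β) * ω γ

/-- The finite-difference Laplacian `Δ_h`. -/
def discLaplacian {N : ℕ} (h : ℝ) (ψ : Idx N → ℝ) (β : Idx N) : ℝ :=
  ∑ i, (ψ (β + Pi.single i 1) + ψ (β - Pi.single i 1) - 2 * ψ β) / h ^ 2

/-- Moments of the weights: `∑_{γ ≠ 0, |z_γ| ∈ S} |z_γ|^m ω_γ`, as an element of `[0, ∞]`. -/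
def weightSum {N : ℕ} (h : ℝ) (z : Idx N → Idx N) (ω : Idx N → ℝ) (S : Set ℝ) (m : ℕ) : ℝ≥0∞ :=
  ∑' γ : {γ : Idx N // γ ≠ 0},
    S.indicator (fun ρ => ENNReal.ofReal (ρ ^ m * ω γ)) ‖gridPoint h (z γ)‖

/-- Families (indexed by `h`) of bounded, symmetric, monotone lattice operators. -/
structure IsSymmetricStencil {N : ℕ} (z : ℝ → Idx N → Idx N) (ω : ℝ → Idx N → ℝ) : Prop where
  odd : ∀ h ∈ Ioo (0 : ℝ) 1, ∀ γ, γ ≠ 0 → z h (-γ) = -z h γ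
  symm : ∀ h ∈ Ioo (0 : ℝ) 1, ∀ γ, γ ≠ 0 → ω h (-γ) = ω h γ
  nonneg : ∀ h ∈ Ioo (0 : ℝ) 1, ∀ γ, γ ≠ 0 → 0 ≤ ω h γ
  summable : ∀ h ∈ Ioo (0 : ℝ) 1, Summable fun γ : {γ : Idx N // γ ≠ 0} => ω h γ

/-- Discrete Lévy condition, uniform in `0 < h < 1`. -/
def LevyWeights {N : ℕ} (z : ℝ → Idx N → Idx N) (ω : ℝ → Idx N → ℝ) : Prop :=
  IsSymmetricStencil z ω ∧ ∃ C : ℝ≥0, ∀ h ∈ Ioo (0 : ℝ) 1,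
    weightSum h (z h) (ω h) (Icc h 1) 2 + weightSum h (z h) (ω h) (Ioi 1) 0 ≤ C

/-- Discrete Lévy condition with a first moment at infinity, uniform in `0 < h < 1`. -/
def FirstMomentWeights {N : ℕ} (z : ℝ → Idx N → Idx N) (ω : ℝ → Idx N → ℝ) : Prop :=
  IsSymmetricStencil z ω ∧ ∃ C : ℝ≥0, ∀ h ∈ Ioo (0 : ℝ) 1,
    weightSum h (z h) (ω h) (Icc h 1) 2 + weightSum h (z h) (ω h) (Ioi 1) 1 ≤ C

/-- Discrete Lévy condition with fractional tails of some order `α ∈ (0,2)`, uniform in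
`0 < h < 1`. -/
def FractionalWeights {N : ℕ} (z : ℝ → Idx N → Idx N) (ω : ℝ → Idx N → ℝ) : Prop :=
  LevyWeights z ω ∧ ∃ α ∈ Ioo (0 : ℝ) 2, ∃ C : ℝ≥0, ∀ R : ℝ, 1 < R → ∀ h ∈ Ioo (0 : ℝ) 1,
    ENNReal.ofReal (R ^ (α - 2)) * weightSum h (z h) (ω h) (Ioc 1 R) 2
      + ENNReal.ofReal (R ^ α) * weightSum h (z h) (ω h) (Ioi R) 0 ≤ C

/-- `F` is a Lipschitz (constant `L`), consistent and monotone numerical flux for `f`. -/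
structure IsNumericalFlux {N : ℕ} (F : ℝ → ℝ → Fin N → ℝ) (f : Fin N → ℝ → ℝ) (L : ℝ≥0) :
    Prop where
  lipschitz : ∀ i a b a' b', |F a b i - F a' b' i| ≤ L * (|a - a'| + |b - b'|)
  consistent : ∀ i u, F u u i = f i u
  mono_left : ∀ i b, Monotone fun a => F a b i
  anti_right : ∀ i a, Antitone fun b => F a b i

/-- The backward difference `D⁻_{h,i}`. -/
def bwdDiff {N : ℕ} (h : ℝ) (i : Fin N) (Φ : Idx N → ℝ) (β : Idx N) : ℝ :=
  (Φ β - Φ (β - Pi.single i 1)) / h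

/-- The explicit convection term `∑_i D⁻_{h,i} F_i(U_β, U_{β+e_i})`. -/
def discConvection {N : ℕ} (h : ℝ) (F : ℝ → ℝ → Fin N → ℝ) (U : Idx N → ℝ) (β : Idx N) : ℝ :=
  ∑ i, bwdDiff h i (fun α => F (U α) (U (α + Pi.single i 1)) i) β

/-- `U` is a (summable) solution of the scheme with explicit convection and implicit diffusion;
`U j β` is the value `U_β^j`. -/
structure IsSchemeSolution {N : ℕ} {T : ℝ} (h : ℝ) (τ : TimeGrid T) (F : ℝ → ℝ → Fin N → ℝ)
    (φ : ℝ → ℝ) (z : Idx N → Idx N) (ω : Idx N → ℝ) (u₀ : EuclideanSpace ℝ (Fin N) → ℝ)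
    (g : EuclideanSpace ℝ (Fin N) → ℝ → ℝ) (U : ℕ → Idx N → ℝ) : Prop where
  summable : ∀ j ≤ τ.J, Summable fun β => |U j β|
  init : ∀ β, U 0 β = discInit h u₀ β
  step : ∀ j < τ.J, ∀ β, U (j + 1) β = U j β - τ.step j * discConvection h F (U j) β
    + τ.step j * latticeOp z ω (fun α => φ (U (j + 1) α)) β + τ.step j * discSource h τ g j β

/-- The piecewise constant interpolant in space. -/
def spaceInterp {N : ℕ} (h : ℝ) (V : Idx N → ℝ) (x : EuclideanSpace ℝ (Fin N)) : ℝ :=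
  ∑' β : Idx N, (cell h β).indicator (fun _ => V β) x

/-- The interpolant that is piecewise constant in space and piecewise linear in time. -/
def spaceTimeInterp {N : ℕ} {T : ℝ} (h : ℝ) (τ : TimeGrid T) (U : ℕ → Idx N → ℝ)
    (x : EuclideanSpace ℝ (Fin N)) (t : ℝ) : ℝ :=
  ({0} : Set ℝ).indicator (fun _ => spaceInterp h (U 0) x) t
    + ∑ j ∈ Finset.range τ.J, (Ioc (τ.t j) (τ.t (j + 1))).indicator
        (fun s => spaceInterp h (U j) x + (s - τ.t j) / τ.step j *
          (spaceInterp h (U (j + 1)) x - spaceInterp h (U j) x)) t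

end ConvDiff

end

/-! The theorem is Arzelà–Ascoli for curves in `L^r` (`exists_subseq_tsendsto_of_equicontinuous`
being replaced below by its exact form `exists_subseq_tendsto_of_equicontinuous`). It needs
estimates uniform in the mesh: a sup bound, small spatial translations, small tails, and
equicontinuity in time. Given the sup bound, `exists_eLpNorm_le_of_lintegral_le` passes from `L¹` to
`L^r`, so everything else is done in `L¹`.

Each time step is a monotone explicit convection step (this is where CFL enters) followed by an
implicit diffusion step, to which the maximum principle and Kato's inequality apply. Together they
give a weighted `ℓ¹` comparison of two solutions, `IsDiscreteSolution.tsum_weighted_sub_le`. Its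
weight `X` enters the error only through its grid differences and an upper bound for the operator
applied to `X`. With `X = 1` it is a contraction: comparing with zero bounds the mass, and comparing
with a translate carries the translation moduli of the data to all times. With `X` a cutoff at scale
`R` it controls tails. The error is then governed by `1/R` and by the truncated moment `∑ ω min(1,
|z|/R)²`; the three alternatives on the diffusion serve to make the latter small uniformly in `h`
(`UniformlyTight`).

Time regularity follows Kružkov (`IsDiscreteSolution.gridL1_sub_le`). Increments are averaged twice
over boxes of a fixed physical size. The averages absorb the differences in the convection and
diffusion terms, making the averaged increments Lipschitz in time up to the source, and removing the
averages costs only the spatial modulus of continuity.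

Finally, `totallyBounded_Lp_of_translation` provides compactness of the values by approximating with
step functions on finitely many cells. -/

noncomputable section

namespace ConvDiff

/-! ### Symmetric difference operators: summation by parts, Kato's inequality, maximum principle. -/

section Stencil

variable {N : ℕ} {ι : Type*}

/-- Symmetric, nonnegative, summable weights `a` at lattice displacements `ζ`. -/
structure SymStencil (ζ : ι → Idx N) (a : ι → ℝ) : Prop where
  nonneg : ∀ γ, 0 ≤ a γ
  summable : Summable a
  -- Symmetry is recorded as a bijection of the index set, not necessarily an involution; it serves
  -- only to reindex sums.
  exists_neg : ∃ σ : Equiv.Perm ι, ∀ γ, ζ (σ γ) = -ζ γ ∧ a (σ γ) = a γ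

/-- The difference operator with displacements `ζ` and weights `a`. -/
def stencilOp (ζ : ι → Idx N) (a : ι → ℝ) (ψ : Idx N → ℝ) (β : Idx N) : ℝ :=
  ∑' γ, (ψ (β + ζ γ) - ψ β) * a γ

variable {ζ : ι → Idx N} {a : ι → ℝ}

lemma exists_bound_of_summable {κ : Type*} {ψ : κ → ℝ} (h : Summable ψ) :
    ∃ C, 0 ≤ C ∧ ∀ β, |ψ β| ≤ C :=
  ⟨∑' β, |ψ β|, tsum_nonneg fun _ => abs_nonneg _,
    fun β => h.abs.le_tsum β fun _ _ => abs_nonneg _⟩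

lemma summable_stencil_term (ha : ∀ γ, 0 ≤ a γ) (hs : Summable a) {ψ : Idx N → ℝ} {C : ℝ}
    (hψ : ∀ β, |ψ β| ≤ C) (β : Idx N) : Summable fun γ => (ψ (β + ζ γ) - ψ β) * a γ := by
  refine Summable.of_norm_bounded (hs.mul_left (2 * C)) fun γ => ?_
  rw [Real.norm_eq_abs, abs_mul, abs_of_nonneg (ha γ)]
  refine mul_le_mul_of_nonneg_right ?_ (ha γ)
  calc _ ≤ |ψ (β + ζ γ)| + |ψ β| := abs_sub _ _
    _ ≤ 2 * C := by linarith [hψ (β + ζ γ), hψ β]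

lemma stencilOp_sub (ha : ∀ γ, 0 ≤ a γ) (hs : Summable a) {ψ χ : Idx N → ℝ} {C C' : ℝ}
    (hψ : ∀ β, |ψ β| ≤ C) (hχ : ∀ β, |χ β| ≤ C') (β : Idx N) :
    stencilOp ζ a (fun β => ψ β - χ β) β = stencilOp ζ a ψ β - stencilOp ζ a χ β := by
  unfold stencilOp
  rw [← (summable_stencil_term ha hs hψ β).tsum_sub (summable_stencil_term ha hs hχ β)]
  exact tsum_congr fun γ => by ring

lemma stencilOp_sub_const (ψ : Idx N → ℝ) (c : ℝ) (β : Idx N) :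
    stencilOp ζ a (fun β => ψ β - c) β = stencilOp ζ a ψ β := by
  simp [stencilOp]

lemma stencilOp_shift (ψ : Idx N → ℝ) (η β : Idx N) :
    stencilOp ζ a (fun β => ψ (β + η)) β = stencilOp ζ a ψ (β + η) := by
  simp only [stencilOp, add_right_comm]

/-- Reindexing by `σ` reverses all displacements without changing the operator; averaging both forms
leaves second differences, the source of all later bounds quadratic in the displacement. -/
lemma stencilOp_eq_half_second_diff (hS : SymStencil ζ a) {ψ : Idx N → ℝ} {C : ℝ}
    (hψ : ∀ β, |ψ β| ≤ C) (β : Idx N) :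
    stencilOp ζ a ψ β = ∑' γ, (ψ (β + ζ γ) + ψ (β - ζ γ) - 2 * ψ β) * (a γ / 2) := by
  obtain ⟨σ, hσ⟩ := hS.exists_neg
  have h1 := summable_stencil_term (ζ := ζ) hS.nonneg hS.summable hψ β
  have h2 : stencilOp ζ a ψ β = ∑' γ, (ψ (β - ζ γ) - ψ β) * a γ := by
    rw [stencilOp, ← σ.tsum_eq]
    exact tsum_congr fun γ => by rw [(hσ γ).1, (hσ γ).2, ← sub_eq_add_neg]
  have h3 : Summable fun γ => (ψ (β - ζ γ) - ψ β) * a γ := by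
    refine (σ.summable_iff.2 h1).congr fun γ => ?_
    simp only [Function.comp_apply]
    rw [(hσ γ).1, (hσ γ).2, ← sub_eq_add_neg]
  have h4 : stencilOp ζ a ψ β = (1 / 2) * (stencilOp ζ a ψ β + stencilOp ζ a ψ β) := by ring
  rw [h4]
  nth_rw 2 [h2]
  rw [stencilOp, ← h1.tsum_add h3, ← tsum_mul_left]
  exact tsum_congr fun γ => by ring

/-- Summation by parts for symmetric stencils. -/
lemma hasSum_mul_stencilOp (hS : SymStencil ζ a) {V X : Idx N → ℝ} {C : ℝ} (hV : Summable V)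
    (hX : ∀ β, |X β| ≤ C) :
    (Summable fun β => X β * stencilOp ζ a V β) ∧
      ∑' β, X β * stencilOp ζ a V β = ∑' β, V β * stencilOp ζ a X β := by
  obtain ⟨σ, hσ⟩ := hS.exists_neg
  have hσ' : ∀ γ, ζ (σ.symm γ) = -ζ γ ∧ a (σ.symm γ) = a γ := fun γ => by
    have := hσ (σ.symm γ)
    rw [Equiv.apply_symm_apply] at this
    exact ⟨by rw [this.1, neg_neg], this.2.symm⟩
  have hC : 0 ≤ C := (abs_nonneg _).trans (hX 0)
  have hprod : Summable fun p : Idx N × ι => C * (|V p.1| * a p.2) :=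
    (hV.abs.mul_of_nonneg hS.summable (fun _ => abs_nonneg _) hS.nonneg).mul_left C
  let f1 : Idx N × ι → ℝ := fun p => V p.1 * X (p.1 + ζ p.2) * a p.2
  let f2 : Idx N × ι → ℝ := fun p => V p.1 * X p.1 * a p.2
  have hf (Y : Idx N × ι → ℝ) (hY : ∀ p, |Y p| ≤ C) :
      Summable fun p : Idx N × ι => V p.1 * Y p * a p.2 := by
    refine Summable.of_norm_bounded hprod fun p => ?_
    rw [Real.norm_eq_abs, abs_mul, abs_mul, abs_of_nonneg (hS.nonneg _)]
    have := mul_le_mul_of_nonneg_left (hY p) (abs_nonneg (V p.1))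
    nlinarith [hS.nonneg p.2]
  have hf1 : Summable f1 := hf (fun p => X (p.1 + ζ p.2)) fun p => hX _
  have hf2 : Summable f2 := hf (fun p => X p.1) fun p => hX _
  -- `e` reverses a jump: the jump from `β` along `ζ γ` becomes the one from `β + ζ γ` along `ζ (σ
  -- γ) = -ζ γ`. Invariance of the double sum of `f1` under `e` is the whole summation by parts.
  let e : Idx N × ι ≃ Idx N × ι :=
    { toFun := fun p => (p.1 + ζ p.2, σ p.2)
      invFun := fun p => (p.1 + ζ p.2, σ.symm p.2)
      left_inv := fun p => by simp [(hσ p.2).1]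
      right_inv := fun p => by simp [(hσ' p.2).1] }
  have he : ∀ p, f1 (e p) = X p.1 * V (p.1 + ζ p.2) * a p.2 := fun p => by
    simp only [f1, e, Equiv.coe_fn_mk, (hσ p.2).1, (hσ p.2).2, add_neg_cancel_right]
    ring
  have hf1e : Summable (f1 ∘ e) := e.summable_iff.2 hf1
  have hB : Summable fun p => f1 (e p) - f2 p := hf1e.sub hf2
  have hCs : Summable fun p => f1 p - f2 p := hf1.sub hf2
  have hBrow : ∀ β, ∑' γ, (f1 (e (β, γ)) - f2 (β, γ)) = X β * stencilOp ζ a V β := fun β => by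
    rw [stencilOp, ← tsum_mul_left]
    exact tsum_congr fun γ => by rw [he]; simp only [f2]; ring
  have hCrow : ∀ β, ∑' γ, (f1 (β, γ) - f2 (β, γ)) = V β * stencilOp ζ a X β := fun β => by
    rw [stencilOp, ← tsum_mul_left]
    exact tsum_congr fun γ => by simp only [f1, f2]; ring
  refine ⟨hB.prod.congr hBrow, ?_⟩
  rw [← tsum_congr hBrow, ← tsum_congr hCrow, ← hB.tsum_prod, ← hCs.tsum_prod, hf1.tsum_sub hf2,
    Summable.tsum_sub (f := fun p => f1 (e p)) hf1e hf2]
  congr 1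
  exact e.tsum_eq f1

/-- Kato's inequality for difference operators. -/
lemma abs_le_of_kato (ha : ∀ γ, 0 ≤ a γ) (hs : Summable a) {ψ : Idx N → ℝ} {C : ℝ}
    (hψ : ∀ β, |ψ β| ≤ C) {Δ d w : ℝ} (hΔ : 0 ≤ Δ) {β : Idx N}
    (heq : d = w + Δ * stencilOp ζ a ψ β) (hsign : 0 ≤ d ∧ 0 ≤ ψ β ∨ d ≤ 0 ∧ ψ β ≤ 0) :
    |d| ≤ |w| + Δ * stencilOp ζ a (fun β => |ψ β|) β := by
  have habs : ∀ β, |(fun β => |ψ β|) β| ≤ C := fun β => by simpa using hψ β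
  have h1 := summable_stencil_term (ζ := ζ) ha hs hψ β
  have h2 := summable_stencil_term (ζ := ζ) ha hs habs β
  -- Multiply the equation by the common sign of `d` and `ψ β`: both become absolute values, and the
  -- signed neighbour `ψ (β + ζ γ)` is at most its absolute value.
  rcases hsign with ⟨hd, hb⟩ | ⟨hd, hb⟩
  · have : stencilOp ζ a ψ β ≤ stencilOp ζ a (fun β => |ψ β|) β :=
      h1.tsum_le_tsum (fun γ => mul_le_mul_of_nonneg_right
        (by simp only [abs_of_nonneg hb]; linarith [le_abs_self (ψ (β + ζ γ))]) (ha γ)) h2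
    rw [abs_of_nonneg hd, heq]
    linarith [le_abs_self w, mul_le_mul_of_nonneg_left this hΔ]
  · have : -stencilOp ζ a ψ β ≤ stencilOp ζ a (fun β => |ψ β|) β := by
      rw [stencilOp, stencilOp, ← tsum_neg]
      exact h1.neg.tsum_le_tsum (fun γ => by
        rw [← neg_mul]
        exact mul_le_mul_of_nonneg_right
          (by simp only [abs_of_nonpos hb]; linarith [neg_le_abs (ψ (β + ζ γ))]) (ha γ)) h2
    rw [abs_of_nonpos hd, heq]
    linarith [neg_le_abs w, mul_le_mul_of_nonneg_left this hΔ]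

lemma Summable.mul_abs_of_bounded {κ : Type*} {X V : κ → ℝ} {C : ℝ} (hV : Summable V)
    (hX : ∀ β, |X β| ≤ C) : Summable fun β => X β * V β := by
  refine Summable.of_norm_bounded (hV.abs.mul_left C) fun β => ?_
  rw [Real.norm_eq_abs, abs_mul]
  exact mul_le_mul_of_nonneg_right (hX β) (abs_nonneg _)

/-- Weighted `ℓ¹` estimate for an implicit diffusion step. -/
lemma tsum_weighted_le_of_implicit (hS : SymStencil ζ a) {ψ D W X : Idx N → ℝ} {Δ ε : ℝ}
    (hΔ : 0 ≤ Δ) (hψ : Summable ψ) (hD : Summable D) (hW : Summable W)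
    (hX0 : ∀ β, 0 ≤ X β) (hX1 : ∀ β, X β ≤ 1) (hLX : ∀ β, stencilOp ζ a X β ≤ ε)
    (heq : ∀ β, D β = W β + Δ * stencilOp ζ a ψ β)
    (hsign : ∀ β, 0 ≤ D β ∧ 0 ≤ ψ β ∨ D β ≤ 0 ∧ ψ β ≤ 0) :
    ∑' β, X β * |D β| ≤ ∑' β, X β * |W β| + Δ * (ε * ∑' β, |ψ β|) := by
  have hX : ∀ β, |X β| ≤ 1 := fun β => by rw [abs_of_nonneg (hX0 β)]; exact hX1 β
  obtain ⟨C, -, hC⟩ := exists_bound_of_summable hψ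
  obtain ⟨hs1, hs2⟩ := hasSum_mul_stencilOp hS hψ.abs hX
  have hs3 := Summable.mul_abs_of_bounded hW.abs hX
  calc ∑' β, X β * |D β|
      ≤ ∑' β, (X β * |W β| + Δ * (X β * stencilOp ζ a (fun β => |ψ β|) β)) := by
        refine (Summable.mul_abs_of_bounded hD.abs hX).tsum_le_tsum (fun β => ?_)
          (hs3.add (hs1.mul_left Δ))
        have := mul_le_mul_of_nonneg_left
          (abs_le_of_kato hS.nonneg hS.summable hC hΔ (heq β) (hsign β)) (hX0 β)
        linarith
    -- Summation by parts moves the operator from `|ψ|` onto `X`, where it is bounded by `ε`.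
    _ = ∑' β, X β * |W β| + Δ * ∑' β, |ψ β| * stencilOp ζ a X β := by
        rw [hs3.tsum_add (hs1.mul_left Δ), tsum_mul_left, hs2]
    _ ≤ _ := by
        gcongr
        rw [← tsum_mul_left]
        have hsX : Summable fun β => |ψ β| * stencilOp ζ a X β := by
          refine Summable.of_norm_bounded (hψ.abs.mul_right (∑' γ, 2 * a γ)) fun β => ?_
          rw [norm_mul, Real.norm_eq_abs, abs_abs]
          refine mul_le_mul_of_nonneg_left ?_ (abs_nonneg _)
          refine tsum_of_norm_bounded (hS.summable.mul_left 2).hasSum fun γ => ?_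
          rw [Real.norm_eq_abs, abs_mul, abs_of_nonneg (hS.nonneg γ)]
          refine mul_le_mul_of_nonneg_right ?_ (hS.nonneg γ)
          exact (abs_sub _ _).trans (by linarith [hX (β + ζ γ), hX β])
        refine hsX.tsum_le_tsum (fun β => ?_) (hψ.abs.mul_left ε)
        rw [mul_comm]
        exact mul_le_mul_of_nonneg_right (hLX β) (abs_nonneg _)

/-- Maximum principle for an implicit diffusion step. -/
lemma abs_le_of_implicit (ha : ∀ γ, 0 ≤ a γ) {U W : Idx N → ℝ}
    {φ : ℝ → ℝ} (hφ : Monotone φ) {Δ M : ℝ} (hΔ : 0 ≤ Δ) (hU : Summable U)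
    (hW : ∀ β, |W β| ≤ M)
    (heq : ∀ β, U β = W β + Δ * stencilOp ζ a (fun β => φ (U β)) β) (β : Idx N) :
    |U β| ≤ M := by
  by_contra! hlt
  have hM : 0 ≤ M := (abs_nonneg _).trans (hW 0)
  -- Summability makes this superlevel set finite, so `|U|` attains its maximum on the infinite
  -- lattice.
  have hfin : {α | |U β| ≤ |U α|}.Finite := by
    have := hU.abs.tendsto_cofinite_zero.eventually (gt_mem_nhds (hM.trans_lt hlt))
    rw [Filter.eventually_cofinite] at this
    simpa using this
  obtain ⟨m, hm, hmax⟩ := Set.exists_max_image _ (fun α => |U α|) hfin ⟨β, le_refl |U β|⟩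
  have hmax' : ∀ α, |U α| ≤ |U m| := fun α => by
    by_cases h : |U β| ≤ |U α|
    · exact hmax α h
    · exact (not_le.1 h).le.trans hm
  have hmM : M < |U m| := hlt.trans_le hm
  -- Since `φ` is monotone, an extremum of `U` is one of `φ ∘ U`; the operator there has the sign
  -- that forces `|U m| ≤ |W m|`.
  rcases le_total 0 (U m) with h0 | h0
  · have : stencilOp ζ a (fun β => φ (U β)) m ≤ 0 := tsum_nonpos fun γ =>
      mul_nonpos_of_nonpos_of_nonneg (sub_nonpos.2 (hφ
        ((le_abs_self _).trans ((hmax' _).trans (abs_of_nonneg h0).le)))) (ha γ)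
    have h1 := heq m
    rw [abs_of_nonneg h0] at hmM
    nlinarith [le_abs_self (W m), hW m]
  · have : 0 ≤ stencilOp ζ a (fun β => φ (U β)) m := tsum_nonneg fun γ =>
      mul_nonneg (sub_nonneg.2 (hφ (by
        have h2 := hmax' (m + ζ γ)
        rw [abs_of_nonpos h0] at h2
        linarith [neg_le_abs (U (m + ζ γ))]))) (ha γ)
    have h1 := heq m
    rw [abs_of_nonpos h0] at hmM
    nlinarith [neg_le_abs (W m), hW m]

end Stencil

/-! ### The explicit convection step: monotonicity under CFL and weighted contraction. -/

section Explicit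

variable {N : ℕ} {F : ℝ → ℝ → Fin N → ℝ} {f : Fin N → ℝ → ℝ} {L : ℝ≥0}

/-- The explicit convection step with `c = Δt / h`. -/
def explicitStep (c : ℝ) (F : ℝ → ℝ → Fin N → ℝ) (U : Idx N → ℝ) (β : Idx N) : ℝ :=
  U β - c * ∑ i, (F (U β) (U (β + Pi.single i 1)) i - F (U (β - Pi.single i 1)) (U β) i)

/-- Raising the neighbours raises the result by monotonicity of the flux. Raising the centre value
changes the flux difference in each direction by at most `2 L (V β - U β)`, and over `N` directions
CFL lets the term `U β` absorb this. -/
lemma explicitStep_mono (hF : IsNumericalFlux F f L) {c : ℝ} (hc : 0 ≤ c)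
    (hCFL : 2 * N * L * c ≤ 1) {U V : Idx N → ℝ} (hUV : ∀ β, U β ≤ V β) (β : Idx N) :
    explicitStep c F U β ≤ explicitStep c F V β := by
  unfold explicitStep
  have key : ∀ i : Fin N, (F (V β) (V (β + Pi.single i 1)) i - F (V (β - Pi.single i 1)) (V β) i)
      - (F (U β) (U (β + Pi.single i 1)) i - F (U (β - Pi.single i 1)) (U β) i)
      ≤ 2 * L * (V β - U β) := fun i => by
    have h1 : F (V β) (V (β + Pi.single i 1)) i ≤ F (V β) (U (β + Pi.single i 1)) i :=
      hF.anti_right i _ (hUV _)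
    have h2 : F (U (β - Pi.single i 1)) (V β) i ≤ F (V (β - Pi.single i 1)) (V β) i :=
      hF.mono_left i _ (hUV _)
    have h3 := (le_abs_self _).trans
      (hF.lipschitz i (V β) (U (β + Pi.single i 1)) (U β) (U (β + Pi.single i 1)))
    have h4 := (le_abs_self _).trans
      (hF.lipschitz i (U (β - Pi.single i 1)) (U β) (U (β - Pi.single i 1)) (V β))
    rw [sub_self, abs_zero, add_zero, abs_of_nonneg (sub_nonneg.2 (hUV β))] at h3
    rw [sub_self, abs_zero, zero_add, abs_sub_comm, abs_of_nonneg (sub_nonneg.2 (hUV β))] at h4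
    linarith
  have hsum := Finset.sum_le_sum fun i (_ : i ∈ Finset.univ) => key i
  rw [Finset.sum_sub_distrib, Finset.sum_const, Finset.card_univ, Fintype.card_fin,
    nsmul_eq_mul] at hsum
  have h0 : 0 ≤ V β - U β := sub_nonneg.2 (hUV β)
  have := mul_le_mul_of_nonneg_left hsum hc
  nlinarith [mul_le_mul_of_nonneg_right hCFL h0]

lemma explicitStep_const (c k : ℝ) (β : Idx N) : explicitStep c F (fun _ => k) β = k := by
  simp [explicitStep]

/-- Constants are fixed by the step, so monotone comparison with `-M` and `M` suffices. -/
lemma abs_explicitStep_le (hF : IsNumericalFlux F f L) {c : ℝ} (hc : 0 ≤ c)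
    (hCFL : 2 * N * L * c ≤ 1) {U : Idx N → ℝ} {M : ℝ} (hU : ∀ β, |U β| ≤ M) (β : Idx N) :
    |explicitStep c F U β| ≤ M := by
  rw [abs_le]
  constructor
  · rw [← explicitStep_const (F := F) c (-M) β]
    exact explicitStep_mono hF hc hCFL (fun β => (abs_le.1 (hU β)).1) β
  · rw [← explicitStep_const (F := F) c M β]
    exact explicitStep_mono hF hc hCFL (fun β => (abs_le.1 (hU β)).2) β

lemma summable_shift {V : Idx N → ℝ} (hV : Summable V) (η : Idx N) :
    Summable fun β => V (β + η) := (Equiv.addRight η).summable_iff.2 hV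

lemma summable_flux_diff (hF : IsNumericalFlux F f L) {U V : Idx N → ℝ}
    (h : Summable fun β => U β - V β) (η : Idx N) (i : Fin N) :
    Summable fun β => F (U β) (U (β + η)) i - F (V β) (V (β + η)) i := by
  refine Summable.of_norm_bounded ((h.abs.add (summable_shift h.abs η)).mul_left (L : ℝ))
    fun β => hF.lipschitz i _ _ _ _

/-- Weighted `ℓ¹` contraction for an explicit convection step. -/
lemma tsum_weighted_explicitStep_le (hF : IsNumericalFlux F f L) {c : ℝ} (hc : 0 ≤ c)
    (hCFL : 2 * N * L * c ≤ 1) {U V X : Idx N → ℝ} (hUV : Summable fun β => U β - V β) {κ : ℝ}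
    (hX0 : ∀ β, 0 ≤ X β) (hX1 : ∀ β, X β ≤ 1)
    (hκ : ∀ β i, |X (β + Pi.single i 1) - X β| ≤ κ) :
    (Summable fun β => explicitStep c F U β - explicitStep c F V β) ∧
    ∑' β, X β * |explicitStep c F U β - explicitStep c F V β|
      ≤ ∑' β, X β * |U β - V β| + c * (N * (κ * (2 * L * ∑' β, |U β - V β|))) := by
  have hX : ∀ β, |X β| ≤ 1 := fun β => by rw [abs_of_nonneg (hX0 β)]; exact hX1 β
  -- Crandall–Tartar idea: by monotonicity, the steps of `U` and `V` both lie between those of their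
  -- minimum `Q` and maximum `P`. The gap between the latter is `|U - V|` minus a discrete
  -- divergence of `q`.
  set P : Idx N → ℝ := fun β => max (U β) (V β) with hP
  set Q : Idx N → ℝ := fun β => min (U β) (V β) with hQ
  have hPQ : ∀ β, P β - Q β = |U β - V β| := fun β => max_sub_min_eq_abs' _ _
  have hPQs : Summable fun β => P β - Q β := hUV.abs.congr fun β => (hPQ β).symm
  let q : Fin N → Idx N → ℝ := fun i β =>
    F (P β) (P (β + Pi.single i 1)) i - F (Q β) (Q (β + Pi.single i 1)) i
  have hq : ∀ i, Summable (q i) := fun i => summable_flux_diff hF hPQs _ i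
  have hqabs : ∀ i, ∑' β, |q i β| ≤ 2 * L * ∑' β, |U β - V β| := fun i => by
    have e1 : ∑' β : Idx N, |U (β + Pi.single i 1) - V (β + Pi.single i 1)|
        = ∑' β, |U β - V β| :=
      (Equiv.addRight (Pi.single i (1 : ℤ) : Idx N)).tsum_eq fun β => |U β - V β|
    have hs' := summable_shift hUV.abs (Pi.single i (1 : ℤ) : Idx N)
    calc ∑' β, |q i β| ≤ ∑' β : Idx N,
          (L : ℝ) * (|U β - V β| + |U (β + Pi.single i 1) - V (β + Pi.single i 1)|) := by
          refine (hq i).abs.tsum_le_tsum (fun β => ?_) ((hUV.abs.add hs').mul_left (L : ℝ))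
          have := hF.lipschitz i (P β) (P (β + Pi.single i 1)) (Q β) (Q (β + Pi.single i 1))
          rwa [hPQ, hPQ, abs_abs, abs_abs] at this
      _ = 2 * L * ∑' β, |U β - V β| := by
          rw [tsum_mul_left, hUV.abs.tsum_add hs', e1]; ring
  have hstep : ∀ β, explicitStep c F P β - explicitStep c F Q β
      = |U β - V β| - c * ∑ i, (q i β - q i (β - Pi.single i 1)) := fun β => by
    have : ∑ i, (q i β - q i (β - Pi.single i 1)) =
      ∑ i, (F (P β) (P (β + Pi.single i 1)) i - F (P (β - Pi.single i 1)) (P β) i)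
      - ∑ i, (F (Q β) (Q (β + Pi.single i 1)) i - F (Q (β - Pi.single i 1)) (Q β) i) := by
      rw [← Finset.sum_sub_distrib]
      refine Finset.sum_congr rfl fun i _ => ?_
      simp only [q, sub_add_cancel]
      ring
    rw [this, ← hPQ, explicitStep, explicitStep]
    ring
  have hdom : ∀ β, |explicitStep c F U β - explicitStep c F V β|
      ≤ |U β - V β| - c * ∑ i, (q i β - q i (β - Pi.single i 1)) := fun β => by
    rw [← hstep, abs_le]
    have a1 := explicitStep_mono hF hc hCFL (U := U) (V := P) (fun β => le_max_left _ _) β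
    have a2 := explicitStep_mono hF hc hCFL (U := V) (V := P) (fun β => le_max_right _ _) β
    have a3 := explicitStep_mono hF hc hCFL (U := Q) (V := U) (fun β => min_le_left _ _) β
    have a4 := explicitStep_mono hF hc hCFL (U := Q) (V := V) (fun β => min_le_right _ _) β
    constructor <;> linarith
  have hqs : ∀ i, Summable fun β => q i (β - Pi.single i 1) := fun i => by
    have := summable_shift (hq i) (-Pi.single i (1 : ℤ))
    exact this.congr fun β => by rw [sub_eq_add_neg]
  have hqd : Summable fun β => ∑ i, (q i β - q i (β - Pi.single i 1)) :=
    summable_sum fun i _ => (hq i).sub (hqs i)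
  have hS1 : Summable fun β => explicitStep c F U β - explicitStep c F V β :=
    Summable.of_norm_bounded (hUV.abs.sub (hqd.mul_left c)) hdom
  refine ⟨hS1, ?_⟩
  -- Summation by parts puts the difference on `X`, so the divergence costs only the variation `κ`
  -- of the weight.
  have hparts : ∀ i, Summable (fun β => X β * (q i β - q i (β - Pi.single i 1))) ∧
      ∑' β, X β * (q i β - q i (β - Pi.single i 1))
        = ∑' β, (X β - X (β + Pi.single i 1)) * q i β := fun i => by
    have b1 := Summable.mul_abs_of_bounded (hq i) hX
    have b2 := Summable.mul_abs_of_bounded (hqs i) hX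
    have b3 : Summable fun β => X (β + Pi.single i 1) * q i β :=
      Summable.mul_abs_of_bounded (hq i) fun β => hX _
    have b4 : ∑' β, X β * q i (β - Pi.single i 1) = ∑' β, X (β + Pi.single i 1) * q i β := by
      refine ((Equiv.addRight (Pi.single i (1 : ℤ) : Idx N)).tsum_eq
        fun β => X β * q i (β - Pi.single i 1)).symm.trans ?_
      simp only [Equiv.coe_addRight, add_sub_cancel_right]
    refine ⟨(b1.sub b2).congr fun β => by ring, ?_⟩
    simp only [mul_sub, sub_mul]
    rw [b1.tsum_sub b2, b1.tsum_sub b3, b4]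
  have hXq : Summable fun β => X β * ∑ i, (q i β - q i (β - Pi.single i 1)) :=
    Summable.mul_abs_of_bounded hqd hX
  have hbound : -∑' β, X β * ∑ i, (q i β - q i (β - Pi.single i 1))
      ≤ N * (κ * (2 * L * ∑' β, |U β - V β|)) := by
    have e1 : ∑' β, X β * ∑ i, (q i β - q i (β - Pi.single i 1))
        = ∑ i, ∑' β, (X β - X (β + Pi.single i 1)) * q i β := by
      simp only [Finset.mul_sum]
      rw [Summable.tsum_finsetSum fun i _ => (hparts i).1]
      exact Finset.sum_congr rfl fun i _ => (hparts i).2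
    rw [e1, ← Finset.sum_neg_distrib]
    calc _ ≤ ∑ i : Fin N, (κ * (2 * L * ∑' β, |U β - V β|)) := by
          refine Finset.sum_le_sum fun i _ => ?_
          have hκ0 : 0 ≤ κ := (abs_nonneg _).trans (hκ 0 i)
          refine le_trans ?_ (mul_le_mul_of_nonneg_left (hqabs i) hκ0)
          rw [← tsum_neg, ← tsum_mul_left]
          have hb : ∀ β, |X β - X (β + Pi.single i 1)| ≤ κ := fun β => by
            rw [abs_sub_comm]; exact hκ β i
          refine (Summable.mul_abs_of_bounded (hq i) hb).neg.tsum_le_tsum (fun β => ?_)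
            ((hq i).abs.mul_left κ)
          refine (neg_le_abs _).trans ?_
          rw [abs_mul]
          exact mul_le_mul_of_nonneg_right (hb β) (abs_nonneg _)
      _ = _ := by simp
  calc ∑' β, X β * |explicitStep c F U β - explicitStep c F V β|
      ≤ ∑' β, (X β * |U β - V β| - c * (X β * ∑ i, (q i β - q i (β - Pi.single i 1)))) := by
        refine (Summable.mul_abs_of_bounded hS1.abs hX).tsum_le_tsum (fun β => ?_)
          ((Summable.mul_abs_of_bounded hUV.abs hX).sub (hXq.mul_left c))
        have := mul_le_mul_of_nonneg_left (hdom β) (hX0 β)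
        linarith
    _ = ∑' β, X β * |U β - V β| + c * (-∑' β, X β * ∑ i, (q i β - q i (β - Pi.single i 1))) := by
        rw [(Summable.mul_abs_of_bounded hUV.abs hX).tsum_sub (hXq.mul_left c), tsum_mul_left]
        ring
    _ ≤ _ := by gcongr

end Explicit

/-! ### Lattice `ℓ¹` norms, translations, and smoothing by box averages. -/

section Averaging

variable {N : ℕ}

/-- The (unnormalized) `ℓ¹` norm of a lattice function. -/
def gridL1 (V : Idx N → ℝ) : ℝ≥0∞ := ∑' β, ‖V β‖ₑ

lemma gridL1_mono {V W : Idx N → ℝ} (h : ∀ β, |V β| ≤ |W β|) : gridL1 V ≤ gridL1 W :=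
  ENNReal.tsum_le_tsum fun β => enorm_le_iff_norm_le.2 (h β)

lemma gridL1_add_le (V W : Idx N → ℝ) :
    gridL1 (fun β => V β + W β) ≤ gridL1 V + gridL1 W := by
  unfold gridL1
  rw [← ENNReal.tsum_add]
  exact ENNReal.tsum_le_tsum fun β => enorm_add_le _ _

lemma gridL1_sub_le (V W : Idx N → ℝ) :
    gridL1 (fun β => V β - W β) ≤ gridL1 V + gridL1 W := by
  unfold gridL1
  rw [← ENNReal.tsum_add]
  exact ENNReal.tsum_le_tsum fun β => enorm_sub_le

lemma gridL1_sub_le_of_sub (V W Z : Idx N → ℝ) :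
    gridL1 (fun β => V β - Z β) ≤ gridL1 (fun β => V β - W β) + gridL1 (fun β => W β - Z β) := by
  refine le_trans (le_of_eq ?_) (gridL1_add_le _ _)
  simp

lemma gridL1_sub_comm (V W : Idx N → ℝ) :
    gridL1 (fun β => V β - W β) = gridL1 (fun β => W β - V β) := by
  unfold gridL1
  exact tsum_congr fun β => by rw [← enorm_neg, neg_sub]

lemma gridL1_sum_le {κ : Type*} (s : Finset κ) (V : κ → Idx N → ℝ) :
    gridL1 (fun β => ∑ i ∈ s, V i β) ≤ ∑ i ∈ s, gridL1 (V i) := by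
  unfold gridL1
  rw [← Summable.tsum_finsetSum fun i _ => ENNReal.summable]
  exact ENNReal.tsum_le_tsum fun β => enorm_sum_le _ _

lemma gridL1_const_mul (c : ℝ) (V : Idx N → ℝ) :
    gridL1 (fun β => c * V β) = ‖c‖ₑ * gridL1 V := by
  unfold gridL1
  rw [← ENNReal.tsum_mul_left]
  exact tsum_congr fun β => enorm_mul _ _

lemma gridL1_shift (V : Idx N → ℝ) (η : Idx N) : gridL1 (fun β => V (β + η)) = gridL1 V :=
  (Equiv.addRight η).tsum_eq fun β => ‖V β‖ₑ

lemma gridL1_eq_ofReal {V : Idx N → ℝ} (h : Summable V) :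
    gridL1 V = ENNReal.ofReal (∑' β, |V β|) := by
  rw [ENNReal.ofReal_tsum_of_nonneg (fun _ => abs_nonneg _) h.abs]
  exact tsum_congr fun β => Real.enorm_eq_ofReal_abs _

/-- The `ℓ¹` distance of `V` to its translate by `η`. -/
def shiftDist (V : Idx N → ℝ) (η : Idx N) : ℝ≥0∞ := gridL1 fun β => V (β + η) - V β

lemma shiftDist_add_le (V : Idx N → ℝ) (η θ : Idx N) :
    shiftDist V (η + θ) ≤ shiftDist V η + shiftDist V θ := by
  have h := gridL1_sub_le_of_sub (fun β => V (β + (η + θ))) (fun β => V (β + θ)) V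
  refine h.trans (add_le_add_left (le_of_eq ?_) _)
  rw [shiftDist, ← gridL1_shift (fun β => V (β + η) - V β) θ]
  simp only [add_assoc, add_comm θ η]

lemma shiftDist_zero (V : Idx N → ℝ) : shiftDist V 0 = 0 := by
  simp [shiftDist, gridL1]

lemma shiftDist_neg (V : Idx N → ℝ) (η : Idx N) : shiftDist V (-η) = shiftDist V η := by
  rw [shiftDist, ← gridL1_shift _ η, shiftDist, gridL1_sub_comm]
  simp

lemma shiftDist_le_two_mul (V : Idx N → ℝ) (η : Idx N) : shiftDist V η ≤ 2 * gridL1 V := by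
  refine (gridL1_sub_le _ _).trans ?_
  rw [gridL1_shift, two_mul]

lemma shiftDist_single_natCast_le (V : Idx N → ℝ) (i : Fin N) (n : ℕ) :
    shiftDist V (Pi.single i (n : ℤ)) ≤ n * shiftDist V (Pi.single i 1) := by
  induction n with
  | zero => simp [shiftDist_zero]
  | succ n ih =>
    push_cast
    rw [Pi.single_add, add_mul, one_mul]
    exact (shiftDist_add_le _ _ _).trans (add_le_add_left ih _)

lemma shiftDist_single_le (V : Idx N → ℝ) (i : Fin N) (k : ℤ) :
    shiftDist V (Pi.single i k) ≤ ENNReal.ofReal |(k : ℝ)| * shiftDist V (Pi.single i 1) := by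
  have : ENNReal.ofReal |(k : ℝ)| = (k.natAbs : ℝ≥0∞) := by
    rw [← Int.cast_abs, Int.abs_eq_natAbs, Int.cast_natCast, ENNReal.ofReal_natCast]
  rw [this]
  rcases Int.natAbs_eq k with h | h
  · nth_rw 1 [h]; exact shiftDist_single_natCast_le V i _
  · nth_rw 1 [h]; rw [Pi.single_neg, shiftDist_neg]; exact shiftDist_single_natCast_le V i _

lemma shiftDist_le_sum (V : Idx N → ℝ) (η : Idx N) :
    shiftDist V η ≤ ∑ i, ENNReal.ofReal |(η i : ℝ)| * shiftDist V (Pi.single i 1) := by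
  have key : ∀ s : Finset (Fin N), shiftDist V (∑ i ∈ s, Pi.single i (η i))
      ≤ ∑ i ∈ s, ENNReal.ofReal |(η i : ℝ)| * shiftDist V (Pi.single i 1) := by
    intro s
    induction s using Finset.induction_on with
    | empty => simp [shiftDist_zero]
    | insert i s hi ih =>
      rw [Finset.sum_insert hi, Finset.sum_insert hi]
      exact (shiftDist_add_le _ _ _).trans (add_le_add (shiftDist_single_le _ _ _) ih)
  simpa [Finset.univ_sum_single] using key Finset.univ

/-- Averaging over `n` consecutive lattice points in direction `i`. -/
def avgOp (n : ℕ) (i : Fin N) : (Idx N → ℝ) →ₗ[ℝ] (Idx N → ℝ) where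
  toFun V β := (n : ℝ)⁻¹ * ∑ k ∈ Finset.range n, V (β + Pi.single i (k : ℤ))
  map_add' V W := by
    ext β; simp [Finset.sum_add_distrib, mul_add]
  map_smul' c V := by
    ext β; simp [← Finset.mul_sum, mul_left_comm]

lemma avgOp_apply (n : ℕ) (i : Fin N) (V : Idx N → ℝ) (β : Idx N) :
    avgOp n i V β = (n : ℝ)⁻¹ * ∑ k ∈ Finset.range n, V (β + Pi.single i (k : ℤ)) := rfl

lemma gridL1_average_le {n : ℕ} (hn : 0 < n) (E : ℝ≥0∞)
    (W : ℕ → Idx N → ℝ) (hW : ∀ k < n, gridL1 (W k) ≤ E) :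
    gridL1 (fun β => (n : ℝ)⁻¹ * ∑ k ∈ Finset.range n, W k β) ≤ E := by
  rw [gridL1_const_mul]
  have hn' : (n : ℝ≥0∞) ≠ 0 := by exact_mod_cast hn.ne'
  have h1 : ‖(n : ℝ)⁻¹‖ₑ = (n : ℝ≥0∞)⁻¹ := by
    rw [enorm_inv (by exact_mod_cast hn.ne'), Real.enorm_natCast]
  have h2 : ∑ k ∈ Finset.range n, gridL1 (W k) ≤ n * E :=
    (Finset.sum_le_sum fun k hk => hW k (Finset.mem_range.1 hk)).trans (by simp)
  calc _ ≤ (n : ℝ≥0∞)⁻¹ * (n * E) := by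
        rw [h1]; gcongr; exact (gridL1_sum_le _ _).trans h2
    _ = E := by rw [← mul_assoc, ENNReal.inv_mul_cancel hn' (by simp), one_mul]

/-- `P` averages lattice functions over boxes of side `n` in the directions of `s`. -/
structure IsAveraging (n : ℕ) (s : Finset (Fin N)) (P : (Idx N → ℝ) →ₗ[ℝ] (Idx N → ℝ)) :
    Prop where
  shift : ∀ V η, P (fun β => V (β + η)) = fun β => P V (β + η)
  bound : ∀ (V : Idx N → ℝ) (C : ℝ), (∀ β, |V β| ≤ C) → ∀ β, |P V β| ≤ C
  l1 : ∀ V, gridL1 (P V) ≤ gridL1 V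
  -- The trade-off in Kružkov's argument: unit differences of an average gain a factor `1/n`, while
  -- by `near` averaging moves `V` no more than translations by fewer than `n` cells allow.
  diff : ∀ V, ∀ i ∈ s, shiftDist (P V) (Pi.single i 1) ≤ ENNReal.ofReal (2 / n) * gridL1 V
  near : ∀ V E, (∀ i ∈ s, ∀ k < n, shiftDist V (Pi.single i (k : ℤ)) ≤ E) →
    gridL1 (fun β => P V β - V β) ≤ s.card * E
  stencil : ∀ {ι : Type} (ζ : ι → Idx N) (a : ι → ℝ), (∀ γ, 0 ≤ a γ) → Summable a →
    ∀ (V : Idx N → ℝ) (C : ℝ), (∀ β, |V β| ≤ C) → P (stencilOp ζ a V) = stencilOp ζ a (P V)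

/-- The sum telescopes, leaving only its two ends; this is the origin of the factor `1/n`. -/
lemma avgOp_sub_shift {n : ℕ} (i : Fin N) (W : Idx N → ℝ) (β : Idx N) :
    avgOp n i W (β + Pi.single i 1) - avgOp n i W β
      = (n : ℝ)⁻¹ * (W (β + Pi.single i (n : ℤ)) - W β) := by
  rw [avgOp_apply, avgOp_apply, ← mul_sub, ← Finset.sum_sub_distrib]
  congr 1
  have := Finset.sum_range_sub (fun k : ℕ => W (β + Pi.single i (k : ℤ))) n
  simp only [Nat.cast_zero, Pi.single_zero, add_zero] at this
  rw [← this]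
  refine Finset.sum_congr rfl fun k _ => ?_
  push_cast
  rw [Pi.single_add, add_assoc, add_comm (Pi.single i (1 : ℤ) : Idx N)]

lemma stencilOp_finset_sum {ι κ : Type*} {ζ : ι → Idx N} {a : ι → ℝ} (ha : ∀ γ, 0 ≤ a γ)
    (hs : Summable a) (s : Finset κ) (V : κ → Idx N → ℝ) (C : ℝ) (hV : ∀ k β, |V k β| ≤ C)
    (c : ℝ) (β : Idx N) :
    stencilOp ζ a (fun β => c * ∑ k ∈ s, V k β) β = c * ∑ k ∈ s, stencilOp ζ a (V k) β := by
  unfold stencilOp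
  rw [← Summable.tsum_finsetSum fun k _ => summable_stencil_term ha hs (hV k) β, ← tsum_mul_left]
  refine tsum_congr fun γ => ?_
  rw [← Finset.sum_mul, Finset.sum_sub_distrib]
  ring

/-- One-dimensional averages are composed, one direction at a time. The new average commutes with
translations and contracts `ℓ¹`, so the gain in the earlier directions survives. -/
lemma exists_isAveraging {n : ℕ} (hn : 0 < n) (s : Finset (Fin N)) :
    ∃ P, IsAveraging n s P := by
  have hn' : (0 : ℝ) < n := by exact_mod_cast hn
  induction s using Finset.induction_on with
  | empty =>
    exact ⟨LinearMap.id, fun V η => rfl, fun V C h => h, fun V => le_rfl, fun V i hi => by simp at hi,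
      fun V E _ => by simp [gridL1], fun ζ a _ _ V C _ => rfl⟩
  | insert i s hi ih =>
    obtain ⟨P, hP⟩ := ih
    have hl1 : ∀ W, gridL1 (avgOp n i W) ≤ gridL1 W := fun W =>
      gridL1_average_le hn _ _ fun k _ => (gridL1_shift _ _).le
    have hsh : ∀ (V : Idx N → ℝ) (η : Idx N),
        avgOp n i (fun β => V (β + η)) = fun β => avgOp n i V (β + η) := fun V η => by
      ext β; simp only [avgOp_apply, add_right_comm]
    refine ⟨avgOp n i ∘ₗ P, ?_, ?_, ?_, ?_, ?_, ?_⟩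
    · intro V η
      rw [LinearMap.comp_apply, hP.shift, hsh]; rfl
    · intro V C hC β
      have := hP.bound V C hC
      rw [LinearMap.comp_apply, avgOp_apply, abs_mul, abs_of_pos (inv_pos.2 hn'), inv_mul_le_iff₀ hn']
      refine (Finset.abs_sum_le_sum_abs _ _).trans ?_
      refine (Finset.sum_le_sum fun k _ => this _).trans ?_
      simp
    · intro V
      exact (hl1 _).trans (hP.l1 V)
    · intro V j hj
      rcases Finset.mem_insert.1 hj with rfl | hj
      · rw [shiftDist]
        simp only [LinearMap.comp_apply, avgOp_sub_shift]
        rw [gridL1_const_mul, div_eq_inv_mul, ENNReal.ofReal_mul (inv_nonneg.2 hn'.le), mul_assoc,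
          Real.enorm_of_nonneg (inv_nonneg.2 hn'.le)]
        gcongr
        refine (shiftDist_le_two_mul (P V) _).trans ?_
        rw [ENNReal.ofReal_ofNat]
        gcongr
        exact hP.l1 V
      · refine le_trans ?_ (hP.diff V j hj)
        have : (fun β => (avgOp n i ∘ₗ P) V (β + Pi.single j 1) - (avgOp n i ∘ₗ P) V β)
            = avgOp n i (fun β => P V (β + Pi.single j 1) - P V β) := by
          have e : (fun β => P V (β + Pi.single j 1) - P V β)
            = (fun β => P V (β + Pi.single j 1)) - P V := rfl
          rw [e, map_sub, hsh]
          rfl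
        rw [shiftDist, this]
        exact hl1 _
    · intro V E hE
      have h1 := hP.near V E fun j hj k hk => hE j (Finset.mem_insert_of_mem hj) k hk
      have h2 : gridL1 (fun β => avgOp n i V β - V β) ≤ E := by
        have : (fun β => avgOp n i V β - V β) = fun β => (n : ℝ)⁻¹ *
            ∑ k ∈ Finset.range n, (V (β + Pi.single i (k : ℤ)) - V β) := by
          ext β
          rw [Finset.sum_sub_distrib, mul_sub, ← avgOp_apply, Finset.sum_const, Finset.card_range,
            nsmul_eq_mul, inv_mul_cancel_left₀ hn'.ne']
        rw [this]
        exact gridL1_average_le hn _ _ fun k hk => hE i (Finset.mem_insert_self _ _) k hk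
      -- With `A = avgOp n i`, `A P V - V = A (P V - V) + (A V - V)`: each direction contributes one
      -- `E`.
      have e : (fun β => (avgOp n i ∘ₗ P) V β - V β)
          = fun β => avgOp n i (fun β => P V β - V β) β + (avgOp n i V β - V β) := by
        have e' : (fun β => P V β - V β) = P V - V := rfl
        ext β
        rw [e', map_sub]
        simp
      rw [e, Finset.card_insert_of_notMem hi]
      refine (gridL1_add_le _ _).trans ?_
      push_cast
      rw [add_mul, one_mul]
      exact add_le_add ((hl1 _).trans h1) h2
    · intro ι ζ a ha hs V C hC
      rw [LinearMap.comp_apply, hP.stencil ζ a ha hs V C hC]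
      ext β
      simp only [avgOp_apply, LinearMap.comp_apply]
      have := stencilOp_finset_sum (ζ := ζ) ha hs (Finset.range n)
        (fun k β => P V (β + Pi.single i (k : ℤ))) C (fun k β => hP.bound V C hC _) (n : ℝ)⁻¹ β
      simp only [stencilOp_shift] at this
      exact this.symm

variable {n : ℕ} {P : (Idx N → ℝ) →ₗ[ℝ] (Idx N → ℝ)}

lemma IsAveraging.shiftDist_le (hP : IsAveraging n Finset.univ P) (V : Idx N → ℝ) (η : Idx N) :
    shiftDist (P V) η ≤ ENNReal.ofReal (2 / n * ∑ i, |(η i : ℝ)|) * gridL1 V := by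
  refine (shiftDist_le_sum _ _).trans ?_
  rw [Finset.mul_sum, ENNReal.ofReal_sum_of_nonneg fun i _ => by positivity, Finset.sum_mul]
  refine Finset.sum_le_sum fun i _ => ?_
  rw [mul_comm (2 / (n : ℝ)), ENNReal.ofReal_mul (abs_nonneg _), mul_assoc]
  gcongr
  exact hP.diff V i (Finset.mem_univ i)

/-- A second difference is a composition of two first differences, along `η` and `-η`, and each uses
up one copy of `P`. Each gains `2 min(1, |η|₁/n)`, with the trivial bound covering long
displacements. -/
lemma IsAveraging.gridL1_second_diff_le (hP : IsAveraging n Finset.univ P) (ψ : Idx N → ℝ)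
    (η : Idx N) :
    gridL1 (fun β => P (P ψ) (β + η) + P (P ψ) (β - η) - 2 * P (P ψ) β)
      ≤ ENNReal.ofReal (4 * min 1 ((∑ i, |(η i : ℝ)|) / n) ^ 2) * gridL1 ψ := by
  set m : ℝ := min 1 ((∑ i, |(η i : ℝ)|) / n) with hm
  have hm0 : 0 ≤ m := le_min zero_le_one (by positivity)
  have key : ∀ (V : Idx N → ℝ) (θ : Idx N), (∑ i, |(θ i : ℝ)|) = (∑ i, |(η i : ℝ)|) →
      shiftDist (P V) θ ≤ ENNReal.ofReal (2 * m) * gridL1 V := fun V θ hθ => by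
    rcases le_total 1 ((∑ i, |(η i : ℝ)|) / n) with h | h
    · rw [hm, min_eq_left h, mul_one, ENNReal.ofReal_ofNat]
      refine (shiftDist_le_two_mul _ _).trans ?_
      gcongr
      exact hP.l1 V
    · rw [hm, min_eq_right h]
      refine (hP.shiftDist_le V θ).trans (le_of_eq ?_)
      rw [hθ]
      congr 2
      ring
  have e : (fun β => P (P ψ) (β + η) + P (P ψ) (β - η) - 2 * P (P ψ) β)
      = fun β => P (fun β => P ψ (β + η) - P ψ β) β
          - P (fun β => P ψ (β + η) - P ψ β) (β + -η) := by
    have e' : (fun β => P ψ (β + η) - P ψ β) = (fun β => P ψ (β + η)) - P ψ := rfl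
    ext β
    rw [e', map_sub, hP.shift]
    simp only [Pi.sub_apply, ← sub_eq_add_neg, sub_add_cancel]
    ring
  rw [e, gridL1_sub_comm]
  calc _ ≤ ENNReal.ofReal (2 * m) * gridL1 (fun β => P ψ (β + η) - P ψ β) :=
        key _ (-η) (by simp)
    _ ≤ ENNReal.ofReal (2 * m) * (ENNReal.ofReal (2 * m) * gridL1 ψ) := by
        gcongr
        exact key ψ η rfl
    _ = _ := by
        rw [← mul_assoc, ← ENNReal.ofReal_mul (by positivity)]
        congr 2
        ring

lemma gridL1_stencilOp_le {ι : Type*} {ζ : ι → Idx N} {a : ι → ℝ} (hS : SymStencil ζ a)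
    {V : Idx N → ℝ} {C : ℝ} (hV : ∀ β, |V β| ≤ C) :
    gridL1 (stencilOp ζ a V) ≤ ∑' γ, ENNReal.ofReal (a γ / 2) *
      gridL1 (fun β => V (β + ζ γ) + V (β - ζ γ) - 2 * V β) := by
  unfold gridL1
  simp only [← ENNReal.tsum_mul_left]
  rw [ENNReal.tsum_comm]
  refine ENNReal.tsum_le_tsum fun β => ?_
  rw [stencilOp_eq_half_second_diff hS hV]
  refine (enorm_tsum_le_tsum_enorm).trans (ENNReal.tsum_le_tsum fun γ => ?_)
  rw [enorm_mul, mul_comm, Real.enorm_of_nonneg (by linarith [hS.nonneg γ])]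

/-- The truncated second moment `∑ a_γ min(1, |z_γ|/R)²`. -/
def truncMoment {ι : Type*} (h : ℝ) (ζ : ι → Idx N) (a : ι → ℝ) (R : ℝ) : ℝ :=
  ∑' γ, a γ * min 1 (‖gridPoint h (ζ γ)‖ / R) ^ 2

lemma min_one_sq_le_one {x : ℝ} (hx : 0 ≤ x) : min 1 x ^ 2 ≤ 1 :=
  pow_le_one₀ (le_min zero_le_one hx) (min_le_left _ _)

lemma summable_truncMoment {ι : Type*} {ζ : ι → Idx N} {a : ι → ℝ} (ha : ∀ γ, 0 ≤ a γ)
    (hs : Summable a) (h : ℝ) {R : ℝ} (hR : 0 ≤ R) :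
    Summable fun γ => a γ * min 1 (‖gridPoint h (ζ γ)‖ / R) ^ 2 := by
  refine Summable.of_nonneg_of_le (fun γ => mul_nonneg (ha γ) (sq_nonneg _)) (fun γ => ?_) hs
  exact mul_le_of_le_one_right (ha γ) (min_one_sq_le_one (by positivity))

lemma sum_abs_le_norm_gridPoint {h : ℝ} (hh : 0 < h) (η : Idx N) :
    ∑ i, |(η i : ℝ)| ≤ N * (‖gridPoint h η‖ / h) := by
  have : ∀ i, |(η i : ℝ)| ≤ ‖gridPoint h η‖ / h := fun i => by
    rw [le_div_iff₀ hh]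
    have := PiLp.norm_apply_le (gridPoint h η) i
    rw [gridPoint, Real.norm_eq_abs] at this
    simp only [abs_mul, abs_of_pos hh] at this
    rw [mul_comm]
    exact this
  refine (Finset.sum_le_sum fun i _ => this i).trans ?_
  simp

/-- The averages commute with the operator and so act on the second differences. The scale `n * h /
N` is the box side divided by `N`, since `|η|₁ ≤ N |z| / h`. -/
lemma IsAveraging.gridL1_stencilOp_le {ι : Type} {ζ : ι → Idx N} {a : ι → ℝ}
    (hP : IsAveraging n Finset.univ P) (hN : 0 < N) (hS : SymStencil ζ a) {ψ : Idx N → ℝ} {C : ℝ}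
    (hψ : ∀ β, |ψ β| ≤ C) {h : ℝ} (hh : 0 < h) :
    gridL1 (P (P (stencilOp ζ a ψ)))
      ≤ ENNReal.ofReal (2 * truncMoment h ζ a (n * h / N)) * gridL1 ψ := by
  have hN' : (0 : ℝ) < N := by exact_mod_cast hN
  rw [hP.stencil ζ a hS.nonneg hS.summable ψ C hψ,
    hP.stencil ζ a hS.nonneg hS.summable (P ψ) C (hP.bound ψ C hψ)]
  refine (ConvDiff.gridL1_stencilOp_le hS (hP.bound _ C (hP.bound ψ C hψ))).trans ?_
  have hR : 0 ≤ n * h / N := by positivity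
  rw [truncMoment, ← tsum_mul_left, ENNReal.ofReal_tsum_of_nonneg, ← ENNReal.tsum_mul_right]
  · refine ENNReal.tsum_le_tsum fun γ => ?_
    have ha := hS.nonneg γ
    calc _ ≤ ENNReal.ofReal (a γ / 2) *
          (ENNReal.ofReal (4 * min 1 ((∑ i, |(ζ γ i : ℝ)|) / n) ^ 2) * gridL1 ψ) := by
          gcongr
          exact hP.gridL1_second_diff_le ψ (ζ γ)
      _ = ENNReal.ofReal (2 * (a γ * min 1 ((∑ i, |(ζ γ i : ℝ)|) / n) ^ 2)) * gridL1 ψ := by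
          rw [← mul_assoc, ← ENNReal.ofReal_mul (by positivity)]
          congr 2
          ring
      _ ≤ _ := by
          have hle : (∑ i, |(ζ γ i : ℝ)|) / n ≤ ‖gridPoint h (ζ γ)‖ / (n * h / N) := by
            calc _ ≤ N * (‖gridPoint h (ζ γ)‖ / h) / n := by
                  gcongr; exact sum_abs_le_norm_gridPoint hh _
              _ = _ := by rw [div_div_eq_mul_div]; field_simp
          have h0 : 0 ≤ min 1 ((∑ i, |(ζ γ i : ℝ)|) / n) := le_min zero_le_one (by positivity)
          gcongr
  · exact fun γ => mul_nonneg zero_le_two (mul_nonneg (hS.nonneg γ) (sq_nonneg _))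
  · exact (summable_truncMoment hS.nonneg hS.summable h hR).mul_left 2

/-- The single flux difference gains `2/n` from an average; with the `1/h` of the difference
quotient only the box side `n h` remains, so the bound does not degenerate as `h → 0`. -/
lemma IsAveraging.gridL1_discConvection_le {F : ℝ → ℝ → Fin N → ℝ} {f : Fin N → ℝ → ℝ} {L : ℝ≥0}
    (hP : IsAveraging n Finset.univ P) (hF : IsNumericalFlux F f L) {h : ℝ} (hh : 0 < h)
    (U : Idx N → ℝ) :
    gridL1 (P (P (discConvection h F U))) ≤ ENNReal.ofReal (N * (4 * L / (n * h))) * gridL1 U := by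
  -- Subtracting `F 0 0` leaves backward differences unchanged and makes the flux bounded by `U` in
  -- `ℓ¹`.
  let q : Fin N → Idx N → ℝ := fun i β => F (U β) (U (β + Pi.single i 1)) i - F 0 0 i
  have hq : ∀ i, gridL1 (q i) ≤ ENNReal.ofReal (2 * L) * gridL1 U := fun i => by
    calc gridL1 (q i) ≤ gridL1 (fun β => (L : ℝ) * (|U β| + |U (β + Pi.single i 1)|)) := by
          refine gridL1_mono fun β => ?_
          have := hF.lipschitz i (U β) (U (β + Pi.single i 1)) 0 0
          rw [sub_zero, sub_zero] at this
          exact this.trans (le_abs_self _)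
      _ ≤ ENNReal.ofReal L * (gridL1 U + gridL1 U) := by
          rw [gridL1_const_mul, Real.enorm_of_nonneg L.coe_nonneg]
          gcongr
          refine (gridL1_add_le _ _).trans (add_le_add (gridL1_mono fun β => by simp) ?_)
          rw [← gridL1_shift U (Pi.single i 1)]
          exact gridL1_mono fun β => by simp
      _ = _ := by
          rw [← two_mul, ← mul_assoc, ENNReal.ofReal_mul zero_le_two, ENNReal.ofReal_ofNat,
            mul_comm 2]
  have e : discConvection h F U
      = ∑ i, h⁻¹ • (q i - fun β => q i (β + -Pi.single i 1)) := by
    ext β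
    simp only [discConvection, bwdDiff, Finset.sum_apply, Pi.smul_apply, Pi.sub_apply, smul_eq_mul]
    refine Finset.sum_congr rfl fun i _ => ?_
    simp only [q, ← sub_eq_add_neg, sub_add_cancel]
    ring
  have e2 : P (P (discConvection h F U))
      = fun β => ∑ i, h⁻¹ * (P (P (q i)) β - P (P (q i)) (β + -Pi.single i 1)) := by
    ext β
    rw [e, map_sum, map_sum, Finset.sum_apply]
    refine Finset.sum_congr rfl fun i _ => ?_
    rw [map_smul, map_smul, map_sub, map_sub, hP.shift, hP.shift]
    rfl
  rw [e2]
  refine (gridL1_sum_le _ _).trans ?_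
  calc _ ≤ ∑ i : Fin N, ENNReal.ofReal (4 * L / (n * h)) * gridL1 U := by
        refine Finset.sum_le_sum fun i _ => ?_
        rw [gridL1_const_mul, Real.enorm_of_nonneg (inv_nonneg.2 hh.le), gridL1_sub_comm]
        have h1 : gridL1 (fun β => P (P (q i)) (β + -Pi.single i 1) - P (P (q i)) β)
            ≤ ENNReal.ofReal (2 / n) * (ENNReal.ofReal (2 * L) * gridL1 U) := by
          refine (shiftDist_neg (P (P (q i))) _).le.trans ?_
          refine (hP.diff _ i (Finset.mem_univ i)).trans ?_
          gcongr
          exact (hP.l1 _).trans (hq i)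
        refine (mul_le_mul_right h1 _).trans (le_of_eq ?_)
        rw [← mul_assoc, ← mul_assoc, ← ENNReal.ofReal_mul (inv_nonneg.2 hh.le),
          ← ENNReal.ofReal_mul (by positivity)]
        congr 2
        field_simp
        ring
    _ = _ := by
        rw [Finset.sum_const, Finset.card_univ, Fintype.card_fin, nsmul_eq_mul, ← mul_assoc,
          ENNReal.ofReal_mul (Nat.cast_nonneg N), ENNReal.ofReal_natCast]

end Averaging

/-! ### Discrete solutions: sup bound, weighted comparison, regularity in time. -/

section Scheme

variable {N : ℕ} {T h : ℝ} {τ : TimeGrid T} {F : ℝ → ℝ → Fin N → ℝ} {f : Fin N → ℝ → ℝ} {L : ℝ≥0}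
  {φ : ℝ → ℝ} {ι : Type} {ζ : ι → Idx N} {a : ι → ℝ} {G G' U V : ℕ → Idx N → ℝ}

lemma TimeGrid.step_pos (τ : TimeGrid T) {j : ℕ} (hj : j < τ.J) : 0 < τ.step j :=
  sub_pos.2 (τ.t_lt j hj)

lemma TimeGrid.t_le (τ : TimeGrid T) {j k : ℕ} (hjk : j ≤ k) (hk : k ≤ τ.J) : τ.t j ≤ τ.t k := by
  induction k, hjk using Nat.le_induction with
  | base => exact le_rfl
  | succ k hjk ih => exact (ih (by omega)).trans (τ.t_lt k (by omega)).le

lemma TimeGrid.t_mem (τ : TimeGrid T) {j : ℕ} (hj : j ≤ τ.J) : τ.t j ∈ Icc 0 T :=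
  ⟨τ.t_zero.symm.le.trans (τ.t_le (Nat.zero_le j) hj), (τ.t_le hj le_rfl).trans τ.t_last.le⟩

/-- Solutions of the scheme with a general summable source. -/
structure IsDiscreteSolution (h : ℝ) (τ : TimeGrid T) (F : ℝ → ℝ → Fin N → ℝ) (φ : ℝ → ℝ)
    (ζ : ι → Idx N) (a : ι → ℝ) (G U : ℕ → Idx N → ℝ) : Prop where
  summable : ∀ j ≤ τ.J, Summable (U j)
  summable_source : ∀ j < τ.J, Summable (G j)
  step : ∀ j < τ.J, ∀ β, U (j + 1) β = U j β - τ.step j * discConvection h F (U j) β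
    + τ.step j * stencilOp ζ a (fun β => φ (U (j + 1) β)) β + τ.step j * G j β

/-- Comparison with this solution turns estimates of differences into mass and tail bounds for one
solution. -/
lemma isDiscreteSolution_zero (h : ℝ) (τ : TimeGrid T) (F : ℝ → ℝ → Fin N → ℝ) (φ : ℝ → ℝ)
    (ζ : ι → Idx N) (a : ι → ℝ) :
    IsDiscreteSolution h τ F φ ζ a (fun _ _ => 0) (fun _ _ => 0) :=
  ⟨fun _ _ => summable_zero, fun _ _ => summable_zero, fun j _ β => by
    simp [discConvection, bwdDiff, stencilOp]⟩

/-- Translation invariance of the scheme: comparing a solution with its translate transports the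
spatial modulus of the data. -/
lemma IsDiscreteSolution.shift (hU : IsDiscreteSolution h τ F φ ζ a G U) (η : Idx N) :
    IsDiscreteSolution h τ F φ ζ a (fun j β => G j (β + η)) (fun j β => U j (β + η)) where
  summable j hj := summable_shift (hU.summable j hj) η
  summable_source j hj := summable_shift (hU.summable_source j hj) η
  step j hj β := by
    have h1 := stencilOp_shift (ζ := ζ) (a := a) (fun β => φ (U (j + 1) β)) η β
    have h2 : discConvection h F (fun β => U j (β + η)) β = discConvection h F (U j) (β + η) := by
      simp only [discConvection, bwdDiff]
      refine Finset.sum_congr rfl fun i _ => ?_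
      simp only [add_right_comm _ η, sub_add_eq_add_sub]
    rw [h1, h2]
    exact hU.step j hj (β + η)

lemma explicitStep_eq (hh : h ≠ 0) (Δ : ℝ) (W : Idx N → ℝ) (β : Idx N) :
    explicitStep (Δ / h) F W β = W β - Δ * discConvection h F W β := by
  simp only [explicitStep, discConvection, bwdDiff, sub_add_cancel, ← Finset.sum_div]
  field_simp

/-- This form separates the monotone explicit step and the source from the implicit diffusion, so
each can be estimated by its own lemma. -/
lemma IsDiscreteSolution.step' (hU : IsDiscreteSolution h τ F φ ζ a G U) (hh : h ≠ 0) {j : ℕ}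
    (hj : j < τ.J) (β : Idx N) :
    U (j + 1) β = (explicitStep (τ.step j / h) F (U j) β + τ.step j * G j β)
      + τ.step j * stencilOp ζ a (fun β => φ (U (j + 1) β)) β := by
  rw [hU.step j hj β, explicitStep_eq hh]
  ring

lemma cfl_div (hh : 0 < h) {Δ : ℝ} (hCFL : 2 * (N : ℝ) * L * Δ ≤ h) :
    2 * N * L * (Δ / h) ≤ 1 := by
  rw [← mul_div_assoc, div_le_one hh]
  exact hCFL

/-- Neither the convection step nor the implicit step increases the sup norm; `M` only has to grow
by the source. -/
lemma IsDiscreteSolution.abs_le (hU : IsDiscreteSolution h τ F φ ζ a G U) (hh : 0 < h)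
    (hF : IsNumericalFlux F f L) (hφ : Monotone φ) (ha : ∀ γ, 0 ≤ a γ)
    (hCFL : ∀ j < τ.J, 2 * (N : ℝ) * L * τ.step j ≤ h) {M : ℕ → ℝ} (h0 : ∀ β, |U 0 β| ≤ M 0)
    (hM : ∀ j < τ.J, ∀ β, M j + |τ.step j * G j β| ≤ M (j + 1)) {j : ℕ} (hj : j ≤ τ.J)
    (β : Idx N) : |U j β| ≤ M j := by
  induction j generalizing β with
  | zero => exact h0 β
  | succ j ih =>
    have hΔ := (τ.step_pos hj).le
    refine abs_le_of_implicit ha hφ hΔ (hU.summable _ hj) (fun β => ?_)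
      (hU.step' hh.ne' hj) β
    refine (abs_add_le _ _).trans (le_trans ?_ (hM j hj β))
    gcongr
    exact abs_explicitStep_le hF (div_nonneg hΔ hh.le) (cfl_div hh (hCFL j hj))
      (ih (Nat.le_of_succ_le hj)) β

/-- Weighted `ℓ¹` comparison of two solutions. -/
lemma IsDiscreteSolution.tsum_weighted_sub_le (hU : IsDiscreteSolution h τ F φ ζ a G U)
    (hV : IsDiscreteSolution h τ F φ ζ a G' V) (hh : 0 < h)
    (hF : IsNumericalFlux F f L) (hφ : Monotone φ) (hS : SymStencil ζ a)
    (hCFL : ∀ j < τ.J, 2 * (N : ℝ) * L * τ.step j ≤ h) {Lφ : ℝ}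
    (hLφ : ∀ j ≤ τ.J, ∀ β, |φ (U j β) - φ (V j β)| ≤ Lφ * |U j β - V j β|)
    {MU MV : ℝ} (hMU : ∀ j ≤ τ.J, ∀ β, |φ (U j β)| ≤ MU) (hMV : ∀ j ≤ τ.J, ∀ β, |φ (V j β)| ≤ MV)
    {X : Idx N → ℝ} (hX0 : ∀ β, 0 ≤ X β) (hX1 : ∀ β, X β ≤ 1) {κ ε K : ℝ} (hε : 0 ≤ ε)
    (hκ : ∀ β i, |X (β + Pi.single i 1) - X β| ≤ κ * h) (hLX : ∀ β, stencilOp ζ a X β ≤ ε)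
    (hK : ∀ j < τ.J, N * (κ * (2 * L * ∑' β, |U j β - V j β|))
      + ε * (Lφ * ∑' β, |U (j + 1) β - V (j + 1) β|) ≤ K) {j : ℕ} (hj : j ≤ τ.J) :
    ∑' β, X β * |U j β - V j β| ≤ ∑' β, X β * |U 0 β - V 0 β| + τ.t j * K
      + ∑ i ∈ Finset.range j, ∑' β, X β * |τ.step i * (G i β - G' i β)| := by
  have hX : ∀ β, |X β| ≤ 1 := fun β => by rw [abs_of_nonneg (hX0 β)]; exact hX1 β
  induction j with
  | zero => simp [τ.t_zero]
  | succ j ih =>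
    have hΔ := (τ.step_pos hj).le
    have hsD : ∀ j ≤ τ.J, Summable fun β => U j β - V j β := fun j hj =>
      (hU.summable j hj).sub (hV.summable j hj)
    have hψ : Summable fun β => φ (U (j + 1) β) - φ (V (j + 1) β) :=
      Summable.of_norm_bounded ((hsD _ hj).abs.mul_left Lφ) (hLφ _ hj)
    obtain ⟨hE1, hE2⟩ := tsum_weighted_explicitStep_le hF (div_nonneg hΔ hh.le)
      (cfl_div hh (hCFL j hj)) (hsD j (Nat.le_of_succ_le hj)) hX0 hX1 hκ
    have hGs : Summable fun β => τ.step j * (G j β - G' j β) :=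
      ((hU.summable_source j hj).sub (hV.summable_source j hj)).mul_left _
    have himp := tsum_weighted_le_of_implicit hS hΔ hψ (hsD _ hj) (hE1.add hGs) hX0 hX1 hLX
      (fun β => by
        rw [stencilOp_sub hS.nonneg hS.summable (hMU _ hj) (hMV _ hj), hU.step' hh.ne' hj,
          hV.step' hh.ne' hj]
        ring)
      (fun β => by
        -- Monotonicity of `φ` gives `U - V` and `φ(U) - φ(V)` compatible signs, as Kato's
        -- inequality requires.
        rcases le_total (V (j + 1) β) (U (j + 1) β) with hle | hle
        · exact Or.inl ⟨sub_nonneg.2 hle, sub_nonneg.2 (hφ hle)⟩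
        · exact Or.inr ⟨sub_nonpos.2 hle, sub_nonpos.2 (hφ hle)⟩)
    have hsplit : ∑' β, X β * |(explicitStep (τ.step j / h) F (U j) β
          - explicitStep (τ.step j / h) F (V j) β) + τ.step j * (G j β - G' j β)|
        ≤ ∑' β, X β * |explicitStep (τ.step j / h) F (U j) β
          - explicitStep (τ.step j / h) F (V j) β|
          + ∑' β, X β * |τ.step j * (G j β - G' j β)| := by
      rw [← (Summable.mul_abs_of_bounded hE1.abs hX).tsum_add
        (Summable.mul_abs_of_bounded hGs.abs hX)]
      refine (Summable.mul_abs_of_bounded (hE1.add hGs).abs hX).tsum_le_tsum (fun β => ?_)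
        ((Summable.mul_abs_of_bounded hE1.abs hX).add (Summable.mul_abs_of_bounded hGs.abs hX))
      rw [← mul_add]
      exact mul_le_mul_of_nonneg_left (abs_add_le _ _) (hX0 β)
    have hψle : ∑' β, |φ (U (j + 1) β) - φ (V (j + 1) β)|
        ≤ Lφ * ∑' β, |U (j + 1) β - V (j + 1) β| := by
      rw [← tsum_mul_left]
      exact hψ.abs.tsum_le_tsum (hLφ _ hj) ((hsD _ hj).abs.mul_left _)
    have hKj := hK j hj
    have ih' := ih (Nat.le_of_succ_le hj)
    -- The variation `κ * h` of the weight over one cell cancels the `1/h` in the ratio `Δt / h`.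
    have e1 : τ.step j / h * (N * (κ * h * (2 * L * ∑' β, |U j β - V j β|)))
        = τ.step j * (N * (κ * (2 * L * ∑' β, |U j β - V j β|))) := by
      field_simp
    have e2 : τ.t (j + 1) * K = τ.t j * K + τ.step j * K := by rw [TimeGrid.step]; ring
    have h3 := mul_le_mul_of_nonneg_left hKj hΔ
    have h4 := mul_le_mul_of_nonneg_left (mul_le_mul_of_nonneg_left hψle hε) hΔ
    rw [Finset.sum_range_succ, e2]
    rw [e1] at hE2
    linarith

/-- Kružkov's estimate: translation estimates in space and the scheme imply an estimate in time. -/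
lemma IsDiscreteSolution.gridL1_sub_le (hU : IsDiscreteSolution h τ F φ ζ a G U) (hN : 0 < N)
    (hh : 0 < h) (hF : IsNumericalFlux F f L) (hS : SymStencil ζ a) {Lφ : ℝ}
    (hLφ0 : 0 ≤ Lφ) (hLφ : ∀ j ≤ τ.J, ∀ β, |φ (U j β) - φ 0| ≤ Lφ * |U j β|)
    {A E : ℝ≥0∞} (hA : ∀ j ≤ τ.J, gridL1 (U j) ≤ A) {n : ℕ} (hn : 0 < n)
    (hE : ∀ j ≤ τ.J, ∀ i, ∀ k < n, shiftDist (U j) (Pi.single i (k : ℤ)) ≤ E)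
    {k j : ℕ} (hkj : k ≤ j) (hj : j ≤ τ.J) :
    gridL1 (fun β => U j β - U k β) ≤ 4 * N * E
      + ENNReal.ofReal ((τ.t j - τ.t k) *
          (N * (4 * L / (n * h)) + 2 * truncMoment h ζ a (n * h / N) * Lφ)) * A
      + ∑ i ∈ Finset.Ico k j, gridL1 (fun β => τ.step i * G i β) := by
  obtain ⟨P, hP⟩ := exists_isAveraging (N := N) hn Finset.univ
  have hμ : 0 ≤ truncMoment h ζ a (n * h / N) :=
    tsum_nonneg fun γ => mul_nonneg (hS.nonneg γ) (sq_nonneg _)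
  set K : ℝ := N * (4 * L / (n * h)) + 2 * truncMoment h ζ a (n * h / N) * Lφ with hKdef
  have hK : 0 ≤ K := by positivity
  -- Averaged increments are controlled through the scheme: two averages are needed for the second
  -- differences of the diffusion, and the source is merely contracted.
  have hinc : ∀ i < τ.J, gridL1 (P (P (U (i + 1) - U i)))
      ≤ ENNReal.ofReal (τ.step i * K) * A + gridL1 (fun β => τ.step i * G i β) := by
    intro i hi
    have hΔ := (τ.step_pos hi).le
    obtain ⟨C, hC0, hC⟩ := exists_bound_of_summable (hU.summable (i + 1) hi)
    -- Subtracting `φ 0` does not change the operator, and brings the function into `ℓ¹`.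
    let ψ : Idx N → ℝ := fun β => φ (U (i + 1) β) - φ 0
    have hψb : ∀ β, |ψ β| ≤ Lφ * C := fun β =>
      (hLφ _ hi β).trans (mul_le_mul_of_nonneg_left (hC β) hLφ0)
    have hψ1 : gridL1 ψ ≤ ENNReal.ofReal Lφ * A := by
      refine le_trans ?_ (mul_le_mul_right (hA _ hi) _)
      rw [← Real.enorm_of_nonneg hLφ0, ← gridL1_const_mul]
      refine gridL1_mono fun β => (hLφ _ hi β).trans ?_
      rw [abs_mul, abs_of_nonneg hLφ0]
    have e : U (i + 1) - U i = τ.step i • (stencilOp ζ a ψ - discConvection h F (U i))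
        + fun β => τ.step i * G i β := by
      ext β
      have h1 := hU.step i hi β
      simp only [Pi.sub_apply, Pi.add_apply, Pi.smul_apply, smul_eq_mul, ψ, stencilOp_sub_const]
      linarith
    rw [e, map_add, map_add, map_smul, map_smul, map_sub, map_sub]
    refine (gridL1_add_le _ _).trans (add_le_add ?_ ((hP.l1 _).trans (hP.l1 _)))
    refine (gridL1_const_mul (τ.step i)
      (P (P (stencilOp ζ a ψ)) - P (P (discConvection h F (U i))))).le.trans ?_
    rw [Real.enorm_of_nonneg hΔ, ENNReal.ofReal_mul hΔ, mul_assoc]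
    gcongr
    refine (ConvDiff.gridL1_sub_le _ _).trans ?_
    calc _ ≤ ENNReal.ofReal (2 * truncMoment h ζ a (n * h / N)) * (ENNReal.ofReal Lφ * A)
          + ENNReal.ofReal (N * (4 * L / (n * h))) * A := by
          refine add_le_add ((hP.gridL1_stencilOp_le hN hS hψb hh).trans ?_)
            ((hP.gridL1_discConvection_le hF hh _).trans ?_)
          · gcongr
          · gcongr
            exact hA i hi.le
      _ = _ := by
          rw [← mul_assoc, ← ENNReal.ofReal_mul (by positivity), ← add_mul,
            ← ENNReal.ofReal_add (by positivity) (by positivity), add_comm, hKdef]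
  have hsum : gridL1 (P (P (U j - U k))) ≤ ENNReal.ofReal ((τ.t j - τ.t k) * K) * A
      + ∑ i ∈ Finset.Ico k j, gridL1 (fun β => τ.step i * G i β) := by
    induction j, hkj using Nat.le_induction with
    | base => simp [gridL1]
    | succ j hkj ih =>
      have e : U (j + 1) - U k = (U j - U k) + (U (j + 1) - U j) := by abel
      rw [e, map_add, map_add, Finset.sum_Ico_succ_top hkj]
      refine (gridL1_add_le _ _).trans ((add_le_add (ih (by omega)) (hinc j hj)).trans
        (le_of_eq ?_))
      have e2 : (τ.t (j + 1) - τ.t k) * K = (τ.t j - τ.t k) * K + τ.step j * K := by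
        rw [TimeGrid.step]; ring
      have h0 : 0 ≤ τ.t j - τ.t k := sub_nonneg.2 (τ.t_le hkj (by omega))
      rw [e2, ENNReal.ofReal_add (mul_nonneg h0 hK) (mul_nonneg (τ.step_pos hj).le hK), add_mul]
      ring
  set W := U j - U k with hW
  -- `W` is a difference of two functions of modulus `E`, so its modulus is `2 * E`; removing each
  -- of the two averages costs `N` times this, in total `4 * N * E`.
  have hWs : ∀ i ∈ Finset.univ, ∀ l < n, shiftDist W (Pi.single i (l : ℤ)) ≤ 2 * E := by
    intro i _ l hl
    have e : (fun β => W (β + Pi.single i (l : ℤ)) - W β) = fun β =>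
        (U j (β + Pi.single i (l : ℤ)) - U j β) - (U k (β + Pi.single i (l : ℤ)) - U k β) := by
      ext β; simp only [hW, Pi.sub_apply]; ring
    rw [shiftDist, e, two_mul]
    exact (ConvDiff.gridL1_sub_le _ _).trans
      (add_le_add (hE j hj i l hl) (hE k (hkj.trans hj) i l hl))
  have hn1 := hP.near W (2 * E) hWs
  have hn2 : gridL1 (fun β => P (P W) β - P W β) ≤ N * (2 * E) := by
    have e : (fun β => P (P W) β - P W β) = P (fun β => P W β - W β) := by
      have e' : (fun β => P W β - W β) = P W - W := rfl
      rw [e', map_sub P (P W) W]; rfl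
    rw [e]
    simpa using (hP.l1 _).trans hn1
  rw [Finset.card_univ, Fintype.card_fin] at hn1
  calc gridL1 (fun β => U j β - U k β) = gridL1 (fun β => (W β - P W β) + ((P W β - P (P W) β)
        + P (P W) β)) := by
        congr 1; ext β; simp only [hW, Pi.sub_apply]; ring
    _ ≤ N * (2 * E) + (N * (2 * E) + gridL1 (P (P W))) := by
        refine (gridL1_add_le _ _).trans (add_le_add ?_ ((gridL1_add_le _ _).trans
          (add_le_add ?_ le_rfl)))
        · rw [gridL1_sub_comm]; exact hn1
        · rw [gridL1_sub_comm]; exact hn2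
    _ ≤ N * (2 * E) + (N * (2 * E) + (ENNReal.ofReal ((τ.t j - τ.t k) * K) * A
          + ∑ i ∈ Finset.Ico k j, gridL1 (fun β => τ.step i * G i β))) := by gcongr
    _ = _ := by ring

end Scheme

/-! ### A quadratic-at-the-origin cutoff and its first and second differences. -/

section Cutoff

variable {N : ℕ}

lemma gridPoint_add (h : ℝ) (β η : Idx N) :
    gridPoint h (β + η) = gridPoint h β + gridPoint h η := by
  ext i; simp [gridPoint, mul_add]

lemma gridPoint_sub (h : ℝ) (β η : Idx N) :
    gridPoint h (β - η) = gridPoint h β - gridPoint h η := by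
  ext i; simp [gridPoint, mul_sub]

lemma gridPoint_zero (h : ℝ) : gridPoint h (0 : Idx N) = 0 := by
  ext i; simp [gridPoint]

lemma gridPoint_single (h : ℝ) (i : Fin N) (k : ℤ) :
    gridPoint h (Pi.single i k : Idx N) = EuclideanSpace.single i (h * k) := by
  ext j
  rcases eq_or_ne j i with rfl | hj
  · simp [gridPoint]
  · simp [gridPoint, hj]

lemma norm_gridPoint_single {h : ℝ} (hh : 0 < h) (i : Fin N) (k : ℤ) :
    ‖gridPoint h (Pi.single i k : Idx N)‖ = h * |(k : ℝ)| := by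
  rw [gridPoint_single, PiLp.norm_single, Real.norm_eq_abs, abs_mul, abs_of_pos hh]

lemma norm_gridPoint_eq_zero_or_le {h : ℝ} (hh : 0 < h) (η : Idx N) :
    ‖gridPoint h η‖ = 0 ∨ h ≤ ‖gridPoint h η‖ := by
  by_cases hη : η = 0
  · left; rw [hη, gridPoint_zero, norm_zero]
  · right
    obtain ⟨i, hi⟩ := Function.ne_iff.1 hη
    have h1 := PiLp.norm_apply_le (gridPoint h η) i
    rw [gridPoint, Real.norm_eq_abs] at h1
    simp only [abs_mul, abs_of_pos hh] at h1
    have h2 : (1 : ℝ) ≤ |(η i : ℝ)| := by exact_mod_cast Int.one_le_abs hi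
    calc h = h * 1 := (mul_one h).symm
      _ ≤ h * |(η i : ℝ)| := by gcongr
      _ ≤ _ := h1

variable {H : Type*} [NormedAddCommGroup H] [InnerProductSpace ℝ H]

/-- A smooth function vanishing at the origin and tending to `1` at infinity, at scale `R`. -/
def cutoff (R : ℝ) (x : H) : ℝ := 1 - (1 + ‖R⁻¹ • x‖ ^ 2)⁻¹

lemma cutoff_nonneg (R : ℝ) (x : H) : 0 ≤ cutoff R x :=
  sub_nonneg.2 (inv_le_one_of_one_le₀ (by linarith [sq_nonneg ‖R⁻¹ • x‖]))

lemma cutoff_le_one (R : ℝ) (x : H) : cutoff R x ≤ 1 :=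
  sub_le_self _ (inv_nonneg.2 (by positivity))

lemma half_le_cutoff {R : ℝ} (hR : 0 < R) {x : H} (hx : R ≤ ‖x‖) : 1 / 2 ≤ cutoff R x := by
  have h1 : 1 ≤ ‖R⁻¹ • x‖ := by
    rw [norm_smul, Real.norm_of_nonneg (inv_nonneg.2 hR.le), ← div_eq_inv_mul, le_div_iff₀ hR]
    linarith
  have h2 : (1 + ‖R⁻¹ • x‖ ^ 2)⁻¹ ≤ (2 : ℝ)⁻¹ := by
    gcongr
    nlinarith
  unfold cutoff
  linarith

/-- Algebraic core of the second-difference bound, with `a = ‖y‖²`, `b = 2⟨y, v⟩`, `c = ‖v‖²`; the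
hypothesis on `b` is then Cauchy–Schwarz. The constant does not depend on `a`, so the bound is
uniform in the base point. -/
lemma inv_add_inv_sub_two_inv_le {a b c : ℝ} (ha : 0 ≤ a) (hc : 0 ≤ c) (hb : b ^ 2 ≤ 4 * a * c)
    (hp : 0 < 1 + (a + b + c)) (hm : 0 < 1 + (a - b + c)) :
    |(1 + (a + b + c))⁻¹ + (1 + (a - b + c))⁻¹ - 2 * (1 + a)⁻¹| ≤ 10 * c := by
  have hA : 0 < 1 + a := by linarith
  have e : (1 + (a + b + c))⁻¹ + (1 + (a - b + c))⁻¹ - 2 * (1 + a)⁻¹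
      = (2 * b ^ 2 - 2 * c * (1 + a + c))
        / ((1 + a) * ((1 + (a + b + c)) * (1 + (a - b + c)))) := by
    field_simp
    ring
  -- The product is `(1 + a + c)² - b²`, and `b² ≤ 4ac` leaves `1 + 2a + 2c + (a - c)²`.
  have hpm : 1 + 2 * a + 2 * c ≤ (1 + (a + b + c)) * (1 + (a - b + c)) := by
    nlinarith [sq_nonneg (a - c)]
  have hD : 0 < (1 + a) * ((1 + (a + b + c)) * (1 + (a - b + c))) := by positivity
  rw [e, abs_div, abs_of_pos hD, div_le_iff₀ hD]
  have h1 : |2 * b ^ 2 - 2 * c * (1 + a + c)| ≤ c * (10 * (1 + a) + 2 * c) := by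
    rw [abs_le]
    constructor <;> nlinarith [sq_nonneg b, mul_nonneg ha hc, mul_nonneg hc hc]
  have h2 : (1 + a) * (1 + 2 * a + 2 * c)
      ≤ (1 + a) * ((1 + (a + b + c)) * (1 + (a - b + c))) := by gcongr
  have h3 : c * (10 * (1 + a) + 2 * c) ≤ 10 * c * ((1 + a) * (1 + 2 * a + 2 * c)) := by
    have : 10 * (1 + a) + 2 * c ≤ 10 * ((1 + a) * (1 + 2 * a + 2 * c)) := by
      nlinarith [mul_nonneg ha hc, mul_nonneg ha ha]
    nlinarith
  nlinarith [mul_le_mul_of_nonneg_left h2 hc]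

/-- Long displacements only need `0 ≤ cutoff ≤ 1`; short ones need the quadratic bound for `1 / (1 +
‖y‖²)`. -/
lemma abs_cutoff_second_diff_le (R : ℝ) (x w : H) :
    |cutoff R (x + w) + cutoff R (x - w) - 2 * cutoff R x| ≤ 10 * min 1 (‖R⁻¹ • w‖) ^ 2 := by
  rcases le_total 1 ‖R⁻¹ • w‖ with h | h
  · rw [min_eq_left h, abs_le]
    have := cutoff_nonneg R (x + w)
    have := cutoff_nonneg R (x - w)
    have := cutoff_nonneg R x
    have := cutoff_le_one R (x + w)
    have := cutoff_le_one R (x - w)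
    have := cutoff_le_one R x
    constructor <;> linarith
  · rw [min_eq_right h]
    set y := R⁻¹ • x with hy
    set v := R⁻¹ • w with hv
    have e1 : ‖R⁻¹ • (x + w)‖ ^ 2 = ‖y‖ ^ 2 + 2 * inner ℝ y v + ‖v‖ ^ 2 := by
      rw [smul_add, norm_add_sq_real]
    have e2 : ‖R⁻¹ • (x - w)‖ ^ 2 = ‖y‖ ^ 2 - 2 * inner ℝ y v + ‖v‖ ^ 2 := by
      rw [smul_sub, norm_sub_sq_real]
    have hb : (2 * inner ℝ y v) ^ 2 ≤ 4 * ‖y‖ ^ 2 * ‖v‖ ^ 2 := by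
      have := abs_real_inner_le_norm y v
      have := sq_le_sq' (by linarith [neg_abs_le (inner ℝ y v)]) ((le_abs_self _).trans this)
      nlinarith
    have := inv_add_inv_sub_two_inv_le (sq_nonneg ‖y‖) (sq_nonneg ‖v‖) hb
      (by rw [← e1]; positivity) (by rw [← e2]; positivity)
    rw [← e1, ← e2] at this
    refine le_trans (le_of_eq ?_) this
    rw [← abs_neg, cutoff, cutoff, cutoff]
    congr 1
    ring

lemma abs_cutoff_sub_le {R : ℝ} (hR : 0 < R) (x y : H) :
    |cutoff R x - cutoff R y| ≤ ‖x - y‖ / R := by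
  set s := ‖R⁻¹ • x‖ with hs
  set t := ‖R⁻¹ • y‖ with ht
  have hs0 : 0 ≤ s := norm_nonneg _
  have ht0 : 0 ≤ t := norm_nonneg _
  have h1 : |s - t| ≤ ‖x - y‖ / R := by
    refine (abs_norm_sub_norm_le _ _).trans (le_of_eq ?_)
    rw [← smul_sub, norm_smul, Real.norm_of_nonneg (inv_nonneg.2 hR.le), div_eq_inv_mul]
  have e : cutoff R x - cutoff R y = (s - t) * ((s + t) / ((1 + s ^ 2) * (1 + t ^ 2))) := by
    rw [cutoff, cutoff, ← hs, ← ht]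
    field_simp
    ring
  have h2 : (s + t) / ((1 + s ^ 2) * (1 + t ^ 2)) ≤ 1 := by
    rw [div_le_one (by positivity)]
    nlinarith [sq_nonneg (s - 1), sq_nonneg (t - 1), sq_nonneg (s * t)]
  rw [e, abs_mul, abs_of_nonneg (by positivity : 0 ≤ (s + t) / ((1 + s ^ 2) * (1 + t ^ 2)))]
  calc _ ≤ |s - t| * 1 := by gcongr
    _ ≤ _ := by rw [mul_one]; exact h1

lemma abs_cutoff_gridPoint_single_sub_le {h R : ℝ} (hh : 0 < h) (hR : 0 < R) (β : Idx N)
    (i : Fin N) : |cutoff R (gridPoint h (β + Pi.single i 1)) - cutoff R (gridPoint h β)|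
      ≤ R⁻¹ * h := by
  refine (abs_cutoff_sub_le hR _ _).trans (le_of_eq ?_)
  rw [gridPoint_add, add_sub_cancel_left, norm_gridPoint_single hh]
  simp [div_eq_inv_mul]

/-- Half the second-difference constant `10`, summed against the weights. This is the diffusion
error in the tail estimate. -/
lemma stencilOp_cutoff_le {ι : Type*} {ζ : ι → Idx N} {a : ι → ℝ} (hS : SymStencil ζ a) (h : ℝ)
    {R : ℝ} (hR : 0 < R) (β : Idx N) :
    stencilOp ζ a (fun β => cutoff R (gridPoint h β)) β ≤ 5 * truncMoment h ζ a R := by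
  have hb : ∀ β : Idx N, |cutoff R (gridPoint h β)| ≤ 1 := fun β => by
    rw [abs_of_nonneg (cutoff_nonneg R (gridPoint h β))]
    exact cutoff_le_one R (gridPoint h β)
  rw [stencilOp_eq_half_second_diff hS hb]
  refine (le_abs_self _).trans ?_
  rw [truncMoment, ← tsum_mul_left, ← Real.norm_eq_abs]
  refine tsum_of_norm_bounded
    ((summable_truncMoment hS.nonneg hS.summable h hR.le).mul_left 5).hasSum fun γ => ?_
  rw [norm_mul, Real.norm_of_nonneg (by linarith [hS.nonneg γ] : 0 ≤ a γ / 2), gridPoint_add,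
    gridPoint_sub, Real.norm_eq_abs]
  have h1 := abs_cutoff_second_diff_le R (gridPoint h β) (gridPoint h (ζ γ))
  rw [norm_smul, Real.norm_of_nonneg (inv_nonneg.2 hR.le), ← div_eq_inv_mul] at h1
  have h2 := mul_le_mul_of_nonneg_right h1 (by linarith [hS.nonneg γ] : 0 ≤ a γ / 2)
  linarith

end Cutoff

/-! ### Truncated moments: uniform bounds, and smallness under each of the three alternatives. -/

section Weights

variable {N : ℕ} {z : ℝ → Idx N → Idx N} {ω : ℝ → Idx N → ℝ} {h : ℝ}

lemma IsSymmetricStencil.symStencil (hs : IsSymmetricStencil z ω) (hh : h ∈ Ioo (0 : ℝ) 1) :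
    SymStencil (fun γ : {γ : Idx N // γ ≠ 0} => z h γ) (fun γ => ω h γ) where
  nonneg γ := hs.nonneg h hh γ γ.2
  summable := hs.summable h hh
  exists_neg := ⟨(Equiv.neg (Idx N)).subtypeEquiv fun γ => by simp,
    fun γ => ⟨hs.odd h hh γ γ.2, hs.symm h hh γ γ.2⟩⟩

lemma ofReal_truncMoment {ι : Type*} {ζ : ι → Idx N} {a : ι → ℝ} (hS : SymStencil ζ a) (h : ℝ)
    {R : ℝ} (hR : 0 < R) : ENNReal.ofReal (truncMoment h ζ a R)
      = ∑' γ, ENNReal.ofReal (a γ * min 1 (‖gridPoint h (ζ γ)‖ / R) ^ 2) :=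
  ENNReal.ofReal_tsum_of_nonneg (fun γ => mul_nonneg (hS.nonneg γ) (sq_nonneg _))
    (summable_truncMoment hS.nonneg hS.summable h hR.le)

lemma sq_min_one_div_le {ρ R : ℝ} (hR : 0 < R) (hρ : 0 ≤ ρ) :
    min 1 (ρ / R) ^ 2 ≤ R⁻¹ ^ 2 * ρ ^ 2 := by
  have h0 : 0 ≤ min 1 (ρ / R) := le_min zero_le_one (by positivity)
  calc _ ≤ (ρ / R) ^ 2 := by gcongr; exact min_le_right _ _
    _ = _ := by ring

/-- Below radius `1` the truncated moment is controlled by second moments. -/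
lemma ofReal_mul_min_sq_le {ρ R w : ℝ} (hh : 0 < h) (hR : 0 < R) (hw : 0 ≤ w)
    (hρ : ρ = 0 ∨ h ≤ ρ) (hρ1 : ρ ≤ 1) :
    ENNReal.ofReal (w * min 1 (ρ / R) ^ 2) ≤ ENNReal.ofReal (R⁻¹ ^ 2) *
      (Icc h 1).indicator (fun ρ => ENNReal.ofReal (ρ ^ 2 * w)) ρ := by
  rcases hρ with rfl | hρ
  · simp
  · rw [indicator_of_mem (show ρ ∈ Icc h 1 from ⟨hρ, hρ1⟩), ← ENNReal.ofReal_mul (by positivity)]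
    refine ENNReal.ofReal_le_ofReal ?_
    have := mul_le_mul_of_nonneg_left (sq_min_one_div_le hR (hh.le.trans hρ)) hw
    linarith

/-- Jumps up to `1` contribute through their second moment divided by `R²`, longer ones through
their mass. The bound need not vanish as `R → ∞`, but uniformity in `h` at a fixed scale is all the
time estimate needs. -/
lemma LevyWeights.exists_truncMoment_le (hω : LevyWeights z ω) :
    ∃ C, 0 ≤ C ∧ ∀ h ∈ Ioo (0 : ℝ) 1, ∀ R, 0 < R →
      truncMoment h (fun γ : {γ : Idx N // γ ≠ 0} => z h γ) (fun γ => ω h γ) R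
        ≤ C * (1 + R⁻¹ ^ 2) := by
  obtain ⟨hs, C, hC⟩ := hω
  refine ⟨C, C.coe_nonneg, fun h hh R hR => ?_⟩
  have hS := hs.symStencil hh
  rw [← ENNReal.ofReal_le_ofReal_iff (mul_nonneg C.coe_nonneg (by positivity)), ofReal_truncMoment hS h hR]
  calc _ ≤ ∑' γ : {γ : Idx N // γ ≠ 0}, ENNReal.ofReal (1 + R⁻¹ ^ 2) *
        ((Icc h 1).indicator (fun ρ => ENNReal.ofReal (ρ ^ 2 * ω h γ)) ‖gridPoint h (z h γ)‖
          + (Ioi 1).indicator (fun ρ => ENNReal.ofReal (ρ ^ 0 * ω h γ))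
            ‖gridPoint h (z h γ)‖) := by
        refine ENNReal.tsum_le_tsum fun γ => ?_
        have hw := hS.nonneg γ
        rcases le_or_gt ‖gridPoint h (z h γ)‖ 1 with h1 | h1
        · refine (ofReal_mul_min_sq_le hh.1 hR hw
            (norm_gridPoint_eq_zero_or_le hh.1 (z h γ)) h1).trans ?_
          gcongr
          · linarith
          · exact le_self_add
        · rw [indicator_of_mem (show _ ∈ Ioi (1 : ℝ) from h1), pow_zero, one_mul]
          calc ENNReal.ofReal (ω h γ * min 1 (‖gridPoint h (z h γ)‖ / R) ^ 2)
              ≤ 1 * ENNReal.ofReal (ω h γ) := by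
                rw [one_mul]
                exact ENNReal.ofReal_le_ofReal
                  (mul_le_of_le_one_right hw (min_one_sq_le_one (by positivity)))
            _ ≤ _ := by
                gcongr
                · rw [← ENNReal.ofReal_one]
                  exact ENNReal.ofReal_le_ofReal (by linarith [sq_nonneg R⁻¹])
                · exact le_add_self
    _ = ENNReal.ofReal (1 + R⁻¹ ^ 2) *
        (weightSum h (z h) (ω h) (Icc h 1) 2 + weightSum h (z h) (ω h) (Ioi 1) 0) := by
        rw [ENNReal.tsum_mul_left, ENNReal.tsum_add]; rfl
    _ ≤ ENNReal.ofReal (1 + R⁻¹ ^ 2) * C := by gcongr; exact hC h hh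
    _ = _ := by
        rw [mul_comm, ENNReal.ofReal_mul C.coe_nonneg, ENNReal.ofReal_coe_nnreal]

/-- Uniform smallness of the truncated moments at large scales. -/
def UniformlyTight (z : ℝ → Idx N → Idx N) (ω : ℝ → Idx N → ℝ) : Prop :=
  ∀ ε > 0, ∃ R₀ ≥ 1, ∀ R ≥ R₀, ∀ h ∈ Ioo (0 : ℝ) 1,
    truncMoment h (fun γ : {γ : Idx N // γ ≠ 0} => z h γ) (fun γ => ω h γ) R ≤ ε

lemma uniformlyTight_of_le {b : ℝ → ℝ} (hb : Tendsto b atTop (𝓝 0))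
    (h : ∀ R > 1, ∀ h ∈ Ioo (0 : ℝ) 1,
      truncMoment h (fun γ : {γ : Idx N // γ ≠ 0} => z h γ) (fun γ => ω h γ) R ≤ b R) :
    UniformlyTight z ω := by
  intro ε hε
  obtain ⟨R₀, hR₀⟩ := eventually_atTop.1 (hb.eventually (gt_mem_nhds hε))
  exact ⟨max R₀ 2, le_max_of_le_right one_le_two, fun R hR h' hh' =>
    (h R (by linarith [(le_max_right _ _).trans hR]) h' hh').trans
      (hR₀ R ((le_max_left _ _).trans hR)).le⟩

/-- For long jumps `min(1, ρ/R)² ≤ ρ/R`, and for short ones `R⁻² ≤ R⁻¹`; hence decay like `1/R`. -/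
lemma FirstMomentWeights.uniformlyTight (hω : FirstMomentWeights z ω) : UniformlyTight z ω := by
  obtain ⟨hs, C, hC⟩ := hω
  refine uniformlyTight_of_le (b := fun R => C * R⁻¹)
    (by simpa using tendsto_inv_atTop_zero.const_mul (C : ℝ)) fun R hR h hh => ?_
  have hR0 : 0 < R := by linarith
  have hS := hs.symStencil hh
  have hRinv : R⁻¹ ≤ 1 := inv_le_one_of_one_le₀ hR.le
  rw [← ENNReal.ofReal_le_ofReal_iff (mul_nonneg C.coe_nonneg (by positivity)), ofReal_truncMoment hS h hR0]
  calc _ ≤ ∑' γ : {γ : Idx N // γ ≠ 0}, ENNReal.ofReal R⁻¹ *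
        ((Icc h 1).indicator (fun ρ => ENNReal.ofReal (ρ ^ 2 * ω h γ)) ‖gridPoint h (z h γ)‖
          + (Ioi 1).indicator (fun ρ => ENNReal.ofReal (ρ ^ 1 * ω h γ))
            ‖gridPoint h (z h γ)‖) := by
        refine ENNReal.tsum_le_tsum fun γ => ?_
        have hw := hS.nonneg γ
        rcases le_or_gt ‖gridPoint h (z h γ)‖ 1 with h1 | h1
        · refine (ofReal_mul_min_sq_le hh.1 hR0 hw
            (norm_gridPoint_eq_zero_or_le hh.1 (z h γ)) h1).trans ?_
          gcongr
          · rw [sq]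
            exact mul_le_of_le_one_right (by positivity) hRinv
          · exact le_self_add
        · rw [indicator_of_mem (show _ ∈ Ioi (1 : ℝ) from h1), mul_add]
          refine le_trans ?_ le_add_self
          rw [← ENNReal.ofReal_mul (by positivity)]
          refine ENNReal.ofReal_le_ofReal ?_
          have hm0 : 0 ≤ min 1 (‖gridPoint h (z h γ)‖ / R) := le_min zero_le_one (by positivity)
          have : min 1 (‖gridPoint h (z h γ)‖ / R) ^ 2 ≤ ‖gridPoint h (z h γ)‖ / R := by
            rw [sq]
            exact (mul_le_of_le_one_left hm0 (min_le_left _ _)).trans (min_le_right _ _)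
          refine (mul_le_mul_of_nonneg_left this hw).trans (le_of_eq ?_)
          ring
    _ = ENNReal.ofReal R⁻¹ *
        (weightSum h (z h) (ω h) (Icc h 1) 2 + weightSum h (z h) (ω h) (Ioi 1) 1) := by
        rw [ENNReal.tsum_mul_left, ENNReal.tsum_add]; rfl
    _ ≤ ENNReal.ofReal R⁻¹ * C := by gcongr; exact hC h hh
    _ = _ := by
        rw [mul_comm, ENNReal.ofReal_mul C.coe_nonneg, ENNReal.ofReal_coe_nnreal]

/-- Jumps are split at `1` and at `R`. The short ones decay like `R⁻²`, and the other two ranges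
together like `R^(-α)`. -/
lemma FractionalWeights.uniformlyTight (hω : FractionalWeights z ω) : UniformlyTight z ω := by
  obtain ⟨⟨hs, C, hC⟩, α, hα, C', hC'⟩ := hω
  refine uniformlyTight_of_le (b := fun R => C * R⁻¹ ^ 2 + C' * R ^ (-α)) ?_ fun R hR h hh => ?_
  · have h1 := ((tendsto_inv_atTop_zero (𝕜 := ℝ)).pow 2).const_mul (C : ℝ)
    have h2 := (tendsto_rpow_neg_atTop hα.1).const_mul (C' : ℝ)
    simpa using h1.add h2
  have hR0 : 0 < R := by linarith
  have hS := hs.symStencil hh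
  rw [← ENNReal.ofReal_le_ofReal_iff (add_nonneg (mul_nonneg C.coe_nonneg (by positivity))
    (mul_nonneg C'.coe_nonneg (by positivity))), ofReal_truncMoment hS h hR0]
  calc _ ≤ ∑' γ : {γ : Idx N // γ ≠ 0}, (ENNReal.ofReal (R⁻¹ ^ 2) *
          (Icc h 1).indicator (fun ρ => ENNReal.ofReal (ρ ^ 2 * ω h γ)) ‖gridPoint h (z h γ)‖
        + (ENNReal.ofReal (R⁻¹ ^ 2) *
          (Ioc 1 R).indicator (fun ρ => ENNReal.ofReal (ρ ^ 2 * ω h γ)) ‖gridPoint h (z h γ)‖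
          + (Ioi R).indicator (fun ρ => ENNReal.ofReal (ρ ^ 0 * ω h γ))
            ‖gridPoint h (z h γ)‖)) := by
        refine ENNReal.tsum_le_tsum fun γ => ?_
        have hw := hS.nonneg γ
        rcases le_or_gt ‖gridPoint h (z h γ)‖ 1 with h1 | h1
        · exact (ofReal_mul_min_sq_le hh.1 hR0 hw
            (norm_gridPoint_eq_zero_or_le hh.1 (z h γ)) h1).trans le_self_add
        · refine le_trans ?_ le_add_self
          rcases le_or_gt ‖gridPoint h (z h γ)‖ R with h2 | h2
          · refine le_trans ?_ le_self_add
            rw [indicator_of_mem (show _ ∈ Ioc (1 : ℝ) R from ⟨h1, h2⟩),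
              ← ENNReal.ofReal_mul (by positivity)]
            refine ENNReal.ofReal_le_ofReal ?_
            have := mul_le_mul_of_nonneg_left
              (sq_min_one_div_le hR0 (norm_nonneg (gridPoint h (z h γ)))) hw
            linarith
          · refine le_trans ?_ le_add_self
            rw [indicator_of_mem (show _ ∈ Ioi R from h2), pow_zero, one_mul]
            exact ENNReal.ofReal_le_ofReal
              (mul_le_of_le_one_right hw (min_one_sq_le_one (by positivity)))
    _ = ENNReal.ofReal (R⁻¹ ^ 2) * weightSum h (z h) (ω h) (Icc h 1) 2
        + (ENNReal.ofReal (R⁻¹ ^ 2) * weightSum h (z h) (ω h) (Ioc 1 R) 2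
          + weightSum h (z h) (ω h) (Ioi R) 0) := by
        rw [ENNReal.tsum_add, ENNReal.tsum_add, ENNReal.tsum_mul_left, ENNReal.tsum_mul_left]; rfl
    _ = ENNReal.ofReal (R⁻¹ ^ 2) * weightSum h (z h) (ω h) (Icc h 1) 2
        + ENNReal.ofReal (R ^ (-α)) *
          (ENNReal.ofReal (R ^ (α - 2)) * weightSum h (z h) (ω h) (Ioc 1 R) 2
            + ENNReal.ofReal (R ^ α) * weightSum h (z h) (ω h) (Ioi R) 0) := by
        -- Extracting `R^(-α)` leaves precisely the combination bounded in the fractional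
        -- hypothesis.
        have e1 : R ^ (-α) * R ^ (α - 2) = R⁻¹ ^ 2 := by
          rw [← Real.rpow_add hR0, ← Real.rpow_natCast, Real.inv_rpow hR0.le, ← Real.rpow_neg hR0.le]
          congr 1
          push_cast
          ring
        have e2 : R ^ (-α) * R ^ α = 1 := by
          rw [← Real.rpow_add hR0, neg_add_cancel, Real.rpow_zero]
        rw [mul_add, ← mul_assoc, ← mul_assoc, ← ENNReal.ofReal_mul (by positivity),
          ← ENNReal.ofReal_mul (by positivity), e1, e2, ENNReal.ofReal_one, one_mul]
    _ ≤ ENNReal.ofReal (R⁻¹ ^ 2) * C + ENNReal.ofReal (R ^ (-α)) * C' := by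
        gcongr
        · exact le_self_add.trans (hC h hh)
        · exact hC' R hR h hh
    _ = _ := by
        rw [ENNReal.ofReal_add (mul_nonneg C.coe_nonneg (by positivity)) (mul_nonneg C'.coe_nonneg (by positivity)),
          ENNReal.ofReal_mul C.coe_nonneg, ENNReal.ofReal_mul C'.coe_nonneg, ENNReal.ofReal_coe_nnreal,
          ENNReal.ofReal_coe_nnreal, mul_comm, mul_comm (C' : ℝ≥0∞)]

/-- The weights are known only through the action of the operator on summable functions. Testing at
the origin with `min(1, |z|/R)²` cut to finitely many points bounds each partial sum of the moment
by `Δ_h ψ(0)`. This is at most `2N/R²`, because `ψ(0) = 0` and `ψ(±h e_i) ≤ h²/R²`. -/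
lemma uniformlyTight_of_discLaplacian (hs : IsSymmetricStencil z ω)
    (hΔ : ∀ h ∈ Ioo (0 : ℝ) 1, ∀ ψ : Idx N → ℝ, (Summable fun β => |ψ β|) →
      latticeOp (z h) (ω h) ψ = discLaplacian h ψ) : UniformlyTight z ω := by
  refine uniformlyTight_of_le (b := fun R => 2 * N * R⁻¹ ^ 2) ?_ fun R hR h hh => ?_
  · simpa using ((tendsto_inv_atTop_zero (𝕜 := ℝ)).pow 2).const_mul (2 * N : ℝ)
  have hR0 : 0 < R := by linarith
  have hS := hs.symStencil hh
  refine (summable_truncMoment hS.nonneg hS.summable h hR0.le).tsum_le_of_sum_le fun s => ?_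
  classical
  -- Restricting the test function to the displacements occurring in `s` makes it summable, and
  -- positivity lets the other terms of the operator be dropped.
  let B : Finset (Idx N) := s.image fun γ : {γ : Idx N // γ ≠ 0} => z h γ
  let m : Idx N → ℝ := fun β => min 1 (‖gridPoint h β‖ / R) ^ 2
  let ψ : Idx N → ℝ := fun β => if β ∈ B then m β else 0
  have hψ0 : ψ 0 = 0 := by simp [ψ, m, gridPoint_zero]
  have hψn : ∀ β, 0 ≤ ψ β := fun β => by
    simp only [ψ]; split_ifs
    · exact sq_nonneg _
    · exact le_rfl
  have hψm : ∀ β, ψ β ≤ m β := fun β => by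
    simp only [ψ]; split_ifs
    · exact le_rfl
    · exact sq_nonneg _
  have hψs : Summable ψ := summable_of_ne_finset_zero (s := B) fun β hβ => by simp [ψ, hβ]
  have hlap := congrFun (hΔ h hh ψ hψs.abs) 0
  have hsingle : ∀ (i : Fin N) (k : ℤ), |(k : ℝ)| = 1 → ψ (Pi.single i k) ≤ R⁻¹ ^ 2 * h ^ 2 :=
    fun i k hk => by
      refine (hψm _).trans ?_
      have hm : m (Pi.single i k) ≤ R⁻¹ ^ 2 * ‖gridPoint h (Pi.single i k : Idx N)‖ ^ 2 :=
        sq_min_one_div_le hR0 (norm_nonneg _)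
      rwa [norm_gridPoint_single hh.1, hk, mul_one] at hm
  have hle : latticeOp (z h) (ω h) ψ 0 ≤ 2 * N * R⁻¹ ^ 2 := by
    rw [hlap, discLaplacian]
    calc _ ≤ ∑ _i : Fin N, 2 * R⁻¹ ^ 2 := by
          refine Finset.sum_le_sum fun i _ => ?_
          rw [zero_add, zero_sub, hψ0, ← Pi.single_neg, div_le_iff₀ (pow_pos hh.1 2)]
          have := hsingle i 1 (by simp)
          have := hsingle i (-1) (by simp)
          linarith
      _ = _ := by simp; ring
  refine le_trans ?_ hle
  have hsum := summable_stencil_term (ζ := fun γ : {γ : Idx N // γ ≠ 0} => z h γ) hS.nonneg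
    hS.summable (ψ := ψ) (C := 1) (fun β => by
      rw [abs_of_nonneg (hψn β)]
      exact (hψm β).trans (min_one_sq_le_one (by positivity))) 0
  refine le_trans (Finset.sum_le_sum fun γ hγ => ?_) (hsum.sum_le_tsum s fun γ _ => ?_)
  · have : z h γ ∈ B := Finset.mem_image_of_mem (fun γ : {γ : Idx N // γ ≠ 0} => z h γ) hγ
    simp only [zero_add, hψ0, sub_zero, ψ, if_pos this, m]
    rw [mul_comm]
  · rw [zero_add, hψ0, sub_zero]
    exact mul_nonneg (hψn _) (hS.nonneg γ)

end Weights

/-! ### Grid cells: measure, translations of step functions, and sampling. -/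

section Cells

variable {N : ℕ} {h : ℝ}

/-- The index of the cell containing `x`. -/
def cellIdx (h : ℝ) (x : EuclideanSpace ℝ (Fin N)) : Idx N := fun i => ⌈x i / h - 1 / 2⌉

/-- Cells are open on the left and closed on the right, which is why the index is a ceiling. -/
lemma mem_cell_iff (hh : 0 < h) {β : Idx N} {x : EuclideanSpace ℝ (Fin N)} :
    x ∈ cell h β ↔ cellIdx h x = β := by
  rw [funext_iff, cell, mem_ofPred_eq]
  refine forall_congr' fun i => ?_
  rw [cellIdx, Int.ceil_eq_iff, mem_Ioc, gridPoint, lt_sub_iff_add_lt (b := (1 / 2 : ℝ)),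
    lt_div_iff₀ hh,
    sub_le_iff_le_add (c := (1 / 2 : ℝ)), div_le_iff₀ hh]
  constructor <;> rintro ⟨h1, h2⟩ <;> constructor <;> nlinarith

lemma self_mem_cell (hh : 0 < h) (x : EuclideanSpace ℝ (Fin N)) : x ∈ cell h (cellIdx h x) :=
  (mem_cell_iff hh).2 rfl

lemma spaceInterp_eq (hh : 0 < h) (V : Idx N → ℝ) (x : EuclideanSpace ℝ (Fin N)) :
    spaceInterp h V x = V (cellIdx h x) := by
  rw [spaceInterp, tsum_eq_single (cellIdx h x), indicator_of_mem (self_mem_cell hh x)]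
  exact fun β hβ => indicator_of_notMem (fun hx => hβ ((mem_cell_iff hh).1 hx).symm) _

lemma measurable_cellIdx (h : ℝ) :
    Measurable (cellIdx h : EuclideanSpace ℝ (Fin N) → Idx N) := by
  refine measurable_pi_lambda _ fun i => Int.measurable_ceil.comp ?_
  fun_prop

lemma cell_eq_preimage (hh : 0 < h) (β : Idx N) : cell h β = cellIdx h ⁻¹' {β} := by
  ext x; exact mem_cell_iff hh

lemma measurableSet_cell (hh : 0 < h) (β : Idx N) : MeasurableSet (cell h β) := by
  rw [cell_eq_preimage hh]
  exact measurable_cellIdx h (measurableSet_singleton β)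

lemma volume_setOf_forall_mem {S : Fin N → Set ℝ} (hS : ∀ i, MeasurableSet (S i)) :
    volume {x : EuclideanSpace ℝ (Fin N) | ∀ i, x i ∈ S i} = ∏ i, volume (S i) := by
  rw [← volume_pi_pi, ← (PiLp.volume_preserving_ofLp (Fin N)).measure_preimage
    (MeasurableSet.univ_pi hS).nullMeasurableSet]
  congr 1
  ext x
  simp

lemma cell_eq_setOf (h : ℝ) (β : Idx N) : cell h β =
    {x | ∀ i, x i ∈ Ioc (h * β i - h / 2) (h * β i + h / 2)} := by
  ext x
  refine forall_congr' fun i => ?_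
  simp only [gridPoint, mem_Ioc]
  constructor <;> rintro ⟨h1, h2⟩ <;> constructor <;> linarith

lemma volume_cell (hh : 0 < h) (β : Idx N) : volume (cell h β) = ENNReal.ofReal (h ^ N) := by
  rw [cell_eq_setOf, volume_setOf_forall_mem fun i => measurableSet_Ioc]
  simp only [Real.volume_Ioc]
  rw [Finset.prod_congr rfl fun i _ => by
    rw [show h * (β i : ℝ) + h / 2 - (h * β i - h / 2) = h by ring], Finset.prod_const,
    Finset.card_univ, Fintype.card_fin, ENNReal.ofReal_pow hh.le]

lemma lintegral_eq_tsum_cell (hh : 0 < h) (k : EuclideanSpace ℝ (Fin N) → ℝ≥0∞) :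
    ∫⁻ x, k x = ∑' β, ∫⁻ x in cell h β, k x := by
  rw [← lintegral_iUnion (measurableSet_cell hh), ← setLIntegral_univ]
  · congr
    exact (eq_univ_of_forall fun x => mem_iUnion.2 ⟨_, self_mem_cell hh x⟩).symm
  · intro β γ hβγ
    refine Set.disjoint_left.2 fun x hx hx' => hβγ ?_
    rw [← (mem_cell_iff hh).1 hx, (mem_cell_iff hh).1 hx']

lemma setLIntegral_cell_congr (hh : 0 < h) (k : Idx N → EuclideanSpace ℝ (Fin N) → ℝ≥0∞)
    (β : Idx N) : ∫⁻ x in cell h β, k (cellIdx h x) x = ∫⁻ x in cell h β, k β x :=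
  setLIntegral_congr_fun (measurableSet_cell hh β) fun x hx => by
    simp only [(mem_cell_iff hh).1 hx]

lemma lintegral_comp_cellIdx (hh : 0 < h) (k : Idx N → ℝ≥0∞) :
    ∫⁻ x, k (cellIdx h x) = ENNReal.ofReal (h ^ N) * ∑' β, k β := by
  rw [lintegral_eq_tsum_cell hh, ← ENNReal.tsum_mul_left]
  refine tsum_congr fun β => ?_
  rw [setLIntegral_cell_congr hh (fun β _ => k β), setLIntegral_const, volume_cell hh, mul_comm]

lemma norm_le_of_forall_abs_le {x : EuclideanSpace ℝ (Fin N)} {c : ℝ} (h : ∀ i, |x i| ≤ c) :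
    ‖x‖ ≤ N * c := by
  have e : x = ∑ i, EuclideanSpace.single i (x i) := by
    ext j
    simp [Finset.sum_apply]
  rw [e]
  refine (norm_sum_le _ _).trans ?_
  refine (Finset.sum_le_sum fun i _ => (?_ : _ ≤ c)).trans (by simp)
  rw [PiLp.norm_single]
  exact h i

lemma norm_sub_gridPoint_le (hh : 0 < h) (x : EuclideanSpace ℝ (Fin N)) :
    ‖x - gridPoint h (cellIdx h x)‖ ≤ N * (h / 2) := by
  refine norm_le_of_forall_abs_le fun i => ?_
  have := self_mem_cell hh x i
  rw [PiLp.sub_apply, abs_le]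
  exact ⟨this.1.le, this.2⟩

/-- Possible cell displacements under translation by `w`. -/
def cellShifts (h : ℝ) (w : EuclideanSpace ℝ (Fin N)) : Finset (Idx N) :=
  Fintype.piFinset fun i => {⌊w i / h⌋, ⌊w i / h⌋ + 1}

lemma card_cellShifts_le (h : ℝ) (w : EuclideanSpace ℝ (Fin N)) :
    (cellShifts h w).card ≤ 2 ^ N := by
  rw [cellShifts, Fintype.card_piFinset]
  refine (Finset.prod_le_prod' fun i _ => Finset.card_le_two).trans ?_
  simp

lemma norm_gridPoint_le_of_mem_cellShifts (hh : 0 < h) {w : EuclideanSpace ℝ (Fin N)} {η : Idx N}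
    (hη : η ∈ cellShifts h w) : ‖gridPoint h η‖ ≤ ‖w‖ + N * h := by
  have : ‖gridPoint h η - w‖ ≤ N * h := by
    refine norm_le_of_forall_abs_le fun i => ?_
    have h1 := Fintype.mem_piFinset.1 hη i
    have h2 := Int.floor_le (w i / h)
    have h3 := Int.lt_floor_add_one (w i / h)
    rw [le_div_iff₀ hh] at h2
    rw [div_lt_iff₀ hh] at h3
    rw [PiLp.sub_apply, gridPoint, abs_le]
    rcases Finset.mem_insert.1 h1 with h1 | h1
    · simp only [h1]
      constructor <;> nlinarith
    · simp only [Finset.mem_singleton.1 h1]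
      push_cast
      constructor <;> nlinarith
  have h2 := norm_add_le w (gridPoint h η - w)
  rw [add_sub_cancel] at h2
  linarith

/-- In each coordinate `⌈p⌉ + ⌊q⌋ ≤ ⌈p + q⌉ ≤ ⌈p⌉ + ⌊q⌋ + 1`, leaving two possible displacements. -/
lemma cellIdx_add_sub_mem (h : ℝ) (x w : EuclideanSpace ℝ (Fin N)) :
    cellIdx h (x + w) - cellIdx h x ∈ cellShifts h w := by
  refine Fintype.mem_piFinset.2 fun i => ?_
  have e : (x + w) i / h - 1 / 2 = (x i / h - 1 / 2) + w i / h := by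
    rw [PiLp.add_apply]; ring
  simp only [Pi.sub_apply, cellIdx, e, Finset.mem_insert, Finset.mem_singleton]
  set p := x i / h - 1 / 2
  set q := w i / h
  have h1 : ⌈p⌉ + ⌊q⌋ ≤ ⌈p + q⌉ := by
    rw [← Int.ceil_add_intCast]
    exact Int.ceil_mono (by linarith [Int.floor_le q])
  have h2 : ⌈p + q⌉ ≤ ⌈p⌉ + (⌊q⌋ + 1) := by
    rw [← Int.ceil_add_intCast]
    refine Int.ceil_mono ?_
    push_cast
    linarith [Int.lt_floor_add_one q]
  omega

/-- `L¹` modulus of continuity of a piecewise constant function in terms of lattice shifts. -/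
lemma lintegral_translate_sub_le_sum (hh : 0 < h) (V : Idx N → ℝ)
    (w : EuclideanSpace ℝ (Fin N)) :
    ∫⁻ x, ‖V (cellIdx h (x + w)) - V (cellIdx h x)‖ₑ
      ≤ ∑ η ∈ cellShifts h w, ENNReal.ofReal (h ^ N) * shiftDist V η := by
  calc _ ≤ ∫⁻ x, ∑ η ∈ cellShifts h w, ‖V (cellIdx h x + η) - V (cellIdx h x)‖ₑ := by
        refine lintegral_mono fun x => ?_
        refine le_trans (le_of_eq ?_)
          (Finset.single_le_sum (f := fun η => ‖V (cellIdx h x + η) - V (cellIdx h x)‖ₑ)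
          (fun _ _ => zero_le) (cellIdx_add_sub_mem h x w))
        simp only [add_sub_cancel]
    _ = _ := by
        rw [lintegral_finsetSum']
        · refine Finset.sum_congr rfl fun η _ => ?_
          exact lintegral_comp_cellIdx hh fun β => ‖V (β + η) - V β‖ₑ
        · intro η _
          exact ((measurable_of_countable fun β : Idx N => ‖V (β + η) - V β‖ₑ).comp
            (measurable_cellIdx h)).aemeasurable

/-- A point leaves its cell only if some coordinate `i` leaves its interval, which confines that
coordinate to a set of length at most `|w i|`. -/
lemma volume_cell_inter_translate_le (hh : 0 < h) (β : Idx N) (w : EuclideanSpace ℝ (Fin N)) :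
    volume (cell h β ∩ {x | cellIdx h (x + w) ≠ cellIdx h x})
      ≤ ENNReal.ofReal (h ^ N) * ∑ i, ENNReal.ofReal (|w i| / h) := by
  let I : Fin N → Set ℝ := fun i => Ioc (h * β i - h / 2) (h * β i + h / 2)
  -- For fixed `i`, the sides of the box on which coordinate `i` is the one that exits.
  let S : Fin N → Fin N → Set ℝ := fun i k => if k = i then I i ∩ {s | s + w i ∉ I i} else I k
  have hI : ∀ i, MeasurableSet (I i) := fun i => measurableSet_Ioc
  have hIw : ∀ i, MeasurableSet {s | s + w i ∉ I i} := fun i =>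
    ((measurable_add_const (w i)) (hI i)).compl
  have hS : ∀ i k, MeasurableSet (S i k) := fun i k => by
    simp only [S]; split_ifs
    · exact (hI i).inter (hIw i)
    · exact hI k
  have hsub : cell h β ∩ {x | cellIdx h (x + w) ≠ cellIdx h x}
      ⊆ ⋃ i, {x : EuclideanSpace ℝ (Fin N) | ∀ k, x k ∈ S i k} := by
    rintro x ⟨hx, hxw⟩
    rw [mem_ofPred_eq, (mem_cell_iff hh).1 hx, Ne, ← mem_cell_iff hh] at hxw
    rw [cell_eq_setOf] at hx hxw
    obtain ⟨i, hi⟩ := not_forall.1 hxw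
    refine mem_iUnion.2 ⟨i, fun k => ?_⟩
    simp only [S]
    split_ifs with hk
    · subst hk; exact ⟨hx k, hi⟩
    · exact hx k
  have hvI : ∀ i, volume (I i) = ENNReal.ofReal h := fun i => by
    simp only [I, Real.volume_Ioc]; congr 1; ring
  have hvS : ∀ i k, volume (S i k)
      ≤ ENNReal.ofReal h * if k = i then ENNReal.ofReal (|w i| / h) else 1 := fun i k => by
    simp only [S]
    split_ifs with hk
    · have hsub' : I i ∩ {s | s + w i ∉ I i} ⊆
          Ioc (h * β i - h / 2) (h * β i - h / 2 - w i) ∪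
            Ioc (h * β i + h / 2 - w i) (h * β i + h / 2) := by
        rintro s ⟨⟨h1, h2⟩, h3⟩
        simp only [I, mem_ofPred_eq, mem_Ioc, not_and_or, not_lt, not_le] at h3
        rcases h3 with h3 | h3
        · left; constructor <;> linarith
        · right; constructor <;> linarith
      refine (measure_mono hsub').trans ((measure_union_le _ _).trans (le_of_eq ?_))
      rw [Real.volume_Ioc, Real.volume_Ioc, ← ENNReal.ofReal_mul hh.le, mul_div_cancel₀ _ hh.ne']
      rcases le_total 0 (w i) with h0 | h0
      · rw [ENNReal.ofReal_of_nonpos (by linarith), zero_add, abs_of_nonneg h0]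
        congr 1; ring
      · rw [ENNReal.ofReal_of_nonpos (p := h * β i + h / 2 - _) (by linarith), add_zero,
          abs_of_nonpos h0]
        congr 1; ring
    · rw [hvI, mul_one]
  refine (measure_mono hsub).trans ((measure_iUnion_le _).trans ?_)
  rw [tsum_fintype, Finset.mul_sum]
  refine Finset.sum_le_sum fun i _ => ?_
  rw [volume_setOf_forall_mem (hS i)]
  refine (Finset.prod_le_prod' fun k _ => hvS i k).trans (le_of_eq ?_)
  rw [Finset.prod_mul_distrib, Finset.prod_const, Finset.card_univ, Fintype.card_fin,
    ENNReal.ofReal_pow hh.le, Finset.prod_ite_eq' Finset.univ i]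
  simp

lemma lintegral_translate_indicator_le (hh : 0 < h) (V : Idx N → ℝ)
    (w : EuclideanSpace ℝ (Fin N)) :
    ∫⁻ x, {x | cellIdx h (x + w) ≠ cellIdx h x}.indicator (fun x => ‖V (cellIdx h x)‖ₑ) x
      ≤ (∑ i, ENNReal.ofReal (|w i| / h)) * (ENNReal.ofReal (h ^ N) * gridL1 V) := by
  rw [lintegral_eq_tsum_cell hh, gridL1, ← ENNReal.tsum_mul_left, ← ENNReal.tsum_mul_left]
  refine ENNReal.tsum_le_tsum fun β => ?_
  have hm : MeasurableSet {x : EuclideanSpace ℝ (Fin N) | cellIdx h (x + w) ≠ cellIdx h x} :=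
    (measurableSet_eq_fun ((measurable_cellIdx h).comp (measurable_add_const w))
      (measurable_cellIdx h)).compl
  rw [lintegral_indicator hm, Measure.restrict_restrict hm, inter_comm,
    setLIntegral_congr_fun (g := fun _ => ‖V β‖ₑ) ((measurableSet_cell hh β).inter hm)
      (fun x hx => by simp only [(mem_cell_iff hh).1 hx.1]), setLIntegral_const]
  refine (mul_le_mul_right (volume_cell_inter_translate_le hh β w) _).trans (le_of_eq ?_)
  ring

/-- Complements `lintegral_translate_sub_le_sum`, whose lattice shifts can be a full cell even for
tiny `w`. Only points changing cell contribute; the value at `x + w` is handled as a translation by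
`-w`. The factor `|w|/h` is useful once `h` is bounded below. -/
lemma lintegral_translate_sub_le_of_large (hh : 0 < h) (V : Idx N → ℝ)
    (w : EuclideanSpace ℝ (Fin N)) :
    ∫⁻ x, ‖V (cellIdx h (x + w)) - V (cellIdx h x)‖ₑ
      ≤ 2 * (∑ i, ENNReal.ofReal (|w i| / h)) * (ENNReal.ofReal (h ^ N) * gridL1 V) := by
  have hV : Measurable fun x : EuclideanSpace ℝ (Fin N) => ‖V (cellIdx h x)‖ₑ :=
    (measurable_of_countable fun β : Idx N => ‖V β‖ₑ).comp (measurable_cellIdx h)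
  have hm : ∀ w, MeasurableSet
      {x : EuclideanSpace ℝ (Fin N) | cellIdx h (x + w) ≠ cellIdx h x} := fun w =>
    (measurableSet_eq_fun ((measurable_cellIdx h).comp (measurable_add_const w))
      (measurable_cellIdx h)).compl
  let k : EuclideanSpace ℝ (Fin N) → EuclideanSpace ℝ (Fin N) → ℝ≥0∞ := fun w =>
    {x | cellIdx h (x + w) ≠ cellIdx h x}.indicator fun x => ‖V (cellIdx h x)‖ₑ
  have hk : ∀ w, Measurable (k w) := fun w => hV.indicator (hm w)
  calc _ ≤ ∫⁻ x, (k (-w) (x + w) + k w x) := by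
        refine lintegral_mono fun x => ?_
        by_cases hx : cellIdx h (x + w) = cellIdx h x
        · simp only [hx, sub_self, enorm_zero]; exact zero_le
        · have h1 : k w x = ‖V (cellIdx h x)‖ₑ := indicator_of_mem (s := {x | _}) hx _
          have h2 : k (-w) (x + w) = ‖V (cellIdx h (x + w))‖ₑ :=
            indicator_of_mem (s := {x | cellIdx h (x + -w) ≠ cellIdx h x})
              (by rw [mem_ofPred_eq, add_neg_cancel_right]; exact Ne.symm hx) _
          rw [h1, h2]
          exact enorm_sub_le
    _ = (∫⁻ x, k (-w) x) + ∫⁻ x, k w x := by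
        rw [lintegral_add_right _ (hk w), lintegral_add_right_eq_self]
    _ ≤ _ := by
        have h1 := lintegral_translate_indicator_le hh V (-w)
        have h2 := lintegral_translate_indicator_le hh V w
        simp only [PiLp.neg_apply, abs_neg] at h1
        refine (add_le_add h1 h2).trans (le_of_eq ?_)
        ring

/-- Sampling a function on a randomly placed grid: some placement is as good as the average
translation error. -/
lemma exists_sample_le {δ : ℝ} (hδ : 0 < δ) {f : EuclideanSpace ℝ (Fin N) → ℝ} (hf : Measurable f)
    {S : ℝ≥0∞} (hS : ∀ w ∈ cell (2 * δ) (0 : Idx N), ∫⁻ x, ‖f (x + w) - f x‖ₑ ≤ S) :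
    ∃ θ, ∫⁻ x, ‖f x - f (gridPoint δ (cellIdx δ x) + θ)‖ₑ ≤ 2 ^ N * S := by
  let p : EuclideanSpace ℝ (Fin N) → EuclideanSpace ℝ (Fin N) := fun x => gridPoint δ (cellIdx δ x)
  have hp : Measurable p :=
    (measurable_of_countable fun β : Idx N => gridPoint δ β).comp (measurable_cellIdx δ)
  let Q : Set (EuclideanSpace ℝ (Fin N)) := cell δ 0
  let B : Set (EuclideanSpace ℝ (Fin N)) := cell (2 * δ) 0
  have hQm : MeasurableSet Q := measurableSet_cell hδ 0
  have hBm : MeasurableSet B := measurableSet_cell (by linarith) 0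
  have hQv : volume Q = ENNReal.ofReal (δ ^ N) := volume_cell hδ 0
  have hBv : volume B = 2 ^ N * ENNReal.ofReal (δ ^ N) := by
    rw [volume_cell (by linarith), mul_pow, ENNReal.ofReal_mul (by positivity),
      ENNReal.ofReal_pow zero_le_two, ENNReal.ofReal_ofNat]
  have hQ0 : volume Q ≠ 0 := by
    rw [hQv]; exact (ENNReal.ofReal_pos.2 (pow_pos hδ N)).ne'
  have hQtop : volume Q ≠ ∞ := by rw [hQv]; exact ENNReal.ofReal_ne_top
  have hmeas : Measurable fun q : EuclideanSpace ℝ (Fin N) × EuclideanSpace ℝ (Fin N) =>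
      ‖f q.1 - f (p q.1 + q.2)‖ₑ :=
    ((hf.comp measurable_fst).sub
      (hf.comp ((hp.comp measurable_fst).add measurable_snd))).enorm
  have hmeas' : Measurable fun q : EuclideanSpace ℝ (Fin N) × EuclideanSpace ℝ (Fin N) =>
      ‖f (q.1 + q.2) - f q.1‖ₑ :=
    ((hf.comp (measurable_fst.add measurable_snd)).sub (hf.comp measurable_fst)).enorm
  -- Some offset does no worse than the average over the cell `Q`.
  obtain ⟨θ, -, hθ⟩ := exists_le_setLAverage (μ := volume)
    (f := fun θ => ∫⁻ x, ‖f x - f (p x + θ)‖ₑ) hQ0 hQtop hmeas.lintegral_prod_left'.aemeasurable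
  refine ⟨θ, hθ.trans ?_⟩
  rw [setLAverage_eq]
  refine ENNReal.div_le_of_le_mul ?_
  -- Substituting `θ = w + (x - p x)` turns the sample point `p x + θ` into `x + w`, with `w` in the
  -- doubled cell `B`. The factor `2 ^ N` is the ratio of volumes of `B` and `Q`.
  have hinner : ∀ x, ∫⁻ θ in Q, ‖f x - f (p x + θ)‖ₑ ≤ ∫⁻ w in B, ‖f (x + w) - f x‖ₑ := by
    intro x
    rw [← lintegral_indicator hQm, ← lintegral_indicator hBm,
      ← lintegral_add_right_eq_self _ (x - p x)]
    refine lintegral_mono fun w => ?_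
    by_cases hw : w + (x - p x) ∈ Q
    · have hwB : w ∈ B := fun i => by
        have h1 := hw i
        have h2 := self_mem_cell hδ x i
        simp only [gridPoint_zero, PiLp.zero_apply, sub_zero, PiLp.add_apply, PiLp.sub_apply, p,
          mem_Ioc] at h1 h2 ⊢
        constructor <;> linarith
      rw [indicator_of_mem hw, indicator_of_mem hwB, ← enorm_neg, neg_sub]
      have : p x + (w + (x - p x)) = x + w := by abel
      rw [this]
    · rw [indicator_of_notMem hw]; exact zero_le
  calc ∫⁻ θ in Q, ∫⁻ x, ‖f x - f (p x + θ)‖ₑ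
      = ∫⁻ x, ∫⁻ θ in Q, ‖f x - f (p x + θ)‖ₑ :=
        (lintegral_lintegral_swap hmeas.aemeasurable).symm
    _ ≤ ∫⁻ x, ∫⁻ w in B, ‖f (x + w) - f x‖ₑ := lintegral_mono hinner
    _ = ∫⁻ w in B, ∫⁻ x, ‖f (x + w) - f x‖ₑ := lintegral_lintegral_swap hmeas'.aemeasurable
    _ ≤ ∫⁻ _w in B, S := setLIntegral_mono measurable_const hS
    _ = _ := by rw [setLIntegral_const, hBv, hQv]; ring

end Cells

/-! ### Total boundedness in `L^r` and an Arzelà–Ascoli theorem. -/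

section Compactness

variable {N : ℕ}

/-- Interpolation: `|f|^p ≤ K^(p-1) |f|` for functions bounded by `K`. -/
lemma exists_eLpNorm_le_of_lintegral_le {α : Type*} [MeasurableSpace α] {μ : Measure α} {r : ℝ≥0∞}
    (hr1 : 1 ≤ r) (hr : r ≠ ∞) {K ε : ℝ} (hK : 0 ≤ K) (hε : 0 < ε) :
    ∃ e : ℝ, 0 < e ∧ ∀ f : α → ℝ, (∀ x, |f x| ≤ K) → ∫⁻ x, ‖f x‖ₑ ∂μ ≤ ENNReal.ofReal e →
      eLpNorm f r μ ≤ ENNReal.ofReal ε := by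
  set p := r.toReal with hp
  have hp1 : 1 ≤ p := by
    rw [hp, ← ENNReal.toReal_one]
    exact ENNReal.toReal_mono hr hr1
  have hp0 : 0 < p := by linarith
  -- The added `1` covers `K = 0`.
  refine ⟨ε ^ p / (K ^ (p - 1) + 1), by positivity, fun f hf hint => ?_⟩
  rw [eLpNorm_eq_lintegral_rpow_enorm_toReal (by positivity) hr]
  have h1 : ∫⁻ x, ‖f x‖ₑ ^ p ∂μ ≤ ENNReal.ofReal (ε ^ p) := by
    calc ∫⁻ x, ‖f x‖ₑ ^ p ∂μ ≤ ∫⁻ x, ENNReal.ofReal (K ^ (p - 1)) * ‖f x‖ₑ ∂μ := by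
          refine lintegral_mono fun x => ?_
          have e1 : ‖f x‖ₑ ^ p = ‖f x‖ₑ ^ (p - 1) * ‖f x‖ₑ := by
            rw [← ENNReal.rpow_one ‖f x‖ₑ, ← ENNReal.rpow_mul, ← ENNReal.rpow_mul,
              ← ENNReal.rpow_add_of_nonneg _ _ (by linarith) (by norm_num)]
            congr 1; ring
          simp only [e1]
          gcongr
          rw [← ENNReal.ofReal_rpow_of_nonneg hK (by linarith), Real.enorm_eq_ofReal_abs]
          gcongr
          exact hf x
      _ ≤ ENNReal.ofReal (K ^ (p - 1)) * ENNReal.ofReal (ε ^ p / (K ^ (p - 1) + 1)) := by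
          rw [lintegral_const_mul' _ _ ENNReal.ofReal_ne_top]
          gcongr
      _ ≤ _ := by
          rw [← ENNReal.ofReal_mul (by positivity)]
          refine ENNReal.ofReal_le_ofReal ?_
          rw [← mul_div_assoc, div_le_iff₀ (by positivity)]
          nlinarith [Real.rpow_nonneg hε.le p, Real.rpow_nonneg hK (p - 1)]
  calc _ ≤ ENNReal.ofReal (ε ^ p) ^ (1 / p) := by gcongr
    _ = _ := by
        rw [← ENNReal.ofReal_rpow_of_nonneg hε.le hp0.le, ← ENNReal.rpow_mul, mul_one_div,
          div_self hp0.ne', ENNReal.rpow_one]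

/-- A Kolmogorov-type criterion: uniformly bounded families with uniformly small `L¹` tails and
translation differences are totally bounded in `L^r`. -/
lemma totallyBounded_Lp_of_translation {r : ℝ≥0∞} [Fact (1 ≤ r)] (hr : r ≠ ∞)
    {𝓕 : Set (EuclideanSpace ℝ (Fin N) → ℝ)} {M : ℝ} (hM0 : 0 ≤ M)
    (hmeas : ∀ f ∈ 𝓕, Measurable f) (hM : ∀ f ∈ 𝓕, ∀ x, |f x| ≤ M)
    (htrans : ∀ ε : ℝ, 0 < ε → ∃ δ > 0, ∀ f ∈ 𝓕, ∀ w, ‖w‖ ≤ δ →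
      ∫⁻ x, ‖f (x + w) - f x‖ₑ ≤ ENNReal.ofReal ε)
    (htail : ∀ ε : ℝ, 0 < ε → ∃ R : ℝ, ∀ f ∈ 𝓕, ∫⁻ x in {x | R ≤ ‖x‖}, ‖f x‖ₑ ≤ ENNReal.ofReal ε) :
    TotallyBounded {g : Lp ℝ r (volume : Measure (EuclideanSpace ℝ (Fin N))) |
      ∃ f ∈ 𝓕, g =ᵐ[volume] f} := by
  refine Metric.totallyBounded_iff.2 fun ε hε => ?_
  obtain ⟨e, he, hLr⟩ := exists_eLpNorm_le_of_lintegral_le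
    (μ := (volume : Measure (EuclideanSpace ℝ (Fin N)))) (Fact.out : 1 ≤ r) hr
    (K := 2 * M) (by positivity) (half_pos hε)
  -- Sampling costs `2 ^ N` times the translation error and the tail costs one more such term,
  -- together `e`.
  obtain ⟨δ₀, hδ₀, htr⟩ := htrans (e / (2 ^ N + 1)) (by positivity)
  obtain ⟨R, hR⟩ := htail (e / (2 ^ N + 1)) (by positivity)
  -- Vectors in the cell of side `2 * δ` have norm at most `N * δ ≤ δ₀`.
  set δ : ℝ := δ₀ / (N + 1) with hδdef
  have hδ : 0 < δ := by positivity
  let m : ℕ := ⌈R / δ⌉₊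
  let s : Finset (Idx N) := Fintype.piFinset fun _ => Finset.Icc (-(m : ℤ)) m
  have hs : ∀ x : EuclideanSpace ℝ (Fin N), cellIdx δ x ∉ s → R ≤ ‖x‖ := by
    intro x hx
    rw [Fintype.mem_piFinset, not_forall] at hx
    obtain ⟨i, hi⟩ := hx
    have h1 : (m : ℤ) + 1 ≤ |cellIdx δ x i| := by
      rw [Finset.mem_Icc, ← abs_le] at hi
      omega
    have h1' : (m : ℝ) + 1 ≤ |(cellIdx δ x i : ℝ)| := by exact_mod_cast h1
    have h2 := self_mem_cell hδ x i
    rw [gridPoint, mem_Ioc] at h2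
    have h3 := PiLp.norm_apply_le x i
    rw [Real.norm_eq_abs] at h3
    have h4 : R ≤ m * δ := by
      rw [← div_le_iff₀ hδ]; exact Nat.le_ceil _
    have h5 : δ * |(cellIdx δ x i : ℝ)| ≤ |x i| + δ / 2 := by
      rw [← abs_of_pos hδ, ← abs_mul, abs_of_pos hδ]
      have : |δ * (cellIdx δ x i : ℝ) - x i| ≤ δ / 2 := by
        rw [abs_sub_comm, abs_le]; exact ⟨h2.1.le, h2.2⟩
      have := abs_add_le (x i) (δ * (cellIdx δ x i : ℝ) - x i)
      rw [add_sub_cancel] at this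
      linarith
    nlinarith
  have hcell : ∀ β : Idx N, volume (cell δ β) ≠ ∞ := fun β => by
    rw [volume_cell hδ]; exact ENNReal.ofReal_ne_top
  let b : Idx N → Lp ℝ r (volume : Measure (EuclideanSpace ℝ (Fin N))) := fun β =>
    indicatorConstLp r (measurableSet_cell hδ β) (hcell β) (1 : ℝ)
  -- Step functions on finitely many cells with values bounded by `M` are the image of a compact
  -- ball under this continuous map, hence have finite nets.
  let Λ : (s → ℝ) → Lp ℝ r (volume : Measure (EuclideanSpace ℝ (Fin N))) := fun c =>
    ∑ β : s, c β • b β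
  have hΛ : Continuous Λ := by
    refine continuous_finsetSum _ fun β _ => ?_
    exact (continuous_apply β).smul continuous_const
  have hΛae : ∀ c, Λ c =ᵐ[volume] fun x => if hx : cellIdx δ x ∈ s then c ⟨_, hx⟩ else 0 := by
    intro c
    have h1 : ∀ β : s, (c β • b β : Lp ℝ r volume) =ᵐ[volume]
        fun x => c β * (cell δ (β : Idx N)).indicator (fun _ => (1 : ℝ)) x := fun β => by
      filter_upwards [Lp.coeFn_smul (c β) (b β), indicatorConstLp_coeFn (p := r)
        (hs := measurableSet_cell hδ (β : Idx N)) (hμs := hcell β) (c := (1 : ℝ))] with x hx1 hx2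
      rw [hx1, Pi.smul_apply, hx2, smul_eq_mul]
    have h2 : (Λ c : EuclideanSpace ℝ (Fin N) → ℝ) =ᵐ[volume]
        fun x => ∑ β : s, (c β • b β : Lp ℝ r volume) x := Lp.coeFn_fun_finsetSum _ _
    filter_upwards [h2, ae_all_iff.2 h1] with x hx1 hx2
    rw [hx1, Finset.sum_congr rfl fun β _ => hx2 β]
    split_ifs with hx
    · rw [Finset.sum_eq_single ⟨_, hx⟩]
      · rw [indicator_of_mem (self_mem_cell hδ x), mul_one]
      · intro β _ hβ
        rw [indicator_of_notMem, mul_zero]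
        exact fun hxβ => hβ (Subtype.ext ((mem_cell_iff hδ).1 hxβ).symm)
      · simp
    · refine Finset.sum_eq_zero fun β _ => ?_
      rw [indicator_of_notMem, mul_zero]
      exact fun hxβ => hx ((mem_cell_iff hδ).1 hxβ ▸ β.2)
  have hK : IsCompact (Λ '' Metric.closedBall 0 M) := (isCompact_closedBall _ _).image hΛ
  obtain ⟨t, ht, htc⟩ := Metric.totallyBounded_iff.1 hK.totallyBounded (ε / 2) (half_pos hε)
  refine ⟨t, ht, ?_⟩
  rintro g ⟨f, hf, hgf⟩
  have hfm := hmeas f hf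
  obtain ⟨θ, hθ⟩ := exists_sample_le hδ hfm (S := ENNReal.ofReal (e / (2 ^ N + 1))) fun w hw => by
    refine htr f hf w ((norm_le_of_forall_abs_le (c := δ) fun i => ?_).trans ?_)
    · have := hw i
      rw [gridPoint_zero, PiLp.zero_apply, sub_zero, mul_div_cancel_left₀ _ two_ne_zero] at this
      exact abs_le.2 ⟨this.1.le, this.2⟩
    · rw [hδdef, ← mul_div_assoc, div_le_iff₀ (by positivity)]
      nlinarith
  let c : s → ℝ := fun β => f (gridPoint δ (β : Idx N) + θ)
  let k : EuclideanSpace ℝ (Fin N) → ℝ := fun x =>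
    if hx : cellIdx δ x ∈ s then c ⟨_, hx⟩ else 0
  have hc : c ∈ Metric.closedBall (0 : s → ℝ) M := by
    rw [mem_closedBall_zero_iff, pi_norm_le_iff_of_nonneg hM0]
    exact fun β => hM f hf _
  have hk0 : ∀ x, |k x| ≤ M := fun x => by
    simp only [k]; split_ifs
    · exact hM f hf _
    · simpa using hM0
  have hfk : ∀ x, |(f - k) x| ≤ 2 * M := fun x =>
    (abs_sub _ _).trans (by linarith [hM f hf x, hk0 x])
  have hint : ∫⁻ x, ‖(f - k) x‖ₑ ≤ ENNReal.ofReal e := by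
    have hm1 : Measurable fun x => ‖f x - f (gridPoint δ (cellIdx δ x) + θ)‖ₑ :=
      (hfm.sub ((measurable_of_countable fun β : Idx N => f (gridPoint δ β + θ)).comp
        (measurable_cellIdx δ))).enorm
    have hRm : MeasurableSet {x : EuclideanSpace ℝ (Fin N) | R ≤ ‖x‖} :=
      measurableSet_le measurable_const measurable_norm
    calc _ ≤ ∫⁻ x, (‖f x - f (gridPoint δ (cellIdx δ x) + θ)‖ₑ
          + {x | R ≤ ‖x‖}.indicator (fun x => ‖f x‖ₑ) x) := by
          refine lintegral_mono fun x => ?_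
          by_cases hx : cellIdx δ x ∈ s
          · have : (f - k) x = f x - f (gridPoint δ (cellIdx δ x) + θ) := by
              simp only [Pi.sub_apply, k, dif_pos hx, c]
            rw [this]; exact le_self_add
          · have : (f - k) x = f x := by
              simp only [Pi.sub_apply, k, dif_neg hx, sub_zero]
            rw [this, indicator_of_mem (s := {x : EuclideanSpace ℝ (Fin N) | R ≤ ‖x‖}) (hs x hx)]
            exact le_add_self
      _ ≤ 2 ^ N * ENNReal.ofReal (e / (2 ^ N + 1)) + ENNReal.ofReal (e / (2 ^ N + 1)) := by
          rw [lintegral_add_left hm1, lintegral_indicator hRm]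
          exact add_le_add hθ (hR f hf)
      _ = _ := by
          have : (2 : ℝ≥0∞) ^ N = ENNReal.ofReal (2 ^ N) := by
            rw [ENNReal.ofReal_pow zero_le_two, ENNReal.ofReal_ofNat]
          rw [this, ← ENNReal.ofReal_mul (by positivity),
            ← ENNReal.ofReal_add (by positivity) (by positivity)]
          congr 1
          field_simp
  have hdist : dist g (Λ c) ≤ ε / 2 := by
    rw [Lp.dist_def]
    refine ENNReal.toReal_le_of_le_ofReal (half_pos hε).le ?_
    rw [eLpNorm_congr_ae (hgf.sub (hΛae c))]
    exact hLr _ hfk hint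
  obtain ⟨y, hy, hyc⟩ := mem_iUnion₂.1 (htc (mem_image_of_mem Λ hc))
  refine mem_iUnion₂.2 ⟨y, hy, ?_⟩
  rw [Metric.mem_ball] at hyc ⊢
  linarith [dist_triangle g (Λ c) y]

/-- Arzelà–Ascoli for sequences of continuous functions with totally bounded values. -/
lemma exists_subseq_tendsto_of_equicontinuous {X Y : Type*} [TopologicalSpace X] [CompactSpace X]
    [MetricSpace Y] [CompleteSpace Y] (v : ℕ → C(X, Y))
    (htb : TotallyBounded {y | ∃ n x, v n x = y})
    (heq : Equicontinuous fun n x => v n x) :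
    ∃ κ : ℕ → ℕ, StrictMono κ ∧ ∃ u : C(X, Y), Tendsto (fun n => v (κ n)) atTop (𝓝 u) := by
  let w : ℕ → BoundedContinuousFunction X Y := fun n => BoundedContinuousFunction.mkOfCompact (v n)
  have hc := BoundedContinuousFunction.arzela_ascoli (closure {y | ∃ n x, v n x = y})
    (isCompact_iff_totallyBounded_isComplete.2
      ⟨TotallyBounded.closure htb, isClosed_closure.isComplete⟩) (range w)
    (by rintro _ x ⟨n, rfl⟩; exact subset_closure ⟨n, x, rfl⟩)
    (by
      intro x U hU
      filter_upwards [heq x U hU] with y hy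
      rintro ⟨_, n, rfl⟩
      exact hy n)
  obtain ⟨u, -, κ, hκ, hu⟩ := hc.tendsto_subseq fun n => subset_closure (mem_range_self n)
  refine ⟨κ, hκ, u.toContinuousMap, ?_⟩
  have := ((ContinuousMap.isometryEquivBoundedOfCompact X Y).symm.continuous.tendsto u).comp hu
  exact this

end Compactness

/-! ### Discretization of the initial datum and the source. -/

section Data

/-- Allows `tendsto_lintegral_translate_sub` to be applied to the source on space-time. -/
instance (N : ℕ) :
    (volume : Measure (EuclideanSpace ℝ (Fin N) × ℝ)).IsAddRightInvariant := by
  have : ((volume : Measure (EuclideanSpace ℝ (Fin N))).prod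
      (volume : Measure ℝ)).IsAddLeftInvariant := inferInstance
  rw [Measure.volume_eq_prod]
  infer_instance

variable {N : ℕ} {h : ℝ}

/-- Continuity of translations in `L¹`, obtained from continuity of composition with
measure-preserving maps: `G` is the family of translations, continuous in the shift. -/
lemma tendsto_lintegral_translate_sub {Y : Type*} [NormedAddCommGroup Y] [MeasurableSpace Y]
    [BorelSpace Y] {μ : Measure Y} [μ.IsAddRightInvariant] [IsLocallyFiniteMeasure μ]
    [μ.InnerRegularCompactLTTop] [LocallyCompactSpace Y] {v : Y → ℝ} (hv : MemLp v 1 μ) :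
    Tendsto (fun w => ∫⁻ y, ‖v (y + w) - v y‖ₑ ∂μ) (𝓝 0) (𝓝 0) := by
  let G : C(Y, C(Y, Y)) := (ContinuousMap.mk (fun p : Y × Y => p.2 + p.1) (by fun_prop)).curry
  have hG : ∀ w, MeasurePreserving (G w) μ μ := fun w => measurePreserving_add_right μ w
  have h1 := (tendsto_const_nhds (x := hv.toLp v)).compMeasurePreservingLp
    (G.continuous.tendsto 0) hG (hG 0) ENNReal.one_ne_top
  have h2 := (tendsto_iff_edist_tendsto_0.1 h1)
  refine h2.congr fun w => ?_
  have e0 : (Lp.compMeasurePreserving (G w) (hG w) (hv.toLp v) : Y → ℝ) =ᵐ[μ] fun y => v (y + w) :=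
    (Lp.coeFn_compMeasurePreserving _ (hG w)).trans
      ((hG w).quasiMeasurePreserving.ae_eq_comp hv.coeFn_toLp)
  have e1 : (Lp.compMeasurePreserving (G 0) (hG 0) (hv.toLp v) : Y → ℝ) =ᵐ[μ] v := by
    refine ((Lp.coeFn_compMeasurePreserving _ (hG 0)).trans
      ((hG 0).quasiMeasurePreserving.ae_eq_comp hv.coeFn_toLp)).trans (ae_of_all _ fun y => ?_)
    simp [G]
  rw [Lp.edist_def, eLpNorm_congr_ae (e0.sub e1), eLpNorm_one_eq_lintegral_enorm]
  rfl

/-- Dominated convergence. The term `N / R` pays for evaluating the cutoff at the grid point instead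
of at `x`. -/
lemma tendsto_lintegral_cutoff_mul {α : Type*} [MeasurableSpace α] {μ : Measure α}
    {p : α → EuclideanSpace ℝ (Fin N)} (hp : Measurable p) {v : α → ℝ}
    (hv : AEStronglyMeasurable v μ) (hfin : ∫⁻ y, ‖v y‖ₑ ∂μ ≠ ∞) :
    Tendsto (fun R : ℝ => ∫⁻ y, ENNReal.ofReal (cutoff R (p y) + N / R) * ‖v y‖ₑ ∂μ) atTop
      (𝓝 0) := by
  have hcont : ∀ x : EuclideanSpace ℝ (Fin N),
      Tendsto (fun R : ℝ => cutoff R x + N / R) atTop (𝓝 0) := fun x => by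
    have h1 : Tendsto (fun R : ℝ => ‖R⁻¹ • x‖ ^ 2) atTop (𝓝 0) := by
      have := ((tendsto_inv_atTop_zero (𝕜 := ℝ)).smul_const x).norm.pow 2
      simpa using this
    have h2 : Tendsto (fun R : ℝ => cutoff R x) atTop (𝓝 0) := by
      have := (tendsto_const_nhds (x := (1 : ℝ))).sub
        (((tendsto_const_nhds (x := (1 : ℝ))).add h1).inv₀ (by norm_num))
      simpa [cutoff] using this
    simpa using h2.add (tendsto_const_nhds.div_atTop tendsto_id)
  have hmeas : ∀ R : ℝ, Measurable fun y => cutoff R (p y) + N / R := fun R => by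
    unfold cutoff
    fun_prop
  have := tendsto_lintegral_filter_of_dominated_convergence' (μ := μ) (l := atTop)
    (F := fun (R : ℝ) y => ENNReal.ofReal (cutoff R (p y) + N / R) * ‖v y‖ₑ) (f := fun _ => 0)
    (fun y => ENNReal.ofReal (1 + N) * ‖v y‖ₑ)
    (Eventually.of_forall fun R => (hmeas R).ennreal_ofReal.aemeasurable.mul hv.enorm)
    (by
      filter_upwards [eventually_ge_atTop 1] with R hR
      refine ae_of_all _ fun y => ?_
      gcongr
      · exact cutoff_le_one _ _
      · exact div_le_self (Nat.cast_nonneg N) hR)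
    (by
      rw [lintegral_const_mul' _ _ ENNReal.ofReal_ne_top]
      exact ENNReal.mul_ne_top ENNReal.ofReal_ne_top hfin)
    (ae_of_all _ fun y => by
      have h1 := ENNReal.tendsto_ofReal (hcont (p y))
      rw [ENNReal.ofReal_zero] at h1
      have := ENNReal.Tendsto.mul_const (b := ‖v y‖ₑ) h1 (Or.inr enorm_ne_top)
      simpa using this)
  simpa using this

lemma cutoff_gridPoint_le {R : ℝ} (hR : 0 < R) (hh : h ∈ Ioo (0 : ℝ) 1)
    (x : EuclideanSpace ℝ (Fin N)) :
    cutoff R (gridPoint h (cellIdx h x)) ≤ cutoff R x + N / R := by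
  have h1 := (le_abs_self _).trans (abs_cutoff_sub_le hR (gridPoint h (cellIdx h x)) x)
  have h2 := norm_sub_gridPoint_le hh.1 x
  rw [norm_sub_rev] at h2
  have h3 : ‖gridPoint h (cellIdx h x) - x‖ / R ≤ N / R := by
    gcongr
    refine h2.trans ?_
    have : (0 : ℝ) ≤ N := Nat.cast_nonneg N
    nlinarith [hh.1, hh.2]
  linarith

lemma cutoff_le_cutoff_gridPoint {R : ℝ} (hR : 0 < R) (hh : h ∈ Ioo (0 : ℝ) 1)
    (x : EuclideanSpace ℝ (Fin N)) :
    cutoff R x ≤ cutoff R (gridPoint h (cellIdx h x)) + N / R := by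
  have h1 := (le_abs_self _).trans (abs_cutoff_sub_le hR x (gridPoint h (cellIdx h x)))
  have h2 := norm_sub_gridPoint_le hh.1 x
  have h3 : ‖x - gridPoint h (cellIdx h x)‖ / R ≤ N / R := by
    gcongr
    refine h2.trans ?_
    have : (0 : ℝ) ≤ N := Nat.cast_nonneg N
    nlinarith [hh.1, hh.2]
  linarith

lemma setIntegral_cell_add (hh : 0 < h) (v : EuclideanSpace ℝ (Fin N) → ℝ) (β η : Idx N) :
    ∫ x in cell h (β + η), v x = ∫ x in cell h β, v (x + gridPoint h η) := by
  rw [← integral_indicator (measurableSet_cell hh _), ← integral_indicator (measurableSet_cell hh _),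
    ← integral_add_right_eq_self _ (gridPoint h η)]
  congr 1
  ext x
  have : x + gridPoint h η ∈ cell h (β + η) ↔ x ∈ cell h β := by
    refine forall_congr' fun i => ?_
    rw [gridPoint_add, PiLp.add_apply, PiLp.add_apply, add_sub_add_right_eq_sub]
  by_cases hx : x ∈ cell h β
  · rw [indicator_of_mem (this.2 hx), indicator_of_mem hx]
  · rw [indicator_of_notMem (fun h' => hx (this.1 h')), indicator_of_notMem hx]

lemma tsum_mul_enorm_setIntegral_cell_le (hh : 0 < h) (X : Idx N → ℝ≥0∞)
    (v : EuclideanSpace ℝ (Fin N) → ℝ) :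
    ∑' β, X β * ‖∫ x in cell h β, v x‖ₑ ≤ ∫⁻ x, X (cellIdx h x) * ‖v x‖ₑ := by
  have hX : Measurable fun x : EuclideanSpace ℝ (Fin N) => X (cellIdx h x) :=
    (measurable_of_countable X).comp (measurable_cellIdx h)
  rw [lintegral_eq_tsum_cell hh]
  refine ENNReal.tsum_le_tsum fun β => ?_
  rw [setLIntegral_cell_congr hh (fun β x => X β * ‖v x‖ₑ)]
  refine (mul_le_mul_right (enorm_integral_le_lintegral_enorm _) _).trans ?_
  exact lintegral_const_mul_le _ _

lemma measurable_lintegral_enorm_slice {k : EuclideanSpace ℝ (Fin N) × ℝ → ℝ} (hk : Measurable k)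
    (S : Set (EuclideanSpace ℝ (Fin N))) : Measurable fun s => ∫⁻ x in S, ‖k (x, s)‖ₑ :=
  hk.enorm.lintegral_prod_left'

lemma tsum_mul_enorm_iterated_integral_le (hh : 0 < h) (X : Idx N → ℝ≥0∞)
    {k : EuclideanSpace ℝ (Fin N) × ℝ → ℝ} (hk : Measurable k) {a b : ℝ} (hab : a ≤ b) :
    ∑' β, X β * ‖∫ s in a..b, ∫ x in cell h β, k (x, s)‖ₑ
      ≤ ∫⁻ s in Ioc a b, ∫⁻ x, X (cellIdx h x) * ‖k (x, s)‖ₑ := by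
  have hm : ∀ β : Idx N, Measurable fun s => ∫⁻ x in cell h β, ‖k (x, s)‖ₑ := fun β =>
    measurable_lintegral_enorm_slice hk _
  calc _ ≤ ∑' β, ∫⁻ s in Ioc a b, X β * ∫⁻ x in cell h β, ‖k (x, s)‖ₑ := by
        refine ENNReal.tsum_le_tsum fun β => ?_
        rw [intervalIntegral.integral_of_le hab, lintegral_const_mul _ (hm β)]
        gcongr
        refine (enorm_integral_le_lintegral_enorm _).trans ?_
        exact lintegral_mono fun s => enorm_integral_le_lintegral_enorm _
    _ = ∫⁻ s in Ioc a b, ∑' β, X β * ∫⁻ x in cell h β, ‖k (x, s)‖ₑ :=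
        (lintegral_tsum fun β => ((hm β).const_mul _).aemeasurable).symm
    _ = _ := by
        refine lintegral_congr fun s => ?_
        rw [lintegral_eq_tsum_cell hh]
        refine tsum_congr fun β => ?_
        rw [setLIntegral_cell_congr hh (fun β x => X β * ‖k (x, s)‖ₑ),
          lintegral_const_mul (X β) (f := fun x => ‖k (x, s)‖ₑ)
            (hk.enorm.comp measurable_prodMk_right)]

/-- The time-integrated discrete source. -/
def discImpulse {T : ℝ} (h : ℝ) (τ : TimeGrid T) (k : EuclideanSpace ℝ (Fin N) × ℝ → ℝ) (j : ℕ)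
    (β : Idx N) : ℝ := (h ^ N)⁻¹ * ∫ s in τ.t j..τ.t (j + 1), ∫ x in cell h β, k (x, s)

lemma step_mul_discSource {T : ℝ} {τ : TimeGrid T} {g : EuclideanSpace ℝ (Fin N) → ℝ → ℝ} {j : ℕ}
    (hj : j < τ.J) (β : Idx N) :
    τ.step j * discSource h τ g j β = discImpulse h τ (fun p => g p.1 p.2) j β := by
  have := (τ.step_pos hj).ne'
  rw [discSource, discImpulse, mul_inv, ← mul_assoc]
  congr 1
  field_simp

variable {T : ℝ} {τ : TimeGrid T} {k : EuclideanSpace ℝ (Fin N) × ℝ → ℝ}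

lemma ofReal_mul_enorm_inv_mul (hh : 0 < h) (y : ℝ) :
    ENNReal.ofReal (h ^ N) * ‖(h ^ N)⁻¹ * y‖ₑ = ‖y‖ₑ := by
  have hN := pow_pos hh N
  rw [enorm_mul, ← mul_assoc, Real.enorm_of_nonneg (inv_nonneg.2 hN.le),
    ← ENNReal.ofReal_mul hN.le, mul_inv_cancel₀ hN.ne', ENNReal.ofReal_one, one_mul]

lemma tsum_weighted_discImpulse_le (hh : 0 < h) (X : Idx N → ℝ≥0∞) (hk : Measurable k) {j : ℕ}
    (hj : j < τ.J) :
    ENNReal.ofReal (h ^ N) * ∑' β, X β * ‖discImpulse h τ k j β‖ₑ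
      ≤ ∫⁻ s in Ioc (τ.t j) (τ.t (j + 1)), ∫⁻ x, X (cellIdx h x) * ‖k (x, s)‖ₑ := by
  rw [← ENNReal.tsum_mul_left]
  refine le_trans (le_of_eq (tsum_congr fun β => ?_))
    (tsum_mul_enorm_iterated_integral_le hh X hk (τ.t_lt j hj).le)
  rw [mul_left_comm, discImpulse, ofReal_mul_enorm_inv_mul hh]

lemma gridL1_discImpulse_le (hh : 0 < h) (hk : Measurable k) {j : ℕ} (hj : j < τ.J) :
    ENNReal.ofReal (h ^ N) * gridL1 (discImpulse h τ k j)
      ≤ ∫⁻ s in Ioc (τ.t j) (τ.t (j + 1)), ∫⁻ x, ‖k (x, s)‖ₑ := by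
  simpa [gridL1] using tsum_weighted_discImpulse_le hh (fun _ => 1) hk hj

lemma enorm_discImpulse_le (hh : 0 < h) {j : ℕ} (hj : j < τ.J) (β : Idx N) :
    ‖discImpulse h τ k j β‖ₑ
      ≤ ∫⁻ s in Ioc (τ.t j) (τ.t (j + 1)), eLpNorm (fun x => k (x, s)) ∞ volume := by
  have hN := pow_pos hh N
  have h1 : ‖∫ s in τ.t j..τ.t (j + 1), ∫ x in cell h β, k (x, s)‖ₑ
      ≤ ENNReal.ofReal (h ^ N) *
        ∫⁻ s in Ioc (τ.t j) (τ.t (j + 1)), eLpNorm (fun x => k (x, s)) ∞ volume := by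
    rw [intervalIntegral.integral_of_le (τ.t_lt j hj).le,
      ← lintegral_const_mul' _ _ ENNReal.ofReal_ne_top]
    refine (enorm_integral_le_lintegral_enorm _).trans (lintegral_mono fun s => ?_)
    refine (enorm_integral_le_lintegral_enorm _).trans ?_
    calc ∫⁻ x in cell h β, ‖k (x, s)‖ₑ
        ≤ ∫⁻ _x in cell h β, eLpNorm (fun x => k (x, s)) ∞ volume := by
          refine lintegral_mono_ae (ae_restrict_of_ae ?_)
          rw [eLpNorm_exponent_top]
          exact ae_le_eLpNormEssSup
      _ = _ := by rw [setLIntegral_const, volume_cell hh, mul_comm]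
  rw [discImpulse, enorm_mul, Real.enorm_of_nonneg (inv_nonneg.2 hN.le)]
  refine (mul_le_mul_right h1 _).trans (le_of_eq ?_)
  rw [← mul_assoc, ← ENNReal.ofReal_mul (inv_nonneg.2 hN.le), inv_mul_cancel₀ hN.ne',
    ENNReal.ofReal_one, one_mul]

/-- A lattice shift is an exact translation of the cells by a grid vector, so it can be moved onto
`k`; integrability justifies subtracting under the integrals. -/
lemma shiftDist_discImpulse_le (hh : 0 < h) (hk : Measurable k) (hki : Integrable k)
    {j : ℕ} (hj : j < τ.J) (η : Idx N) :
    ENNReal.ofReal (h ^ N) * shiftDist (discImpulse h τ k j) η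
      ≤ ∫⁻ s in Ioc (τ.t j) (τ.t (j + 1)), ∫⁻ x, ‖k (x + gridPoint h η, s) - k (x, s)‖ₑ := by
  let kη : EuclideanSpace ℝ (Fin N) × ℝ → ℝ := fun p => k (p.1 + gridPoint h η, p.2)
  have hkη : Measurable kη := hk.comp ((measurable_fst.add_const _).prodMk measurable_snd)
  have hkηi : Integrable kη := by
    have := hki.comp_add_right (gridPoint h η, (0 : ℝ))
    exact this.congr (ae_of_all _ fun ⟨x, s⟩ => by simp [kη])
  have hint : ∀ (q : EuclideanSpace ℝ (Fin N) × ℝ → ℝ), Integrable q → ∀ β : Idx N,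
      IntervalIntegrable (fun s => ∫ x in cell h β, q (x, s)) volume (τ.t j) (τ.t (j + 1)) := by
    intro q hq β
    refine Integrable.intervalIntegrable ?_
    have hq' : Integrable q ((volume.restrict (cell h β)).prod volume) := by
      rw [Measure.restrict_prod_eq_prod_univ]
      exact hq.restrict
    exact hq'.integral_prod_right
  have hslice : ∀ (q : EuclideanSpace ℝ (Fin N) × ℝ → ℝ), Integrable q →
      ∀ᵐ s : ℝ, Integrable fun x => q (x, s) := fun q hq => hq.prod_left_ae
  have e : ∀ β, discImpulse h τ k j (β + η) - discImpulse h τ k j β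
      = discImpulse h τ (fun p => kη p - k p) j β := by
    intro β
    simp only [discImpulse]
    rw [← mul_sub]
    congr 1
    simp only [setIntegral_cell_add hh _ β η]
    rw [← intervalIntegral.integral_sub (hint kη hkηi β) (hint k hki β)]
    refine intervalIntegral.integral_congr_ae ?_
    filter_upwards [hslice kη hkηi, hslice k hki] with s hs1 hs2 _
    exact (integral_sub hs1.restrict hs2.restrict).symm
  rw [shiftDist]
  simp only [e]
  exact gridL1_discImpulse_le hh (hkη.sub hk) hj

lemma sum_lintegral_Ioc (m : ℝ → ℝ≥0∞) {i j : ℕ} (hij : i ≤ j) (hj : j ≤ τ.J) :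
    ∑ l ∈ Finset.Ico i j, ∫⁻ s in Ioc (τ.t l) (τ.t (l + 1)), m s
      = ∫⁻ s in Ioc (τ.t i) (τ.t j), m s := by
  induction j, hij using Nat.le_induction with
  | base => simp
  | succ j hij ih =>
    rw [Finset.sum_Ico_succ_top hij, ih (by omega),
      ← lintegral_union measurableSet_Ioc (Ioc_disjoint_Ioc_of_le le_rfl),
      Ioc_union_Ioc_eq_Ioc (τ.t_le hij (by omega)) (τ.t_lt j hj).le]

/-- Replaces `g`, controlled only almost everywhere on `(0,T)`, by a jointly measurable function
vanishing outside that interval with the same discrete sources, so that Tonelli and translations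
apply. -/
lemma exists_integrable_source {g : EuclideanSpace ℝ (Fin N) → ℝ → ℝ}
    (hg_meas : AEStronglyMeasurable (fun p : EuclideanSpace ℝ (Fin N) × ℝ => g p.1 p.2)
      ((volume : Measure (EuclideanSpace ℝ (Fin N))).prod (volume.restrict (Ioo 0 T))))
    (hg : ∫⁻ t in Ioo 0 T, (eLpNorm (fun x => g x t) 1 volume
      + eLpNorm (fun x => g x t) ∞ volume) < ∞) :
    ∃ k : EuclideanSpace ℝ (Fin N) × ℝ → ℝ, Measurable k ∧ Integrable k ∧
      ∫⁻ s, eLpNorm (fun x => k (x, s)) ∞ volume < ∞ ∧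
      ∀ (h : ℝ) (τ : TimeGrid T), ∀ j < τ.J, ∀ β,
        τ.step j * discSource h τ g j β = discImpulse h τ k j β := by
  let g' := hg_meas.mk
  have hg' : Measurable g' := hg_meas.stronglyMeasurable_mk.measurable
  let k : EuclideanSpace ℝ (Fin N) × ℝ → ℝ := (Prod.snd ⁻¹' Ioo 0 T).indicator g'
  have hS : MeasurableSet (Prod.snd ⁻¹' Ioo 0 T : Set (EuclideanSpace ℝ (Fin N) × ℝ)) :=
    measurable_snd measurableSet_Ioo
  have hk : Measurable k := hg'.indicator hS
  have hae : ∀ᵐ s ∂(volume.restrict (Ioo 0 T)),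
      (fun x => g x s) =ᵐ[volume] fun x => k (x, s) := by
    have h1 : ∀ᵐ p ∂((volume : Measure (EuclideanSpace ℝ (Fin N))).prod
        (volume.restrict (Ioo 0 T))), g p.1 p.2 = g' p := hg_meas.ae_eq_mk
    have h2 := Measure.ae_ae_of_ae_prod (Measure.measurePreserving_swap.quasiMeasurePreserving.ae h1)
    filter_upwards [h2, ae_restrict_mem measurableSet_Ioo] with s hs hsT
    filter_upwards [hs] with x hx
    have hx' : g x s = g' (x, s) := hx
    rw [hx']
    exact (indicator_of_mem (s := Prod.snd ⁻¹' Ioo 0 T) (a := (x, s)) hsT _).symm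
  have hslice : ∀ s ∉ Ioo 0 T, (fun x => k (x, s)) = 0 := fun s hs => by
    ext x
    exact indicator_of_notMem (s := Prod.snd ⁻¹' Ioo 0 T) (a := (x, s)) hs _
  have hnorm : ∀ p : ℝ≥0∞, ∫⁻ s, eLpNorm (fun x => k (x, s)) p volume
      = ∫⁻ s in Ioo 0 T, eLpNorm (fun x => g x s) p volume := fun p => by
    rw [← lintegral_indicator measurableSet_Ioo]
    have h1 := (ae_restrict_iff' measurableSet_Ioo).1 hae
    refine lintegral_congr_ae ?_
    filter_upwards [h1] with s hs
    by_cases hsT : s ∈ Ioo 0 T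
    · rw [indicator_of_mem hsT, eLpNorm_congr_ae (hs hsT)]
    · rw [indicator_of_notMem hsT, hslice s hsT, eLpNorm_zero]
  refine ⟨k, hk, ⟨hk.aestronglyMeasurable, ?_⟩, ?_, ?_⟩
  · rw [hasFiniteIntegral_iff_enorm, Measure.volume_eq_prod,
      lintegral_prod_symm _ hk.enorm.aemeasurable]
    simp only [← eLpNorm_one_eq_lintegral_enorm]
    rw [hnorm 1]
    exact (lintegral_mono fun t => le_self_add).trans_lt hg
  · rw [hnorm ∞]
    exact (lintegral_mono fun t => le_add_self).trans_lt hg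
  · intro h τ j hj β
    rw [step_mul_discSource hj, discImpulse, discImpulse]
    congr 1
    refine intervalIntegral.integral_congr_ae ?_
    have h1 := (ae_restrict_iff' measurableSet_Ioo).1 hae
    -- The last time interval contains the endpoint `T`, which `Ioo 0 T` omits.
    have hT : ∀ᵐ s : ℝ, s ≠ T := by simp [ae_iff]
    filter_upwards [h1, hT] with s hs hsT hsj
    rw [uIoc_of_le (τ.t_lt j hj).le] at hsj
    have hmem : s ∈ Ioo 0 T :=
      ⟨(τ.t_mem hj.le).1.trans_lt hsj.1, lt_of_le_of_ne (hsj.2.trans (τ.t_mem hj).2) hsT⟩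
    exact integral_congr_ae (ae_restrict_of_ae (hs hmem))

lemma tsum_weighted_discInit_le (hh : 0 < h) (X : Idx N → ℝ≥0∞)
    (v : EuclideanSpace ℝ (Fin N) → ℝ) :
    ENNReal.ofReal (h ^ N) * ∑' β, X β * ‖discInit h v β‖ₑ
      ≤ ∫⁻ x, X (cellIdx h x) * ‖v x‖ₑ := by
  rw [← ENNReal.tsum_mul_left]
  refine le_trans (le_of_eq (tsum_congr fun β => ?_)) (tsum_mul_enorm_setIntegral_cell_le hh X v)
  rw [mul_left_comm, discInit, ofReal_mul_enorm_inv_mul hh]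

lemma gridL1_discInit_le (hh : 0 < h) (v : EuclideanSpace ℝ (Fin N) → ℝ) :
    ENNReal.ofReal (h ^ N) * gridL1 (discInit h v) ≤ ∫⁻ x, ‖v x‖ₑ := by
  simpa [gridL1] using tsum_weighted_discInit_le hh (fun _ => 1) v

lemma shiftDist_discInit_le (hh : 0 < h) {v : EuclideanSpace ℝ (Fin N) → ℝ} (hv : Integrable v)
    (η : Idx N) :
    ENNReal.ofReal (h ^ N) * shiftDist (discInit h v) η
      ≤ ∫⁻ x, ‖v (x + gridPoint h η) - v x‖ₑ := by
  have e : ∀ β, discInit h v (β + η) - discInit h v β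
      = discInit h (fun x => v (x + gridPoint h η) - v x) β := fun β => by
    simp only [discInit]
    rw [← mul_sub, setIntegral_cell_add hh,
      integral_sub (hv.comp_add_right (gridPoint h η)).restrict hv.restrict]
  rw [shiftDist]
  simp only [e]
  exact gridL1_discInit_le hh _

lemma enorm_discInit_le (hh : 0 < h) (v : EuclideanSpace ℝ (Fin N) → ℝ) (β : Idx N) :
    ‖discInit h v β‖ₑ ≤ eLpNorm v ∞ volume := by
  have hN := pow_pos hh N
  have h1 : ‖∫ x in cell h β, v x‖ₑ ≤ ENNReal.ofReal (h ^ N) * eLpNorm v ∞ volume := by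
    refine (enorm_integral_le_lintegral_enorm _).trans ?_
    calc ∫⁻ x in cell h β, ‖v x‖ₑ ≤ ∫⁻ _x in cell h β, eLpNorm v ∞ volume := by
          refine lintegral_mono_ae (ae_restrict_of_ae ?_)
          rw [eLpNorm_exponent_top]
          exact ae_le_eLpNormEssSup
      _ = _ := by rw [setLIntegral_const, volume_cell hh, mul_comm]
  rw [discInit, enorm_mul, Real.enorm_of_nonneg (inv_nonneg.2 hN.le)]
  refine (mul_le_mul_right h1 _).trans (le_of_eq ?_)
  rw [← mul_assoc, ← ENNReal.ofReal_mul (inv_nonneg.2 hN.le), inv_mul_cancel₀ hN.ne',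
    ENNReal.ofReal_one, one_mul]

end Data

/-! ### Mesh-independent bounds at the time nodes. -/

section UniformEstimates

variable {N : ℕ} {T : ℝ}

/-- Weighted `ℓ¹` norm of a lattice function. -/
def gridWL1 (X V : Idx N → ℝ) : ℝ≥0∞ := ∑' β, ENNReal.ofReal (X β) * ‖V β‖ₑ

lemma gridWL1_one (V : Idx N → ℝ) : gridWL1 (fun _ => 1) V = gridL1 V := by
  simp [gridWL1, gridL1]

lemma gridWL1_eq_ofReal {X V : Idx N → ℝ} (hV : Summable V) (hX0 : ∀ β, 0 ≤ X β)
    (hX1 : ∀ β, X β ≤ 1) : gridWL1 X V = ENNReal.ofReal (∑' β, X β * |V β|) := by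
  rw [ENNReal.ofReal_tsum_of_nonneg (fun β => mul_nonneg (hX0 β) (abs_nonneg _))
    (Summable.mul_abs_of_bounded hV.abs (C := 1) fun β => by
      rw [abs_of_nonneg (hX0 β)]; exact hX1 β)]
  exact tsum_congr fun β => by rw [ENNReal.ofReal_mul (hX0 β), Real.enorm_eq_ofReal_abs]

lemma summable_of_gridL1_ne_top {V : Idx N → ℝ} (hV : gridL1 V ≠ ∞) : Summable V := by
  have := ENNReal.summable_toReal hV
  simp only [toReal_enorm] at this
  exact this.of_norm

lemma exists_lipschitz_bound {φ : ℝ → ℝ} (hφ : LocallyLipschitz φ) (M : ℝ) :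
    ∃ K, 0 ≤ K ∧ ∀ x y, |x| ≤ M → |y| ≤ M → |φ x - φ y| ≤ K * |x - y| := by
  obtain ⟨K, hK⟩ := (hφ.locallyLipschitzOn (s := Icc (-M) M)).exists_lipschitzOnWith_of_compact
    isCompact_Icc
  refine ⟨K, K.coe_nonneg, fun x y hx hy => ?_⟩
  have := hK.dist_le_mul x (abs_le.1 hx) y (abs_le.1 hy)
  rwa [Real.dist_eq, Real.dist_eq] at this

/-- Absolute continuity gives `ε` on intervals shorter than some `d`; on longer ones the total
integral is at most `K (b - a)` with `K` the total divided by `d`. An affine modulus survives the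
linear interpolation in time. -/
lemma exists_setLIntegral_Ioc_le {m : ℝ → ℝ≥0∞} (hm : ∫⁻ s, m s ≠ ∞) {ε : ℝ} (hε : 0 < ε) :
    ∃ K, 0 ≤ K ∧ ∀ a b, a ≤ b → ∫⁻ s in Ioc a b, m s ≤ ENNReal.ofReal (ε + K * (b - a)) := by
  obtain ⟨δ, hδ, h⟩ := exists_pos_setLIntegral_lt_of_measure_lt hm (ε := ENNReal.ofReal ε)
    (ENNReal.ofReal_pos.2 hε).ne'
  obtain ⟨d, hd, hdδ⟩ : ∃ d : ℝ, 0 < d ∧ ENNReal.ofReal d ≤ δ := by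
    rcases eq_or_ne δ ∞ with rfl | hδ'
    · exact ⟨1, one_pos, le_top⟩
    · exact ⟨δ.toReal, ENNReal.toReal_pos hδ.ne' hδ', ENNReal.ofReal_toReal_le⟩
  refine ⟨(∫⁻ s, m s).toReal / d, by positivity, fun a b hab => ?_⟩
  have hba : 0 ≤ b - a := sub_nonneg.2 hab
  rcases lt_or_ge (b - a) d with hlt | hge
  · refine (h (Ioc a b) ?_).le.trans (ENNReal.ofReal_le_ofReal ?_)
    · rw [Real.volume_Ioc]
      exact ((ENNReal.ofReal_lt_ofReal_iff hd).2 hlt).trans_le hdδ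
    · have : 0 ≤ (∫⁻ s, m s).toReal / d * (b - a) := by positivity
      linarith
  · refine (setLIntegral_le_lintegral _ _).trans ?_
    rw [← ENNReal.ofReal_toReal hm]
    refine ENNReal.ofReal_le_ofReal ?_
    rw [ENNReal.toReal_ofReal ENNReal.toReal_nonneg]
    have : (∫⁻ s, m s).toReal ≤ (∫⁻ s, m s).toReal / d * (b - a) := by
      rw [div_mul_eq_mul_div, le_div_iff₀ hd]
      gcongr
    linarith

lemma IsDiscreteSolution.gridWL1_sub_le {h : ℝ} {τ : TimeGrid T} {F : ℝ → ℝ → Fin N → ℝ}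
    {f : Fin N → ℝ → ℝ} {L : ℝ≥0} {φ : ℝ → ℝ} {ι : Type} {ζ : ι → Idx N} {a : ι → ℝ}
    {G G' U V : ℕ → Idx N → ℝ} (hU : IsDiscreteSolution h τ F φ ζ a G U)
    (hV : IsDiscreteSolution h τ F φ ζ a G' V) (hh : 0 < h)
    (hF : IsNumericalFlux F f L) (hφ : Monotone φ) (hS : SymStencil ζ a)
    (hCFL : ∀ j < τ.J, 2 * (N : ℝ) * L * τ.step j ≤ h) {Lφ : ℝ}
    (hLφ : ∀ j ≤ τ.J, ∀ β, |φ (U j β) - φ (V j β)| ≤ Lφ * |U j β - V j β|)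
    {MU MV : ℝ} (hMU : ∀ j ≤ τ.J, ∀ β, |φ (U j β)| ≤ MU) (hMV : ∀ j ≤ τ.J, ∀ β, |φ (V j β)| ≤ MV)
    {X : Idx N → ℝ} (hX0 : ∀ β, 0 ≤ X β) (hX1 : ∀ β, X β ≤ 1) {κ ε K : ℝ} (hε : 0 ≤ ε)
    (hκ : ∀ β i, |X (β + Pi.single i 1) - X β| ≤ κ * h) (hLX : ∀ β, stencilOp ζ a X β ≤ ε)
    (hK : ∀ j < τ.J, N * (κ * (2 * L * ∑' β, |U j β - V j β|))
      + ε * (Lφ * ∑' β, |U (j + 1) β - V (j + 1) β|) ≤ K) {j : ℕ} (hj : j ≤ τ.J) :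
    gridWL1 X (fun β => U j β - V j β) ≤ gridWL1 X (fun β => U 0 β - V 0 β)
      + ENNReal.ofReal (τ.t j * K)
      + ∑ i ∈ Finset.range j, gridWL1 X (fun β => τ.step i * (G i β - G' i β)) := by
  have hnn : ∀ W : Idx N → ℝ, 0 ≤ ∑' β, X β * |W β| := fun W =>
    tsum_nonneg fun β => mul_nonneg (hX0 β) (abs_nonneg _)
  have hsum : ∀ j ≤ τ.J, Summable fun β => U j β - V j β := fun j hj =>
    (hU.summable j hj).sub (hV.summable j hj)
  rw [gridWL1_eq_ofReal (hsum j hj) hX0 hX1, gridWL1_eq_ofReal (hsum 0 (Nat.zero_le _)) hX0 hX1,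
    Finset.sum_congr rfl fun i hi => gridWL1_eq_ofReal
      (((hU.summable_source i ((Finset.mem_range.1 hi).trans_le hj)).sub
        (hV.summable_source i ((Finset.mem_range.1 hi).trans_le hj))).mul_left (τ.step i)) hX0 hX1,
    ← ENNReal.ofReal_sum_of_nonneg fun i _ => hnn _]
  refine (ENNReal.ofReal_le_ofReal (hU.tsum_weighted_sub_le hV hh hF hφ hS hCFL hLφ hMU hMV hX0 hX1
    hε hκ hLX hK hj)).trans ?_
  exact ENNReal.ofReal_add_le.trans (add_le_add ENNReal.ofReal_add_le le_rfl)

/-- `ℓ¹` contraction. -/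
lemma IsDiscreteSolution.gridL1_sub_le_initial {h : ℝ} {τ : TimeGrid T} {F : ℝ → ℝ → Fin N → ℝ}
    {f : Fin N → ℝ → ℝ} {L : ℝ≥0} {φ : ℝ → ℝ} {ι : Type} {ζ : ι → Idx N} {a : ι → ℝ}
    {G G' U V : ℕ → Idx N → ℝ} (hU : IsDiscreteSolution h τ F φ ζ a G U)
    (hV : IsDiscreteSolution h τ F φ ζ a G' V) (hh : 0 < h)
    (hF : IsNumericalFlux F f L) (hφ : Monotone φ) (hS : SymStencil ζ a)
    (hCFL : ∀ j < τ.J, 2 * (N : ℝ) * L * τ.step j ≤ h) {Lφ : ℝ}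
    (hLφ : ∀ j ≤ τ.J, ∀ β, |φ (U j β) - φ (V j β)| ≤ Lφ * |U j β - V j β|)
    {MU MV : ℝ} (hMU : ∀ j ≤ τ.J, ∀ β, |φ (U j β)| ≤ MU) (hMV : ∀ j ≤ τ.J, ∀ β, |φ (V j β)| ≤ MV)
    {j : ℕ} (hj : j ≤ τ.J) :
    gridL1 (fun β => U j β - V j β) ≤ gridL1 (fun β => U 0 β - V 0 β)
      + ∑ i ∈ Finset.range j, gridL1 (fun β => τ.step i * (G i β - G' i β)) := by
  -- A constant weight has zero differences, so both error terms vanish.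
  have := hU.gridWL1_sub_le hV hh hF hφ hS hCFL hLφ hMU hMV (X := fun _ => 1)
    (fun _ => zero_le_one) (fun _ => le_rfl) (κ := 0) (ε := 0) (K := 0) le_rfl (by simp)
    (by simp [stencilOp]) (by simp) hj
  simpa only [gridWL1_one, mul_zero, ENNReal.ofReal_zero, add_zero] using this

/-- A family of discrete solutions for the data `u₀` and `k`, indexed by the mesh size. -/
structure IsSchemeFamily (F : ℝ → ℝ → Fin N → ℝ) (f : Fin N → ℝ → ℝ) (L : ℝ≥0) (φ : ℝ → ℝ)
    (z : ℝ → Idx N → Idx N) (ω : ℝ → Idx N → ℝ) (τ : ℝ → TimeGrid T)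
    (u₀ : EuclideanSpace ℝ (Fin N) → ℝ) (k : EuclideanSpace ℝ (Fin N) × ℝ → ℝ)
    (U : ℝ → ℕ → Idx N → ℝ) : Prop where
  flux : IsNumericalFlux F f L
  lipschitz : LocallyLipschitz φ
  mono : Monotone φ
  levy : LevyWeights z ω
  tight : UniformlyTight z ω
  cfl : ∀ h ∈ Ioo (0 : ℝ) 1, ∀ j < (τ h).J, 2 * (N : ℝ) * L * (τ h).step j ≤ h
  init_one : MemLp u₀ 1 volume
  init_top : MemLp u₀ ∞ volume
  meas : Measurable k
  integrable : Integrable k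
  source_top : ∫⁻ s, eLpNorm (fun x => k (x, s)) ∞ volume < ∞
  summable : ∀ h ∈ Ioo (0 : ℝ) 1, ∀ j ≤ (τ h).J, Summable (U h j)
  init : ∀ h ∈ Ioo (0 : ℝ) 1, ∀ β, U h 0 β = discInit h u₀ β
  step : ∀ h ∈ Ioo (0 : ℝ) 1, ∀ j < (τ h).J, ∀ β,
    U h (j + 1) β = U h j β - (τ h).step j * discConvection h F (U h j) β
      + (τ h).step j * stencilOp (fun γ : {γ : Idx N // γ ≠ 0} => z h γ) (fun γ => ω h γ)
          (fun β => φ (U h (j + 1) β)) β + discImpulse h (τ h) k j β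

namespace IsSchemeFamily

variable {F : ℝ → ℝ → Fin N → ℝ} {f : Fin N → ℝ → ℝ} {L : ℝ≥0} {φ : ℝ → ℝ}
  {z : ℝ → Idx N → Idx N} {ω : ℝ → Idx N → ℝ} {τ : ℝ → TimeGrid T}
  {u₀ : EuclideanSpace ℝ (Fin N) → ℝ} {k : EuclideanSpace ℝ (Fin N) × ℝ → ℝ}
  {U : ℝ → ℕ → Idx N → ℝ} {h : ℝ}

lemma lintegral_source_ne_top (hU : IsSchemeFamily F f L φ z ω τ u₀ k U) :
    ∫⁻ s, ∫⁻ x, ‖k (x, s)‖ₑ ≠ ∞ := by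
  have := hU.integrable.2
  rw [hasFiniteIntegral_iff_enorm, Measure.volume_eq_prod,
    lintegral_prod_symm _ hU.meas.enorm.aemeasurable] at this
  exact this.ne

lemma lintegral_init_ne_top (hU : IsSchemeFamily F f L φ z ω τ u₀ k U) :
    ∫⁻ x, ‖u₀ x‖ₑ ≠ ∞ := by
  rw [← eLpNorm_one_eq_lintegral_enorm]
  exact hU.init_one.2.ne

lemma sum_source_le (t : TimeGrid T) (m : ℝ → ℝ≥0∞) {j : ℕ} (hj : j ≤ t.J) :
    ∑ i ∈ Finset.range j, ∫⁻ s in Ioc (t.t i) (t.t (i + 1)), m s ≤ ∫⁻ s, m s := by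
  rw [Finset.range_eq_Ico, sum_lintegral_Ioc m (Nat.zero_le j) hj]
  exact setLIntegral_le_lintegral _ _

lemma isDiscreteSolution (hU : IsSchemeFamily F f L φ z ω τ u₀ k U) (hh : h ∈ Ioo (0 : ℝ) 1) :
    IsDiscreteSolution h (τ h) F φ (fun γ : {γ : Idx N // γ ≠ 0} => z h γ) (fun γ => ω h γ)
      (fun j β => ((τ h).step j)⁻¹ * discImpulse h (τ h) k j β) (U h) where
  summable := hU.summable h hh
  summable_source j hj := by
    refine Summable.mul_left _ (summable_of_gridL1_ne_top fun htop => ?_)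
    have h1 := gridL1_discImpulse_le (τ := τ h) hh.1 hU.meas hj
    rw [htop, ENNReal.mul_top (ENNReal.ofReal_pos.2 (pow_pos hh.1 N)).ne', top_le_iff] at h1
    exact hU.lintegral_source_ne_top
      (top_le_iff.1 (h1.symm.le.trans (setLIntegral_le_lintegral _ _)))
  step j hj β := by
    rw [mul_inv_cancel_left₀ ((τ h).step_pos hj).ne']
    exact hU.step h hh j hj β

lemma step_mul_source {j : ℕ} (hj : j < (τ h).J) (β : Idx N) :
    (τ h).step j * (((τ h).step j)⁻¹ * discImpulse h (τ h) k j β) = discImpulse h (τ h) k j β :=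
  mul_inv_cancel_left₀ ((τ h).step_pos hj).ne' _

lemma exists_abs_le (hU : IsSchemeFamily F f L φ z ω τ u₀ k U) :
    ∃ M, 0 ≤ M ∧ ∀ h ∈ Ioo (0 : ℝ) 1, ∀ j ≤ (τ h).J, ∀ β, |U h j β| ≤ M := by
  let n : ℝ → ℝ≥0∞ := fun s => eLpNorm (fun x => k (x, s)) ∞ volume
  have hn : ∀ S : Set ℝ, ∫⁻ s in S, n s ≠ ∞ := fun S =>
    ((setLIntegral_le_lintegral _ _).trans_lt hU.source_top).ne
  have hA : eLpNorm u₀ ∞ volume ≠ ∞ := hU.init_top.2.ne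
  have habs : ∀ {x : ℝ} {c : ℝ≥0∞}, c ≠ ∞ → ‖x‖ₑ ≤ c → |x| ≤ c.toReal := fun hc hx => by
    rw [← Real.norm_eq_abs, ← toReal_enorm]
    exact ENNReal.toReal_mono hc hx
  refine ⟨(eLpNorm u₀ ∞ volume + ∫⁻ s, n s).toReal, ENNReal.toReal_nonneg,
    fun h hh j hj β => ?_⟩
  have h1 := (hU.isDiscreteSolution hh).abs_le hh.1 hU.flux hU.mono
    (hU.levy.1.symStencil hh).nonneg (hU.cfl h hh)
    -- The majorant is the sup norm of the datum plus the accumulated sup norm of the source up to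
    -- `t_j`.
    (M := fun j => (eLpNorm u₀ ∞ volume + ∫⁻ s in Ioc 0 ((τ h).t j), n s).toReal)
    (fun β => habs (ENNReal.add_ne_top.2 ⟨hA, hn _⟩) (by
      rw [hU.init h hh]
      exact (enorm_discInit_le hh.1 u₀ β).trans le_self_add))
    (fun j hj β => by
      rw [step_mul_source hj]
      have h2 := habs (hn _) (enorm_discImpulse_le (k := k) hh.1 hj β)
      refine (add_le_add_right h2 _).trans (le_of_eq ?_)
      rw [← ENNReal.toReal_add (ENNReal.add_ne_top.2 ⟨hA, hn _⟩) (hn _), add_assoc,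
        ← lintegral_union measurableSet_Ioc (Ioc_disjoint_Ioc_of_le le_rfl),
        Ioc_union_Ioc_eq_Ioc ((τ h).t_mem hj.le).1 ((τ h).t_lt j hj).le])
    hj β
  refine h1.trans (ENNReal.toReal_mono (ENNReal.add_ne_top.2 ⟨hA, hU.source_top.ne⟩) ?_)
  gcongr
  exact Measure.restrict_le_self

/-- The uniform sup bound confines all values to one compact interval, on which `φ` has a single
Lipschitz constant. -/
lemma exists_lipschitz (hU : IsSchemeFamily F f L φ z ω τ u₀ k U) :
    ∃ Lφ MU : ℝ, 0 ≤ Lφ ∧ ∀ h ∈ Ioo (0 : ℝ) 1, ∀ j ≤ (τ h).J,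
      (∀ β, |φ (U h j β)| ≤ MU) ∧ (∀ β, |φ (U h j β) - φ 0| ≤ Lφ * |U h j β|) ∧
      ∀ β η, |φ (U h j (β + η)) - φ (U h j β)| ≤ Lφ * |U h j (β + η) - U h j β| := by
  obtain ⟨M, hM0, hM⟩ := hU.exists_abs_le
  obtain ⟨K, hK0, hK⟩ := exists_lipschitz_bound hU.lipschitz M
  have h0 : ∀ h ∈ Ioo (0 : ℝ) 1, ∀ j ≤ (τ h).J, ∀ β, |φ (U h j β) - φ 0| ≤ K * |U h j β| := by
    intro h hh j hj β
    simpa using hK _ 0 (hM h hh j hj β) (by simpa using hM0)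
  refine ⟨K, K * M + |φ 0|, hK0, fun h hh j hj => ⟨fun β => ?_, h0 h hh j hj, fun β η =>
    hK _ _ (hM h hh j hj _) (hM h hh j hj _)⟩⟩
  have h1 := h0 h hh j hj β
  have h2 := mul_le_mul_of_nonneg_left (hM h hh j hj β) hK0
  have h3 := abs_sub_abs_le_abs_sub (φ (U h j β)) (φ 0)
  linarith

lemma gridL1_le_initial (hU : IsSchemeFamily F f L φ z ω τ u₀ k U) (hh : h ∈ Ioo (0 : ℝ) 1) {j : ℕ}
    (hj : j ≤ (τ h).J) : gridL1 (U h j) ≤ gridL1 (discInit h u₀)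
      + ∑ i ∈ Finset.range j, gridL1 (discImpulse h (τ h) k i) := by
  obtain ⟨Lφ, MU, -, hL⟩ := hU.exists_lipschitz
  have h1 := (hU.isDiscreteSolution hh).gridL1_sub_le_initial (isDiscreteSolution_zero _ _ _ _ _ _)
    hh.1 hU.flux hU.mono (hU.levy.1.symStencil hh) (hU.cfl h hh) (Lφ := Lφ)
    (fun j hj β => by simpa using (hL h hh j hj).2.1 β) (fun j hj => (hL h hh j hj).1)
    (MV := |φ 0|) (fun _ _ _ => le_rfl) hj
  simp only [sub_zero] at h1
  have h0 : U h 0 = discInit h u₀ := funext (hU.init h hh)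
  rw [← h0]
  refine h1.trans (add_le_add le_rfl (Finset.sum_le_sum fun i hi => le_of_eq ?_))
  exact congrArg gridL1 (funext (step_mul_source ((Finset.mem_range.1 hi).trans_le hj)))

lemma exists_gridL1_le (hU : IsSchemeFamily F f L φ z ω τ u₀ k U) :
    ∃ A : ℝ, 0 ≤ A ∧ ∀ h ∈ Ioo (0 : ℝ) 1, ∀ j ≤ (τ h).J,
      ENNReal.ofReal (h ^ N) * gridL1 (U h j) ≤ ENNReal.ofReal A := by
  refine ⟨((∫⁻ x, ‖u₀ x‖ₑ) + ∫⁻ s, ∫⁻ x, ‖k (x, s)‖ₑ).toReal, ENNReal.toReal_nonneg,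
    fun h hh j hj => ?_⟩
  rw [ENNReal.ofReal_toReal
    (ENNReal.add_ne_top.2 ⟨hU.lintegral_init_ne_top, hU.lintegral_source_ne_top⟩)]
  refine (mul_le_mul_right (hU.gridL1_le_initial hh hj) _).trans ?_
  rw [mul_add, Finset.mul_sum]
  refine add_le_add (gridL1_discInit_le hh.1 u₀) ((Finset.sum_le_sum fun i hi => ?_).trans
    (sum_source_le (τ h) (fun s => ∫⁻ x, ‖k (x, s)‖ₑ) hj))
  exact gridL1_discImpulse_le hh.1 hU.meas ((Finset.mem_range.1 hi).trans_le hj)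

lemma shiftDist_le_initial (hU : IsSchemeFamily F f L φ z ω τ u₀ k U) (hh : h ∈ Ioo (0 : ℝ) 1)
    {j : ℕ} (hj : j ≤ (τ h).J) (η : Idx N) : shiftDist (U h j) η ≤ shiftDist (discInit h u₀) η
      + ∑ i ∈ Finset.range j, shiftDist (discImpulse h (τ h) k i) η := by
  obtain ⟨Lφ, MU, -, hL⟩ := hU.exists_lipschitz
  have h1 := ((hU.isDiscreteSolution hh).shift η).gridL1_sub_le_initial (hU.isDiscreteSolution hh)
    hh.1 hU.flux hU.mono (hU.levy.1.symStencil hh) (hU.cfl h hh) (Lφ := Lφ)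
    (fun j hj β => (hL h hh j hj).2.2 β η) (fun j hj β => (hL h hh j hj).1 _)
    (fun j hj => (hL h hh j hj).1) hj
  have h0 : U h 0 = discInit h u₀ := funext (hU.init h hh)
  rw [← h0]
  refine h1.trans (add_le_add le_rfl (Finset.sum_le_sum fun i hi => le_of_eq ?_))
  refine congrArg gridL1 (funext fun β => ?_)
  have hi' := (Finset.mem_range.1 hi).trans_le hj
  rw [mul_sub, step_mul_source hi', step_mul_source hi']

lemma tendsto_lintegral_source_translate (hU : IsSchemeFamily F f L φ z ω τ u₀ k U) :
    Tendsto (fun w => ∫⁻ s, ∫⁻ x, ‖k (x + w, s) - k (x, s)‖ₑ) (𝓝 0) (𝓝 0) := by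
  have h1 : Tendsto (fun w : EuclideanSpace ℝ (Fin N) => (w, (0 : ℝ))) (𝓝 0) (𝓝 0) :=
    Continuous.tendsto' (by fun_prop) _ _ rfl
  refine ((tendsto_lintegral_translate_sub
    (memLp_one_iff_integrable.2 hU.integrable)).comp h1).congr fun w => ?_
  rw [Function.comp_apply, Measure.volume_eq_prod, lintegral_prod_symm]
  · simp
  · exact ((hU.meas.comp (measurable_id.add_const _)).sub hU.meas).enorm.aemeasurable

/-- By contraction the modulus at every time is bounded by those of the data, which vanish by
continuity of translations in `L¹`. -/
lemma exists_shiftDist_le (hU : IsSchemeFamily F f L φ z ω τ u₀ k U) {ε : ℝ} (hε : 0 < ε) :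
    ∃ δ > 0, ∀ h ∈ Ioo (0 : ℝ) 1, ∀ j ≤ (τ h).J, ∀ η, ‖gridPoint h η‖ ≤ δ →
      ENNReal.ofReal (h ^ N) * shiftDist (U h j) η ≤ ENNReal.ofReal ε := by
  have h1 := (tendsto_lintegral_translate_sub hU.init_one).add
    hU.tendsto_lintegral_source_translate
  rw [add_zero] at h1
  obtain ⟨δ, hδ, h2⟩ := Metric.nhds_basis_closedBall.eventually_iff.1
    (h1.eventually_le_const (ENNReal.ofReal_pos.2 hε))
  refine ⟨δ, hδ, fun h hh j hj η hη => le_trans ?_ (h2 (mem_closedBall_zero_iff.2 hη))⟩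
  refine (mul_le_mul_right (hU.shiftDist_le_initial hh hj η) _).trans ?_
  rw [mul_add, Finset.mul_sum]
  refine add_le_add (shiftDist_discInit_le hh.1 (memLp_one_iff_integrable.1 hU.init_one) η)
    ((Finset.sum_le_sum fun i hi => ?_).trans
    (sum_source_le (τ h) (fun s => ∫⁻ x, ‖k (x + gridPoint h η, s) - k (x, s)‖ₑ) hj))
  exact shiftDist_discImpulse_le hh.1 hU.meas hU.integrable ((Finset.mem_range.1 hi).trans_le hj) η

lemma tendsto_lintegral_source_cutoff (hU : IsSchemeFamily F f L φ z ω τ u₀ k U) :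
    Tendsto (fun R : ℝ => ∫⁻ s, ∫⁻ x, ENNReal.ofReal (cutoff R x + N / R) * ‖k (x, s)‖ₑ) atTop
      (𝓝 0) := by
  refine (tendsto_lintegral_cutoff_mul (p := Prod.fst) measurable_fst
    hU.meas.aestronglyMeasurable hU.integrable.2.ne).congr fun R => ?_
  rw [Measure.volume_eq_prod, lintegral_prod_symm]
  have hc : Continuous (cutoff R : EuclideanSpace ℝ (Fin N) → ℝ) := by
    unfold cutoff
    exact continuous_const.sub (Continuous.inv₀ (by fun_prop) fun x => by positivity)
  exact ((((hc.measurable.comp measurable_fst).add_const _).ennreal_ofReal).mul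
    hU.meas.enorm).aemeasurable

/-- Weighted comparison with the zero solution. The tail mass comes from the initial datum, from the
source, and from transport and diffusion across the cutoff; the last is small because `R⁻¹` and the
truncated moment are. -/
lemma exists_tail_le (hU : IsSchemeFamily F f L φ z ω τ u₀ k U) (hT : 0 < T) {ε : ℝ} (hε : 0 < ε) :
    ∃ R₀ ≥ (1 : ℝ), ∀ R ≥ R₀, ∀ h ∈ Ioo (0 : ℝ) 1, ∀ j ≤ (τ h).J,
      ENNReal.ofReal (h ^ N) * gridWL1 (fun β => cutoff R (gridPoint h β)) (U h j)
        ≤ ENNReal.ofReal ε := by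
  obtain ⟨Lφ, MU, hLφ, hL⟩ := hU.exists_lipschitz
  obtain ⟨A, hA0, hA⟩ := hU.exists_gridL1_le
  have hL0 := L.coe_nonneg
  -- `Q - 1` is the factor multiplying `e` when both `R⁻¹` and the truncated moment are at most `e`;
  -- the added `1` makes `Q` positive, and `Q * e = ε / 3`.
  set Q : ℝ := T * A * (2 * N * L + 5 * Lφ) + 1 with hQ
  have hQ0 : 0 < Q := by positivity
  set e : ℝ := ε / (3 * Q) with he
  have he0 : 0 < e := by positivity
  have hε3 : (0 : ℝ) < ε / 3 := by positivity
  obtain ⟨R₁, hR₁, h1⟩ := hU.tight e he0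
  obtain ⟨R₂, h2⟩ := eventually_atTop.1 (((tendsto_lintegral_cutoff_mul (μ := volume) measurable_id
    hU.init_one.1 hU.lintegral_init_ne_top).eventually_le_const
      (ENNReal.ofReal_pos.2 hε3)).and
    (hU.tendsto_lintegral_source_cutoff.eventually_le_const (ENNReal.ofReal_pos.2 hε3)))
  refine ⟨max (max R₁ R₂) e⁻¹, hR₁.trans ((le_max_left _ _).trans (le_max_left _ _)),
    fun R hR h hh j hj => ?_⟩
  have hRR₁ : R₁ ≤ R := ((le_max_left _ _).trans (le_max_left _ _)).trans hR
  have hRR₂ : R₂ ≤ R := ((le_max_right _ _).trans (le_max_left _ _)).trans hR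
  have hR0 : 0 < R := one_pos.trans_le (hR₁.trans hRR₁)
  have hRe : R⁻¹ ≤ e := inv_le_of_inv_le₀ he0 ((le_max_right _ _).trans hR)
  have hhN : 0 < h ^ N := pow_pos hh.1 N
  obtain ⟨hi1, hi2⟩ := h2 R hRR₂
  set μ := truncMoment h (fun γ : {γ : Idx N // γ ≠ 0} => z h γ) (fun γ => ω h γ) R with hμ
  have hS := hU.levy.1.symStencil hh
  have hμ0 : 0 ≤ μ := tsum_nonneg fun γ => mul_nonneg (hS.nonneg γ) (sq_nonneg _)
  have hμe : μ ≤ e := h1 R hRR₁ h hh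
  have hsum : ∀ j ≤ (τ h).J, ∑' β, |U h j β| ≤ A / h ^ N := fun j hj => by
    have h3 := hA h hh j hj
    rw [gridL1_eq_ofReal (hU.summable h hh j hj), ← ENNReal.ofReal_mul hhN.le,
      ENNReal.ofReal_le_ofReal_iff hA0] at h3
    rw [le_div_iff₀ hhN, mul_comm]
    exact h3
  have h4 := (hU.isDiscreteSolution hh).gridWL1_sub_le (isDiscreteSolution_zero _ _ _ _ _ _)
    hh.1 hU.flux hU.mono hS (hU.cfl h hh) (Lφ := Lφ)
    (fun j hj β => by simpa using (hL h hh j hj).2.1 β) (fun j hj => (hL h hh j hj).1)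
    (MV := |φ 0|) (fun _ _ _ => le_rfl) (X := fun β => cutoff R (gridPoint h β))
    (fun β => cutoff_nonneg _ _) (fun β => cutoff_le_one _ _) (κ := R⁻¹) (ε := 5 * μ)
    (K := N * (R⁻¹ * (2 * L * (A / h ^ N))) + 5 * μ * (Lφ * (A / h ^ N))) (by positivity)
    (fun β i => abs_cutoff_gridPoint_single_sub_le hh.1 hR0 β i)
    (fun β => stencilOp_cutoff_le hS h hR0 β)
    (fun j hj => by
      simp only [sub_zero]
      have h5 := hsum j hj.le
      have h6 := hsum (j + 1) hj
      gcongr) hj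
  simp only [sub_zero] at h4
  refine (mul_le_mul_right h4 _).trans ?_
  rw [mul_add, mul_add, Finset.mul_sum]
  have hcut : ∀ x, ENNReal.ofReal (cutoff R (gridPoint h (cellIdx h x)))
      ≤ ENNReal.ofReal (cutoff R x + N / R) := fun x =>
    ENNReal.ofReal_le_ofReal (cutoff_gridPoint_le hR0 hh x)
  have p1 : ENNReal.ofReal (h ^ N) * gridWL1 (fun β => cutoff R (gridPoint h β)) (fun β => U h 0 β)
      ≤ ENNReal.ofReal (ε / 3) := by
    have h0 : U h 0 = discInit h u₀ := funext (hU.init h hh)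
    rw [h0]
    refine (tsum_weighted_discInit_le hh.1
      (fun β => ENNReal.ofReal (cutoff R (gridPoint h β))) u₀).trans (le_trans ?_ hi1)
    exact lintegral_mono fun x => mul_le_mul_left (hcut x) _
  have p2 : ENNReal.ofReal (h ^ N) * ENNReal.ofReal ((τ h).t j *
      (N * (R⁻¹ * (2 * L * (A / h ^ N))) + 5 * μ * (Lφ * (A / h ^ N)))) ≤ ENNReal.ofReal (ε / 3) := by
    rw [← ENNReal.ofReal_mul hhN.le]
    refine ENNReal.ofReal_le_ofReal ?_
    calc h ^ N * ((τ h).t j *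
        (N * (R⁻¹ * (2 * L * (A / h ^ N))) + 5 * μ * (Lφ * (A / h ^ N))))
        = (τ h).t j * (A * (2 * N * L * R⁻¹ + 5 * Lφ * μ)) := by field_simp
      _ ≤ T * (A * (2 * N * L * e + 5 * Lφ * e)) := by
          have := (τ h).t_mem hj
          have h7 := this.1
          have h8 := this.2
          gcongr
      _ = (Q - 1) * e := by rw [hQ]; ring
      _ ≤ Q * e := by gcongr; linarith
      _ = ε / 3 := by rw [he]; field_simp
  have p3 : ∑ i ∈ Finset.range j, ENNReal.ofReal (h ^ N) *
      gridWL1 (fun β => cutoff R (gridPoint h β)) (fun β => (τ h).step i *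
        (((τ h).step i)⁻¹ * discImpulse h (τ h) k i β)) ≤ ENNReal.ofReal (ε / 3) := by
    refine le_trans ((Finset.sum_le_sum fun i hi => ?_).trans (sum_source_le (τ h)
      (fun s => ∫⁻ x, ENNReal.ofReal (cutoff R x + N / R) * ‖k (x, s)‖ₑ) hj)) hi2
    have hi' := (Finset.mem_range.1 hi).trans_le hj
    simp only [step_mul_source hi']
    refine (tsum_weighted_discImpulse_le hh.1
      (fun β => ENNReal.ofReal (cutoff R (gridPoint h β))) hU.meas hi').trans ?_
    exact lintegral_mono fun s => lintegral_mono fun x => mul_le_mul_left (hcut x) _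
  refine (add_le_add (add_le_add p1 p2) p3).trans (le_of_eq ?_)
  rw [← ENNReal.ofReal_add hε3.le hε3.le, ← ENNReal.ofReal_add (by positivity) hε3.le]
  congr 1
  ring

/-- Kružkov's estimate with boxes of physical side at least `ρ`, chosen from the spatial modulus
before `h`; hence `B` does not depend on `h`. -/
lemma exists_time_sub_le (hU : IsSchemeFamily F f L φ z ω τ u₀ k U) (hN : 0 < N) {ε : ℝ}
    (hε : 0 < ε) :
    ∃ B : ℝ, 0 ≤ B ∧ ∀ h ∈ Ioo (0 : ℝ) 1, ∀ i j, i ≤ j → j ≤ (τ h).J →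
      ENNReal.ofReal (h ^ N) * gridL1 (fun β => U h j β - U h i β)
        ≤ ENNReal.ofReal (ε + B * ((τ h).t j - (τ h).t i)) := by
  obtain ⟨Lφ, MU, hLφ, hL⟩ := hU.exists_lipschitz
  obtain ⟨A, hA0, hA⟩ := hU.exists_gridL1_le
  obtain ⟨C, hC0, hC⟩ := hU.levy.exists_truncMoment_le
  obtain ⟨K, hK0, hK⟩ := exists_setLIntegral_Ioc_le hU.lintegral_source_ne_top (half_pos hε)
  have hL0 := L.coe_nonneg
  have hN' : (0 : ℝ) < N := by exact_mod_cast hN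
  -- The cost `4 * N * e` of removing the averages is then `ε / 2`; the source modulus takes the
  -- other half.
  set e : ℝ := ε / (8 * N) with he
  have he0 : 0 < e := by positivity
  obtain ⟨ρ, hρ, hsh⟩ := hU.exists_shiftDist_le he0
  set D : ℝ := N * (4 * L / ρ) + 2 * (C * (1 + (ρ / N)⁻¹ ^ 2)) * Lφ with hD
  have hD0 : 0 ≤ D := by positivity
  refine ⟨D * A + K, by positivity, fun h hh i j hij hj => ?_⟩
  have hh0 := hh.1
  -- Large enough that `n * h ≥ ρ`, yet every `k < n` still satisfies `k * h ≤ ρ`.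
  set n : ℕ := ⌊ρ / h⌋₊ + 1 with hn
  have hnh : ρ ≤ n * h := by
    rw [hn, ← div_le_iff₀ hh0]
    push_cast
    exact (Nat.lt_floor_add_one _).le
  have hc0 : ENNReal.ofReal (h ^ N) ≠ 0 := (ENNReal.ofReal_pos.2 (pow_pos hh0 N)).ne'
  have hcancel : ∀ y : ℝ≥0∞, ENNReal.ofReal (h ^ N) * ((ENNReal.ofReal (h ^ N))⁻¹ * y) = y :=
    fun y => by rw [← mul_assoc, ENNReal.mul_inv_cancel hc0 ENNReal.ofReal_ne_top, one_mul]
  have hle : ∀ x y : ℝ≥0∞, ENNReal.ofReal (h ^ N) * x ≤ y → x ≤ (ENNReal.ofReal (h ^ N))⁻¹ * y :=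
    fun x y hxy => by
      rw [mul_comm, ← div_eq_mul_inv, ENNReal.le_div_iff_mul_le (Or.inl hc0)
        (Or.inl ENNReal.ofReal_ne_top), mul_comm]
      exact hxy
  have h1 := (hU.isDiscreteSolution hh).gridL1_sub_le hN hh0 hU.flux (hU.levy.1.symStencil hh) hLφ
    (fun j hj => (hL h hh j hj).2.1) (fun j hj => hle _ _ (hA h hh j hj)) (Nat.succ_pos _)
    (n := n) (E := (ENNReal.ofReal (h ^ N))⁻¹ * ENNReal.ofReal e)
    (fun j hj i k hk => hle _ _ (hsh h hh j hj _ (by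
      rw [norm_gridPoint_single hh0, Int.cast_natCast, Nat.abs_cast]
      have : (k : ℝ) ≤ ρ / h := (Nat.cast_le.2 (Nat.lt_succ_iff.1 hk)).trans
        (Nat.floor_le (by positivity))
      rwa [le_div_iff₀ hh0, mul_comm] at this))) hij hj
  have hij' : 0 ≤ (τ h).t j - (τ h).t i := sub_nonneg.2 ((τ h).t_le hij hj)
  refine (mul_le_mul_right h1 _).trans ?_
  rw [mul_add, mul_add, mul_left_comm _ (4 * (N : ℝ≥0∞)), hcancel, mul_left_comm _ _ (_⁻¹ * _),
    hcancel, Finset.mul_sum]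
  have p1 : 4 * (N : ℝ≥0∞) * ENNReal.ofReal e = ENNReal.ofReal (ε / 2) := by
    rw [← ENNReal.ofReal_natCast, ← ENNReal.ofReal_ofNat 4, ← ENNReal.ofReal_mul (by norm_num),
      ← ENNReal.ofReal_mul (by positivity)]
    congr 1
    rw [he]
    field_simp
    norm_num
  have p2 : ENNReal.ofReal (((τ h).t j - (τ h).t i) * (N * (4 * L / (n * h)) + 2 *
      truncMoment h (fun γ : {γ : Idx N // γ ≠ 0} => z h γ) (fun γ => ω h γ) (n * h / N) * Lφ))
        * ENNReal.ofReal A ≤ ENNReal.ofReal (D * A * ((τ h).t j - (τ h).t i)) := by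
    rw [← ENNReal.ofReal_mul' hA0]
    refine ENNReal.ofReal_le_ofReal ?_
    have h2 : truncMoment h (fun γ : {γ : Idx N // γ ≠ 0} => z h γ) (fun γ => ω h γ) (n * h / N)
        ≤ C * (1 + (ρ / N)⁻¹ ^ 2) := by
      refine (hC h hh _ (by positivity)).trans ?_
      gcongr
    have h3 : N * (4 * L / (n * h)) + 2 * truncMoment h (fun γ : {γ : Idx N // γ ≠ 0} => z h γ)
        (fun γ => ω h γ) (n * h / N) * Lφ ≤ D := by
      rw [hD]
      gcongr
    calc _ ≤ ((τ h).t j - (τ h).t i) * D * A := by gcongr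
      _ = _ := by ring
  have p3 : ∑ l ∈ Finset.Ico i j, ENNReal.ofReal (h ^ N) * gridL1 (fun β => (τ h).step l *
      (((τ h).step l)⁻¹ * discImpulse h (τ h) k l β))
        ≤ ENNReal.ofReal (ε / 2 + K * ((τ h).t j - (τ h).t i)) := by
    refine le_trans (Finset.sum_le_sum fun l hl => ?_)
      ((sum_lintegral_Ioc (fun s => ∫⁻ x, ‖k (x, s)‖ₑ) hij hj).le.trans
        (hK _ _ (sub_nonneg.1 hij')))
    have hl' := (Finset.mem_Ico.1 hl).2.trans_le hj
    simp only [step_mul_source hl']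
    exact gridL1_discImpulse_le hh0 hU.meas hl'
  refine (add_le_add (add_le_add p1.le p2) p3).trans (le_of_eq ?_)
  rw [← ENNReal.ofReal_add (by positivity) (by positivity),
    ← ENNReal.ofReal_add (by positivity) (by positivity)]
  congr 1
  ring

end IsSchemeFamily

end UniformEstimates

/-! ### Transfer of the estimates to the space-time interpolants. -/

section Interpolation

variable {N : ℕ} {T : ℝ}

/-- The piecewise linear interpolant in time of a sequence of lattice functions. -/
def timeInterp (τ : TimeGrid T) (U : ℕ → Idx N → ℝ) (t : ℝ) (β : Idx N) : ℝ :=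
  ({0} : Set ℝ).indicator (fun _ => U 0 β) t
    + ∑ j ∈ Finset.range τ.J, (Ioc (τ.t j) (τ.t (j + 1))).indicator
        (fun s => U j β + (s - τ.t j) / τ.step j * (U (j + 1) β - U j β)) t

lemma spaceTimeInterp_eq {h : ℝ} (hh : 0 < h) (τ : TimeGrid T) (U : ℕ → Idx N → ℝ)
    (x : EuclideanSpace ℝ (Fin N)) (t : ℝ) :
    spaceTimeInterp h τ U x t = timeInterp τ U t (cellIdx h x) := by
  simp only [spaceTimeInterp, timeInterp, spaceInterp_eq hh]

lemma TimeGrid.exists_mem_Ioc (τ : TimeGrid T) {t : ℝ} (ht : t ∈ Ioc 0 T) :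
    ∃ j < τ.J, t ∈ Ioc (τ.t j) (τ.t (j + 1)) := by
  classical
  have hex : ∃ j, t ≤ τ.t j := ⟨τ.J, ht.2.trans τ.t_last.symm.le⟩
  have h0 : Nat.find hex ≠ 0 := fun h0 => by
    have h1 := Nat.find_spec hex
    rw [h0, τ.t_zero] at h1
    exact ht.1.not_ge h1
  obtain ⟨j, hj⟩ := Nat.exists_eq_succ_of_ne_zero h0
  have h1 := Nat.find_spec hex
  have h2 : Nat.find hex ≤ τ.J := Nat.find_min' hex (ht.2.trans τ.t_last.symm.le)
  have h3 : ¬ t ≤ τ.t j := Nat.find_min hex (by omega)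
  exact ⟨j, by omega, not_le.1 h3, by rwa [hj] at h1⟩

/-- The same `j` and `θ` serve all `U` and `β`, so the interpolant is a convex combination of two
lattice functions and every convex bound passes to it. -/
lemma exists_timeInterp_eq (τ : TimeGrid T) (hT : 0 < T) {t : ℝ} (ht : t ∈ Icc 0 T) :
    ∃ j < τ.J, ∃ θ ∈ Icc (0 : ℝ) 1, t = τ.t j + θ * τ.step j ∧ ∀ (U : ℕ → Idx N → ℝ) (β : Idx N),
      timeInterp τ U t β = U j β + θ * (U (j + 1) β - U j β) := by
  rcases ht.1.eq_or_lt with rfl | ht0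
  · have hJ : 0 < τ.J := Nat.pos_of_ne_zero fun h0 => by
      have := τ.t_last
      rw [h0, τ.t_zero] at this
      exact hT.ne this
    refine ⟨0, hJ, 0, ⟨le_rfl, zero_le_one⟩, by simp [τ.t_zero], fun U β => ?_⟩
    rw [timeInterp, Finset.sum_eq_zero fun j hj => indicator_of_notMem (fun hmem =>
      (τ.t_mem (Finset.mem_range.1 hj).le).1.not_gt hmem.1) _]
    simp
  · obtain ⟨j, hj, hmem⟩ := τ.exists_mem_Ioc ⟨ht0, ht.2⟩
    have hs := τ.step_pos hj
    refine ⟨j, hj, (t - τ.t j) / τ.step j, ⟨div_nonneg (sub_nonneg.2 hmem.1.le) hs.le,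
      (div_le_one hs).2 (sub_le_sub_right hmem.2 _)⟩, ?_, fun U β => ?_⟩
    · rw [div_mul_cancel₀ _ hs.ne']
      ring
    · rw [timeInterp, indicator_of_notMem (by simpa using ht0.ne'), zero_add,
        Finset.sum_eq_single_of_mem j (Finset.mem_range.2 hj), indicator_of_mem hmem]
      intro i hi hij
      refine indicator_of_notMem (fun hmem' => ?_) _
      have hi' := Finset.mem_range.1 hi
      rcases hij.lt_or_gt with hlt | hgt
      · exact (hmem'.2.trans (τ.t_le hlt hj.le)).not_gt hmem.1
      · exact (hmem.2.trans (τ.t_le hgt hi'.le)).not_gt hmem'.1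

lemma mul_gridWL1_lerp_le {c E : ℝ≥0∞} {X V W : Idx N → ℝ} {θ : ℝ} (hθ : θ ∈ Icc (0 : ℝ) 1)
    (hV : c * gridWL1 X V ≤ E) (hW : c * gridWL1 X W ≤ E) :
    c * gridWL1 X (fun β => V β + θ * (W β - V β)) ≤ E := by
  have h1 : gridWL1 X (fun β => V β + θ * (W β - V β))
      ≤ ENNReal.ofReal (1 - θ) * gridWL1 X V + ENNReal.ofReal θ * gridWL1 X W := by
    simp only [gridWL1, ← ENNReal.tsum_mul_left]
    rw [← ENNReal.tsum_add]
    refine ENNReal.tsum_le_tsum fun β => ?_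
    have h2 : V β + θ * (W β - V β) = (1 - θ) * V β + θ * W β := by ring
    rw [h2, mul_left_comm, mul_left_comm (ENNReal.ofReal θ), ← mul_add]
    refine mul_le_mul_right ((enorm_add_le _ _).trans (le_of_eq ?_)) _
    rw [enorm_mul, enorm_mul, Real.enorm_of_nonneg (sub_nonneg.2 hθ.2), Real.enorm_of_nonneg hθ.1]
  calc c * gridWL1 X (fun β => V β + θ * (W β - V β))
      ≤ c * (ENNReal.ofReal (1 - θ) * gridWL1 X V + ENNReal.ofReal θ * gridWL1 X W) :=
        mul_le_mul_right h1 _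
    _ = ENNReal.ofReal (1 - θ) * (c * gridWL1 X V) + ENNReal.ofReal θ * (c * gridWL1 X W) := by
        ring
    _ ≤ ENNReal.ofReal (1 - θ) * E + ENNReal.ofReal θ * E := by gcongr
    _ = E := by
        rw [← add_mul, ← ENNReal.ofReal_add (sub_nonneg.2 hθ.2) hθ.1, sub_add_cancel,
          ENNReal.ofReal_one, one_mul]

lemma mul_gridL1_lerp_le {c E : ℝ≥0∞} {V W : Idx N → ℝ} {θ : ℝ} (hθ : θ ∈ Icc (0 : ℝ) 1)
    (hV : c * gridL1 V ≤ E) (hW : c * gridL1 W ≤ E) :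
    c * gridL1 (fun β => V β + θ * (W β - V β)) ≤ E := by
  rw [← gridWL1_one] at hV hW ⊢
  exact mul_gridWL1_lerp_le hθ hV hW

lemma mul_gridL1_const_mul_le {c : ℝ≥0∞} {V : Idx N → ℝ} {θ ε b : ℝ} (hθ : θ ∈ Icc (0 : ℝ) 1)
    (hε : 0 ≤ ε) (hV : c * gridL1 V ≤ ENNReal.ofReal (ε + b)) :
    c * gridL1 (fun β => θ * V β) ≤ ENNReal.ofReal (ε + θ * b) := by
  rw [gridL1_const_mul, mul_left_comm, Real.enorm_of_nonneg hθ.1]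
  refine (mul_le_mul_right hV _).trans ?_
  rw [← ENNReal.ofReal_mul hθ.1]
  refine ENNReal.ofReal_le_ofReal ?_
  have := mul_le_of_le_one_left hε hθ.2
  linarith

/-- The path from `s` to `t` splits into a partial step, a stretch between nodes and another partial
step. Each costs `ε`, and their lengths add up to `t - s`. -/
lemma mul_gridL1_timeInterp_sub_le {c : ℝ≥0∞} {τ : TimeGrid T} (hT : 0 < T) {U : ℕ → Idx N → ℝ}
    {ε B : ℝ} (hε : 0 ≤ ε) (hB : 0 ≤ B)
    (hU : ∀ i j, i ≤ j → j ≤ τ.J →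
      c * gridL1 (fun β => U j β - U i β) ≤ ENNReal.ofReal (ε + B * (τ.t j - τ.t i)))
    {s t : ℝ} (hs : s ∈ Icc 0 T) (ht : t ∈ Icc 0 T) (hst : s ≤ t) :
    c * gridL1 (fun β => timeInterp τ U t β - timeInterp τ U s β)
      ≤ ENNReal.ofReal (3 * ε + B * (t - s)) := by
  obtain ⟨i, hi, θ, hθ, hsθ, hsU⟩ := exists_timeInterp_eq (N := N) τ hT hs
  obtain ⟨j, hj, ρ, hρ, htρ, htU⟩ := exists_timeInterp_eq (N := N) τ hT ht
  have hstep : ∀ l, τ.t (l + 1) = τ.t l + τ.step l := fun l => by rw [TimeGrid.step]; ring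
  simp only [hsU, htU]
  rcases lt_trichotomy i j with hij | rfl | hij
  · have e1 := mul_gridL1_const_mul_le hρ hε (hU j (j + 1) (Nat.le_succ j) hj)
    have e2 := hU (i + 1) j hij hj.le
    have e3 := mul_gridL1_const_mul_le (θ := 1 - θ) ⟨by linarith [hθ.2], by linarith [hθ.1]⟩ hε
      (hU i (i + 1) (Nat.le_succ i) hi)
    have hji : 0 ≤ τ.t j - τ.t (i + 1) := sub_nonneg.2 (τ.t_le hij hj.le)
    have hs1 := (τ.step_pos hi).le
    have hs2 := (τ.step_pos hj).le
    have hθ1 : 0 ≤ 1 - θ := by linarith [hθ.2]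
    have hρ0 := hρ.1
    rw [hstep j, add_sub_cancel_left] at e1
    rw [hstep i, add_sub_cancel_left] at e3
    calc _ ≤ c * (gridL1 (fun β => ρ * (U (j + 1) β - U j β)) + gridL1 (fun β => U j β - U (i + 1) β)
          + gridL1 (fun β => (1 - θ) * (U (i + 1) β - U i β))) := by
          refine mul_le_mul_right (le_trans (le_of_eq ?_) ((gridL1_add_le _ _).trans
            (add_le_add (gridL1_add_le _ _) le_rfl))) _
          congr 1
          funext β
          ring
      _ ≤ ENNReal.ofReal (ε + ρ * (B * τ.step j)) + ENNReal.ofReal (ε + B * (τ.t j - τ.t (i + 1)))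
          + ENNReal.ofReal (ε + (1 - θ) * (B * τ.step i)) := by
          rw [mul_add, mul_add]
          exact add_le_add (add_le_add e1 e2) e3
      _ = _ := by
          rw [← ENNReal.ofReal_add (by positivity) (by positivity),
            ← ENNReal.ofReal_add (by positivity) (by positivity)]
          congr 1
          rw [hsθ, htρ, hstep i]
          ring
  · have hst' : 0 < τ.step i := τ.step_pos hi
    have hθρ : θ ≤ ρ := by
      rw [hsθ, htρ] at hst
      exact le_of_mul_le_mul_right (by linarith) hst'
    have e1 := mul_gridL1_const_mul_le (θ := ρ - θ)
      ⟨sub_nonneg.2 hθρ, by linarith [hρ.2, hθ.1]⟩ hε (hU i (i + 1) (Nat.le_succ i) hi)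
    refine le_trans (le_of_eq ?_) (e1.trans (ENNReal.ofReal_le_ofReal ?_))
    · congr 2
      funext β
      ring
    · rw [hsθ, htρ, hstep i]
      linarith
  -- A node has two representations, at the end of one step and the start of the next, so this case
  -- is possible but forces `s = t`.
  · have hts : t ≤ s := by
      rw [hsθ, htρ]
      have h1 := τ.t_le hij hi.le
      rw [hstep] at h1
      have h2 := mul_le_of_le_one_left (τ.step_pos hj).le hρ.2
      have h3 := mul_nonneg hθ.1 (τ.step_pos hi).le
      linarith
    have heq : s = t := le_antisymm hst hts
    subst heq
    have : (fun β => (U j β + ρ * (U (j + 1) β - U j β)) - (U i β + θ * (U (i + 1) β - U i β)))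
        = fun _ => 0 := funext fun β => by rw [← hsU, ← htU, sub_self]
    rw [this]
    simp [gridL1]

namespace IsSchemeFamily

variable {F : ℝ → ℝ → Fin N → ℝ} {f : Fin N → ℝ → ℝ} {L : ℝ≥0} {φ : ℝ → ℝ}
  {z : ℝ → Idx N → Idx N} {ω : ℝ → Idx N → ℝ} {τ : ℝ → TimeGrid T}
  {u₀ : EuclideanSpace ℝ (Fin N) → ℝ} {k : EuclideanSpace ℝ (Fin N) × ℝ → ℝ}
  {U : ℝ → ℕ → Idx N → ℝ} {h : ℝ}


lemma exists_abs_timeInterp_le (hU : IsSchemeFamily F f L φ z ω τ u₀ k U) (hT : 0 < T) :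
    ∃ M, 0 ≤ M ∧ ∀ h ∈ Ioo (0 : ℝ) 1, ∀ t ∈ Icc 0 T, ∀ β, |timeInterp (τ h) (U h) t β| ≤ M := by
  obtain ⟨M, hM0, hM⟩ := hU.exists_abs_le
  refine ⟨M, hM0, fun h hh t ht β => ?_⟩
  obtain ⟨j, hj, θ, hθ, -, hj'⟩ := exists_timeInterp_eq (N := N) (τ h) hT ht
  rw [hj']
  have h1 := abs_le.1 (hM h hh j hj.le β)
  have h2 := abs_le.1 (hM h hh (j + 1) hj β)
  have h3 := hθ.1
  have h4 : 0 ≤ 1 - θ := by linarith [hθ.2]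
  rw [abs_le]
  constructor <;> nlinarith [mul_nonneg h3 (sub_nonneg.2 h2.1), mul_nonneg h3 (sub_nonneg.2 h2.2),
    mul_nonneg h4 (sub_nonneg.2 h1.1), mul_nonneg h4 (sub_nonneg.2 h1.2)]

lemma exists_gridL1_timeInterp_le (hU : IsSchemeFamily F f L φ z ω τ u₀ k U) (hT : 0 < T) :
    ∃ A : ℝ, 0 ≤ A ∧ ∀ h ∈ Ioo (0 : ℝ) 1, ∀ t ∈ Icc 0 T,
      ENNReal.ofReal (h ^ N) * gridL1 (timeInterp (τ h) (U h) t) ≤ ENNReal.ofReal A := by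
  obtain ⟨A, hA0, hA⟩ := hU.exists_gridL1_le
  refine ⟨A, hA0, fun h hh t ht => ?_⟩
  obtain ⟨j, hj, θ, hθ, -, hj'⟩ := exists_timeInterp_eq (N := N) (τ h) hT ht
  rw [funext (hj' (U h))]
  exact mul_gridL1_lerp_le hθ (hA h hh j hj.le) (hA h hh (j + 1) hj)

lemma exists_shiftDist_timeInterp_le (hU : IsSchemeFamily F f L φ z ω τ u₀ k U) (hT : 0 < T)
    {ε : ℝ} (hε : 0 < ε) :
    ∃ δ > 0, ∀ h ∈ Ioo (0 : ℝ) 1, ∀ t ∈ Icc 0 T, ∀ η, ‖gridPoint h η‖ ≤ δ →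
      ENNReal.ofReal (h ^ N) * shiftDist (timeInterp (τ h) (U h) t) η ≤ ENNReal.ofReal ε := by
  obtain ⟨δ, hδ, hs⟩ := hU.exists_shiftDist_le hε
  refine ⟨δ, hδ, fun h hh t ht η hη => ?_⟩
  obtain ⟨j, hj, θ, hθ, -, hj'⟩ := exists_timeInterp_eq (N := N) (τ h) hT ht
  refine le_trans (le_of_eq ?_)
    (mul_gridL1_lerp_le hθ (hs h hh j hj.le η hη) (hs h hh (j + 1) hj η hη))
  rw [funext (hj' (U h)), shiftDist]
  congr 2
  funext β
  ring

lemma lintegral_enorm_interp (hh : 0 < h) (V : Idx N → ℝ) :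
    ∫⁻ x, ‖V (cellIdx h x)‖ₑ = ENNReal.ofReal (h ^ N) * gridL1 V :=
  lintegral_comp_cellIdx hh fun β => ‖V β‖ₑ

/-- For `h ≤ h₀` a translation acts through at most `2 ^ N` lattice shifts, all short. For `h ≥ h₀`
the interpolants are steps on cells of side bounded below, and a small translation changes few of
the values. -/
lemma exists_lintegral_translate_le (hU : IsSchemeFamily F f L φ z ω τ u₀ k U) (hT : 0 < T)
    {ε : ℝ} (hε : 0 < ε) : ∃ δ > 0, ∀ h ∈ Ioo (0 : ℝ) 1, ∀ t ∈ Icc 0 T, ∀ w, ‖w‖ ≤ δ →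
      ∫⁻ x, ‖timeInterp (τ h) (U h) t (cellIdx h (x + w))
        - timeInterp (τ h) (U h) t (cellIdx h x)‖ₑ ≤ ENNReal.ofReal ε := by
  obtain ⟨A, hA0, hA⟩ := hU.exists_gridL1_timeInterp_le hT
  obtain ⟨δ, hδ, hs⟩ := hU.exists_shiftDist_timeInterp_le hT (ε := ε / 2 ^ N) (by positivity)
  -- Ensures `N * h ≤ δ / 2`, so that the lattice shifts have length at most `‖w‖ + N * h ≤ δ`.
  set h₀ : ℝ := δ / (2 * (N + 1)) with hh₀
  have hh₀0 : 0 < h₀ := by positivity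
  refine ⟨min (δ / 2) (h₀ * ε / (2 * (N * A + 1))), lt_min (by positivity) (by positivity),
    fun h hh t ht w hw => ?_⟩
  rcases le_total h h₀ with hle | hge
  · refine (lintegral_translate_sub_le_sum hh.1 _ w).trans ?_
    have h1 : ‖w‖ + N * h ≤ δ := by
      have h2 := hw.trans (min_le_left _ _)
      have h3 : N * h ≤ N * h₀ := by gcongr
      have h4 : (N + 1) * h₀ = δ / 2 := by rw [hh₀]; field_simp
      linarith
    calc _ ≤ ∑ η ∈ cellShifts h w, ENNReal.ofReal (ε / 2 ^ N) := Finset.sum_le_sum fun η hη =>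
          hs h hh t ht η ((norm_gridPoint_le_of_mem_cellShifts hh.1 hη).trans h1)
      _ = (cellShifts h w).card * ENNReal.ofReal (ε / 2 ^ N) := by simp
      _ ≤ (2 ^ N : ℕ) * ENNReal.ofReal (ε / 2 ^ N) := by
          gcongr
          exact card_cellShifts_le h w
      _ = ENNReal.ofReal ε := by
          rw [← ENNReal.ofReal_natCast, ← ENNReal.ofReal_mul (by positivity)]
          congr 1
          push_cast
          field_simp
  · refine (lintegral_translate_sub_le_of_large hh.1 _ w).trans ?_
    have h1 : ∑ i, ENNReal.ofReal (|w i| / h) ≤ ENNReal.ofReal (N * (‖w‖ / h₀)) := by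
      rw [← ENNReal.ofReal_sum_of_nonneg fun i _ => by have := hh.1; positivity]
      refine ENNReal.ofReal_le_ofReal ((Finset.sum_le_sum fun i _ => ?_).trans
        (le_of_eq (by simp) : ∑ _i : Fin N, ‖w‖ / h₀ ≤ _))
      have := PiLp.norm_apply_le w i
      rw [Real.norm_eq_abs] at this
      gcongr
    calc _ ≤ 2 * ENNReal.ofReal (N * (‖w‖ / h₀)) * ENNReal.ofReal A := by
          gcongr
          exact hA h hh t ht
      _ = ENNReal.ofReal (2 * (N * (‖w‖ / h₀)) * A) := by
          rw [ENNReal.ofReal_mul' hA0, ENNReal.ofReal_mul zero_le_two, ENNReal.ofReal_ofNat]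
      _ ≤ ENNReal.ofReal ε := ENNReal.ofReal_le_ofReal ?_
    have h2 := hw.trans (min_le_right _ _)
    rw [le_div_iff₀ (by positivity)] at h2
    have h3 : 2 * (N * (‖w‖ / h₀)) * A = (2 * (N * A) * ‖w‖) / h₀ := by ring
    rw [h3, div_le_iff₀ hh₀0]
    have := norm_nonneg w
    nlinarith

/-- Outside the ball of radius `R` the cutoff is at least `1/2`; replacing `x` by its grid point
loses at most `N / R`, which is absorbed using the total mass bound. -/
lemma exists_lintegral_tail_le (hU : IsSchemeFamily F f L φ z ω τ u₀ k U) (hT : 0 < T)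
    {ε : ℝ} (hε : 0 < ε) : ∃ R : ℝ, ∀ h ∈ Ioo (0 : ℝ) 1, ∀ t ∈ Icc 0 T,
      ∫⁻ x in {x | R ≤ ‖x‖}, ‖timeInterp (τ h) (U h) t (cellIdx h x)‖ₑ ≤ ENNReal.ofReal ε := by
  obtain ⟨A, hA0, hA⟩ := hU.exists_gridL1_timeInterp_le hT
  obtain ⟨R₀, hR₀, htail⟩ := hU.exists_tail_le hT (ε := ε / 4) (by positivity)
  -- The second entry makes `N / R * A ≤ ε / 4`, matching the tail bound `ε / 4`; the factor `2`
  -- from the cutoff then gives `ε`.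
  set R := max R₀ (4 * N * A / ε) with hR
  have hR0 : 0 < R := one_pos.trans_le (hR₀.trans (le_max_left _ _))
  refine ⟨R, fun h hh t ht => ?_⟩
  set V := timeInterp (τ h) (U h) t with hV
  have h1 : ENNReal.ofReal (h ^ N) * gridWL1 (fun β => cutoff R (gridPoint h β)) V
      ≤ ENNReal.ofReal (ε / 4) := by
    obtain ⟨j, hj, θ, hθ, -, hj'⟩ := exists_timeInterp_eq (N := N) (τ h) hT ht
    rw [hV, funext (hj' (U h))]
    exact mul_gridWL1_lerp_le hθ (htail R (le_max_left _ _) h hh j hj.le)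
      (htail R (le_max_left _ _) h hh (j + 1) hj)
  have hNR : 0 ≤ (N : ℝ) / R := by positivity
  have hpt : ∀ x : EuclideanSpace ℝ (Fin N), R ≤ ‖x‖ → ‖V (cellIdx h x)‖ₑ
      ≤ 2 * (ENNReal.ofReal (cutoff R (gridPoint h (cellIdx h x))) * ‖V (cellIdx h x)‖ₑ
        + ENNReal.ofReal (N / R) * ‖V (cellIdx h x)‖ₑ) := fun x hx => by
    rw [← add_mul, ← ENNReal.ofReal_add (cutoff_nonneg _ _) hNR, ← mul_assoc]
    refine le_mul_of_one_le_left zero_le ?_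
    have h2 := half_le_cutoff hR0 hx
    have h3 := cutoff_le_cutoff_gridPoint hR0 hh x
    have h4 : 1 ≤ ENNReal.ofReal (2 * (cutoff R (gridPoint h (cellIdx h x)) + N / R)) :=
      ENNReal.one_le_ofReal.2 (by linarith)
    rwa [ENNReal.ofReal_mul zero_le_two, ENNReal.ofReal_ofNat] at h4
  have hms : MeasurableSet {x : EuclideanSpace ℝ (Fin N) | R ≤ ‖x‖} :=
    measurableSet_le measurable_const measurable_norm
  have hmV : ∀ W : Idx N → ℝ≥0∞, Measurable fun x => W (cellIdx h x) := fun W =>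
    (measurable_of_countable W).comp (measurable_cellIdx h)
  calc _ ≤ ∫⁻ x in {x | R ≤ ‖x‖},
        2 * (ENNReal.ofReal (cutoff R (gridPoint h (cellIdx h x))) * ‖V (cellIdx h x)‖ₑ
          + ENNReal.ofReal (N / R) * ‖V (cellIdx h x)‖ₑ) := setLIntegral_mono' hms hpt
    _ ≤ ∫⁻ x, 2 * (ENNReal.ofReal (cutoff R (gridPoint h (cellIdx h x))) * ‖V (cellIdx h x)‖ₑ
          + ENNReal.ofReal (N / R) * ‖V (cellIdx h x)‖ₑ) := setLIntegral_le_lintegral _ _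
    _ = 2 * (ENNReal.ofReal (h ^ N) * gridWL1 (fun β => cutoff R (gridPoint h β)) V
          + ENNReal.ofReal (N / R) * (ENNReal.ofReal (h ^ N) * gridL1 V)) := by
        rw [lintegral_const_mul' _ _ (by simp), lintegral_add_left (hmV fun β =>
          ENNReal.ofReal (cutoff R (gridPoint h β)) * ‖V β‖ₑ),
          lintegral_const_mul' _ _ ENNReal.ofReal_ne_top, lintegral_enorm_interp hh.1,
          lintegral_comp_cellIdx hh.1 fun β => ENNReal.ofReal (cutoff R (gridPoint h β)) * ‖V β‖ₑ]
        rfl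
    _ ≤ 2 * (ENNReal.ofReal (ε / 4) + ENNReal.ofReal (N / R) * ENNReal.ofReal A) := by
        gcongr
        exact hA h hh t ht
    _ = ENNReal.ofReal (2 * (ε / 4 + N / R * A)) := by
        rw [ENNReal.ofReal_mul zero_le_two, ENNReal.ofReal_add (by positivity) (by positivity),
          ENNReal.ofReal_mul hNR, ENNReal.ofReal_ofNat]
    _ ≤ ENNReal.ofReal ε := ENNReal.ofReal_le_ofReal ?_
  have h5 : 4 * N * A / ε ≤ R := le_max_right _ _
  rw [div_le_iff₀ hε] at h5
  have h6 : N / R * A ≤ ε / 4 := by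
    rw [div_mul_eq_mul_div, div_le_iff₀ hR0]
    linarith
  linarith

lemma exists_lintegral_time_sub_le (hU : IsSchemeFamily F f L φ z ω τ u₀ k U) (hN : 0 < N)
    (hT : 0 < T) {ε : ℝ} (hε : 0 < ε) :
    ∃ δ > 0, ∀ h ∈ Ioo (0 : ℝ) 1, ∀ s ∈ Icc 0 T, ∀ t ∈ Icc 0 T, |t - s| < δ →
      ∫⁻ x, ‖timeInterp (τ h) (U h) t (cellIdx h x)
        - timeInterp (τ h) (U h) s (cellIdx h x)‖ₑ ≤ ENNReal.ofReal ε := by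
  -- Interpolation triples the constant: `3ε/4`, and `|t - s| < ε / (4 (B + 1))` leaves at most
  -- `ε/4` for the linear term.
  obtain ⟨B, hB0, hB⟩ := hU.exists_time_sub_le hN (ε := ε / 4) (by positivity)
  have key : ∀ h ∈ Ioo (0 : ℝ) 1, ∀ s ∈ Icc 0 T, ∀ t ∈ Icc 0 T, s ≤ t → |t - s| < ε / (4 * (B + 1)) →
      ENNReal.ofReal (h ^ N) * gridL1 (fun β => timeInterp (τ h) (U h) t β
        - timeInterp (τ h) (U h) s β) ≤ ENNReal.ofReal ε := fun h hh s hs t ht hst hlt => by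
    refine (mul_gridL1_timeInterp_sub_le hT (by positivity) hB0 (hB h hh) hs ht hst).trans
      (ENNReal.ofReal_le_ofReal ?_)
    rw [abs_of_nonneg (sub_nonneg.2 hst), lt_div_iff₀ (by positivity)] at hlt
    nlinarith [sub_nonneg.2 hst]
  refine ⟨ε / (4 * (B + 1)), by positivity, fun h hh s hs t ht hlt => ?_⟩
  rw [lintegral_enorm_interp hh.1 fun β => timeInterp (τ h) (U h) t β - timeInterp (τ h) (U h) s β]
  rcases le_total s t with hst | hst
  · exact key h hh s hs t ht hst hlt
  · rw [gridL1_sub_comm]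
    exact key h hh t ht s hs hst (by rwa [abs_sub_comm])

end IsSchemeFamily

end Interpolation

/-! ### Continuous curves in `L^r` and extraction of a subsequence. -/

section Precompactness

variable {N : ℕ} {T : ℝ}

/-- Scaling `v` by a small `c` makes its integral small enough for
`exists_eLpNorm_le_of_lintegral_le`; scaling back preserves membership. -/
lemma memLp_of_abs_le_of_lintegral_ne_top {α : Type*} [MeasurableSpace α] {μ : Measure α}
    {r : ℝ≥0∞} (hr1 : 1 ≤ r) (hr : r ≠ ∞) {v : α → ℝ} (hv : AEStronglyMeasurable v μ) {K : ℝ}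
    (hK : ∀ x, |v x| ≤ K) (hint : ∫⁻ x, ‖v x‖ₑ ∂μ ≠ ∞) : MemLp v r μ := by
  rcases isEmpty_or_nonempty α with hα | ⟨⟨x₀⟩⟩
  · rw [Subsingleton.elim v 0]
    exact MemLp.zero
  have hK0 : 0 ≤ K := (abs_nonneg _).trans (hK x₀)
  obtain ⟨e, he, h⟩ := exists_eLpNorm_le_of_lintegral_le (μ := μ) hr1 hr hK0 one_pos
  set I := (∫⁻ x, ‖v x‖ₑ ∂μ).toReal with hI
  have hI0 : 0 ≤ I := ENNReal.toReal_nonneg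
  set c : ℝ := min 1 (e / (I + 1)) with hc
  have hc0 : 0 < c := lt_min one_pos (by positivity)
  have h1 := h (fun x => c * v x) (fun x => by
    rw [abs_mul, abs_of_pos hc0]
    exact (mul_le_of_le_one_left (abs_nonneg _) (min_le_left _ _)).trans (hK x)) (by
    simp only [enorm_mul]
    rw [lintegral_const_mul' _ _ enorm_ne_top, Real.enorm_of_nonneg hc0.le,
      ← ENNReal.ofReal_toReal hint, ← hI, ← ENNReal.ofReal_mul hc0.le]
    refine ENNReal.ofReal_le_ofReal ?_
    calc c * I ≤ e / (I + 1) * (I + 1) := by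
          gcongr
          · exact min_le_right _ _
          · linarith
      _ = e := by field_simp)
  have h2 : MemLp (fun x => c * v x) r μ :=
    ⟨hv.const_mul c, h1.trans_lt ENNReal.ofReal_lt_top⟩
  have h3 := h2.const_mul c⁻¹
  simpa only [inv_mul_cancel_left₀ hc0.ne'] using h3

namespace IsSchemeFamily

variable {F : ℝ → ℝ → Fin N → ℝ} {f : Fin N → ℝ → ℝ} {L : ℝ≥0} {φ : ℝ → ℝ}
  {z : ℝ → Idx N → Idx N} {ω : ℝ → Idx N → ℝ} {τ : ℝ → TimeGrid T}
  {u₀ : EuclideanSpace ℝ (Fin N) → ℝ} {k : EuclideanSpace ℝ (Fin N) × ℝ → ℝ}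
  {U : ℝ → ℕ → Idx N → ℝ} {h : ℝ}


lemma measurable_interp (V : Idx N → ℝ) : Measurable fun x => V (cellIdx h x) :=
  (measurable_of_countable V).comp (measurable_cellIdx h)

lemma memLp_interp {r : ℝ≥0∞} [hr1 : Fact (1 ≤ r)] (hU : IsSchemeFamily F f L φ z ω τ u₀ k U)
    (hT : 0 < T) (hr : r ≠ ∞) (hh : h ∈ Ioo (0 : ℝ) 1) {t : ℝ} (ht : t ∈ Icc 0 T) :
    MemLp (fun x => timeInterp (τ h) (U h) t (cellIdx h x)) r volume := by
  obtain ⟨M, hM0, hM⟩ := hU.exists_abs_timeInterp_le hT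
  obtain ⟨A, hA0, hA⟩ := hU.exists_gridL1_timeInterp_le hT
  refine memLp_of_abs_le_of_lintegral_ne_top hr1.out hr
    (measurable_interp _).aestronglyMeasurable (fun x => hM h hh t ht _) ?_
  rw [lintegral_enorm_interp hh.1]
  exact ((hA h hh t ht).trans_lt ENNReal.ofReal_lt_top).ne

lemma exists_dist_interp_lt {r : ℝ≥0∞} [hr1 : Fact (1 ≤ r)]
    (hU : IsSchemeFamily F f L φ z ω τ u₀ k U) (hN : 0 < N) (hT : 0 < T) (hr : r ≠ ∞) {ε : ℝ}
    (hε : 0 < ε) : ∃ δ > 0, ∀ h (hh : h ∈ Ioo (0 : ℝ) 1) (s t : Icc (0 : ℝ) T), dist s t < δ →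
      dist ((hU.memLp_interp hT hr hh s.2).toLp _) ((hU.memLp_interp hT hr hh t.2).toLp _) < ε := by
  obtain ⟨M, hM0, hM⟩ := hU.exists_abs_timeInterp_le hT
  obtain ⟨e, he, hLr⟩ := exists_eLpNorm_le_of_lintegral_le
    (μ := (volume : Measure (EuclideanSpace ℝ (Fin N)))) hr1.out hr (K := 2 * M) (by positivity)
    (half_pos hε)
  obtain ⟨δ, hδ, ht⟩ := hU.exists_lintegral_time_sub_le hN hT he
  refine ⟨δ, hδ, fun h hh s t hst => lt_of_le_of_lt ?_ (half_lt_self hε)⟩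
  rw [Lp.dist_def]
  refine ENNReal.toReal_le_of_le_ofReal (half_pos hε).le ?_
  rw [eLpNorm_congr_ae ((MemLp.coeFn_toLp _).sub (MemLp.coeFn_toLp _))]
  refine hLr _ (fun x => (abs_sub _ _).trans ?_) (ht h hh t t.2 s s.2 hst)
  linarith [hM h hh s s.2 (cellIdx h x), hM h hh t t.2 (cellIdx h x)]

/-- The interpolants of a family of discrete solutions are continuous curves in `L^r` and form a
precompact family. -/
lemma exists_precompact_interp {r : ℝ≥0∞} [Fact (1 ≤ r)]
    (hU : IsSchemeFamily F f L φ z ω τ u₀ k U) (hN : 0 < N) (hT : 0 < T) (hr : r ≠ ∞) :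
    ∃ V : ℝ → C(Icc (0 : ℝ) T, Lp ℝ r (volume : Measure (EuclideanSpace ℝ (Fin N)))),
      (∀ h ∈ Ioo (0 : ℝ) 1, ∀ t : Icc (0 : ℝ) T,
        V h t =ᵐ[volume] fun x => timeInterp (τ h) (U h) t (cellIdx h x)) ∧
      ∀ s : ℕ → ℝ, (∀ n, s n ∈ Ioo (0 : ℝ) 1) →
        ∃ κ : ℕ → ℕ, StrictMono κ ∧
          ∃ u : C(Icc (0 : ℝ) T, Lp ℝ r (volume : Measure (EuclideanSpace ℝ (Fin N)))),
            Tendsto (fun n => V (s (κ n))) atTop (𝓝 u) := by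
  classical
  have hcont : ∀ h (hh : h ∈ Ioo (0 : ℝ) 1), Continuous fun t : Icc (0 : ℝ) T =>
      (hU.memLp_interp (r := r) hT hr hh t.2).toLp _ := fun h hh => by
    refine Metric.continuous_iff.2 fun t ε hε => ?_
    obtain ⟨δ, hδ, hd⟩ := hU.exists_dist_interp_lt (r := r) hN hT hr hε
    exact ⟨δ, hδ, fun s hs => hd h hh s t hs⟩
  let V : ℝ → C(Icc (0 : ℝ) T, Lp ℝ r (volume : Measure (EuclideanSpace ℝ (Fin N)))) := fun h =>
    if hh : h ∈ Ioo (0 : ℝ) 1 then ⟨_, hcont h hh⟩ else 0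
  have hV : ∀ h (hh : h ∈ Ioo (0 : ℝ) 1) (t : Icc (0 : ℝ) T),
      V h t = (hU.memLp_interp (r := r) hT hr hh t.2).toLp _ := fun h hh t => by
    simp only [V, dif_pos hh]
    rfl
  have hVae : ∀ h ∈ Ioo (0 : ℝ) 1, ∀ t : Icc (0 : ℝ) T,
      V h t =ᵐ[volume] fun x => timeInterp (τ h) (U h) t (cellIdx h x) := fun h hh t => by
    rw [hV h hh]
    exact MemLp.coeFn_toLp _
  refine ⟨V, hVae, fun s hs => exists_subseq_tendsto_of_equicontinuous (fun n => V (s n)) ?_ ?_⟩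
  · obtain ⟨M, hM0, hM⟩ := hU.exists_abs_timeInterp_le hT
    -- The criterion is applied to the interpolants of all mesh sizes at all times at once.
    refine TotallyBounded.subset ?_ (totallyBounded_Lp_of_translation hr
      (𝓕 := {v | ∃ h ∈ Ioo (0 : ℝ) 1, ∃ t ∈ Icc 0 T,
        v = fun x => timeInterp (τ h) (U h) t (cellIdx h x)}) hM0 ?_ ?_ ?_ ?_)
    · rintro _ ⟨n, t, rfl⟩
      exact ⟨_, ⟨s n, hs n, t, t.2, rfl⟩, hVae (s n) (hs n) t⟩
    · rintro _ ⟨h, hh, t, ht, rfl⟩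
      exact measurable_interp _
    · rintro _ ⟨h, hh, t, ht, rfl⟩ x
      exact hM h hh t ht _
    · intro ε hε
      obtain ⟨δ, hδ, hd⟩ := hU.exists_lintegral_translate_le hT hε
      refine ⟨δ, hδ, ?_⟩
      rintro _ ⟨h, hh, t, ht, rfl⟩ w hw
      exact hd h hh t ht w hw
    · intro ε hε
      obtain ⟨R, hR⟩ := hU.exists_lintegral_tail_le hT hε
      refine ⟨R, ?_⟩
      rintro _ ⟨h, hh, t, ht, rfl⟩
      exact hR h hh t ht
  · intro t
    refine Metric.equicontinuousAt_iff.2 fun ε hε => ?_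
    obtain ⟨δ, hδ, hd⟩ := hU.exists_dist_interp_lt (r := r) hN hT hr hε
    refine ⟨δ, hδ, fun s' hs' n => ?_⟩
    rw [hV _ (hs n), hV _ (hs n)]
    exact hd _ (hs n) t s' (by rwa [dist_comm])

end IsSchemeFamily

end Precompactness

end ConvDiff

end

/-! ### The main theorem. -/

open ConvDiff in
theorem theorem5p4 {N : ℕ} (hN : 0 < N) {T : ℝ} (hT : 0 < T)
    (r : ℝ≥0∞) [Fact (1 ≤ r)] (hr : r ≠ ∞)
    (f : Fin N → ℝ → ℝ) (φ : ℝ → ℝ)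
    (hf : ∀ i, LocallyLipschitz (f i)) (hφ : LocallyLipschitz φ) (hφ_mono : Monotone φ)
    (g : EuclideanSpace ℝ (Fin N) → ℝ → ℝ)
    (hg_meas : AEStronglyMeasurable (fun p : EuclideanSpace ℝ (Fin N) × ℝ => g p.1 p.2)
      ((volume : Measure (EuclideanSpace ℝ (Fin N))).prod (volume.restrict (Ioo 0 T))))
    (hg : ∫⁻ t in Ioo 0 T, (eLpNorm (fun x => g x t) 1 volume
      + eLpNorm (fun x => g x t) ∞ volume) < ∞)
    (u₀ : EuclideanSpace ℝ (Fin N) → ℝ) (hu₀_one : MemLp u₀ 1 volume)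
    (hu₀_top : MemLp u₀ ∞ volume)
    (F : ℝ → ℝ → Fin N → ℝ) (LF : ℝ≥0) (hF : IsNumericalFlux F f LF)
    (z : ℝ → Idx N → Idx N) (ω : ℝ → Idx N → ℝ) (hω : LevyWeights z ω)
    (hcase : (∀ h ∈ Ioo (0 : ℝ) 1, ∀ ψ : Idx N → ℝ, (Summable fun β => |ψ β|) →
          latticeOp (z h) (ω h) ψ = discLaplacian h ψ)
        ∨ FirstMomentWeights z ω
        ∨ FractionalWeights z ω)
    (τ : ℝ → TimeGrid T)
    (hCFL : ∀ h ∈ Ioo (0 : ℝ) 1, ∀ j < (τ h).J, 2 * (N : ℝ) * LF * (τ h).step j ≤ h)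
    (U : ℝ → ℕ → Idx N → ℝ)
    (hU : ∀ h ∈ Ioo (0 : ℝ) 1, IsSchemeSolution h (τ h) F φ (z h) (ω h) u₀ g (U h)) :
    ∃ V : ℝ → C(Icc (0 : ℝ) T, Lp ℝ r (volume : Measure (EuclideanSpace ℝ (Fin N)))),
      (∀ h ∈ Ioo (0 : ℝ) 1, ∀ t : Icc (0 : ℝ) T,
        V h t =ᵐ[volume] fun x => spaceTimeInterp h (τ h) (U h) x t) ∧
      ∀ s : ℕ → ℝ, (∀ k, s k ∈ Ioo (0 : ℝ) 1) →
        ∃ κ : ℕ → ℕ, StrictMono κ ∧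
          ∃ u : C(Icc (0 : ℝ) T, Lp ℝ r (volume : Measure (EuclideanSpace ℝ (Fin N)))),
            Tendsto (fun n => V (s (κ n))) atTop (𝓝 u) := by
  obtain ⟨k, hk, hki, hk_top, hkg⟩ := exists_integrable_source hg_meas hg
  -- The three alternatives are used only through this common consequence.
  have htight : UniformlyTight z ω := by
    rcases hcase with hΔ | h1 | h2
    · exact uniformlyTight_of_discLaplacian hω.1 hΔ
    · exact h1.uniformlyTight
    · exact h2.uniformlyTight
  have hfam : IsSchemeFamily F f LF φ z ω τ u₀ k U :=
    { flux := hF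
      lipschitz := hφ
      mono := hφ_mono
      levy := hω
      tight := htight
      cfl := hCFL
      init_one := hu₀_one
      init_top := hu₀_top
      meas := hk
      integrable := hki
      source_top := hk_top
      summable := fun h hh j hj => ((hU h hh).summable j hj).of_abs
      init := fun h hh => (hU h hh).init
      step := fun h hh j hj β => by
        rw [← hkg h (τ h) j hj β]
        exact (hU h hh).step j hj β }
  obtain ⟨V, hV, hcomp⟩ := hfam.exists_precompact_interp (r := r) hN hT hr
  refine ⟨V, fun h hh t => (hV h hh t).trans (ae_of_all _ fun x => ?_), hcomp⟩
  exact (spaceTimeInterp_eq hh.1 (τ h) (U h) x t).symm
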